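/- Let $n\ge 0$ and $T\in\mathbb R$. Let $(\Omega_t)_{t\in(0,T)}$ be bounded open subsets of $\mathbb R^{n+1}$ with smooth boundary hypersurfaces $M_t=\partial\Omega_t$ and outward unit normal $\nu$, evolving by a smooth one-parameter family of diffeomorphisms: $\bar\Omega_t=\phi_t(\bar\Omega)$ and $M_t=\phi_t(\partial\Omega)$, where $\Omega\subset\mathbb R^{n+1}$ is a bounded open set with smooth boundary, $\phi(\cdot,\cdot)$ is smooth on $\bar\Omega\times(0,T)$, and each $\phi_t:\bar\Omega\to\bar\Omega_t$ is a diffeomorphism. Let $\tau(t)>0$ satisfy $\frac{\partial\tau}{\partial t}=-1$ on $(0,T)$. Let $f(x,t)$ be a smooth function on $\{(x,t): 0<t<T,\ x\in\bar\Omega_t\}$ (smooth up to $M_t$) which satisfies $$\Big(\frac{\partial}{\partial t}+\Delta\Big)f=|\nabla f|^2+\frac{n+1}{2\tau}\quad\text{in }\Omega_t,\ t\in(0,T),$$ and suppose that the sets evolve along the negative gradient of $f$, i.e. $x=\phi_t(q)$ satisfies $\frac{\partial x}{\partial t}=-\nabla f(x,t)$ for $q\in\Omega$, $t\in(0,T)$.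 Put $$u=\frac{e^{-f}}{(4\pi\tau)^{\frac{n+1}{2}}},\qquad W=\tau(2\Delta f-|\nabla f|^2)+f-(n+1),$$ and, for a function $\beta(\cdot,t)$ on $M_t$, $$\mathcal W_\beta(\Omega_t,f(t),\tau(t))=\int_{\Omega_t}\big(\tau|\nabla f|^2+f-(n+1)\big)u\,dx+2\tau\int_{M_t}\beta u\,dS .$$ Then $$\frac{d}{dt}\int_{\Omega_t}u\,dx=0\qquad\text{for all }t\in(0,T).$$ If in addition $\nabla f\cdot\nu=\beta$ on $M_t$ for all $t\in(0,T)$, then for all $t\in(0,T)$ the derivative of $\mathcal W_\beta$ exists and $$\frac{d}{dt}\mathcal W_\beta(\Omega_t,f(t),\tau(t))=2\tau\int_{\Omega_t}\Big|\nabla_i\nabla_jf-\frac{\delta_{ij}}{2\tau}\Big|^2u\,dx-\int_{M_t}\nabla W\cdot\nu\,u\,dS .$$ -/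

import Mathlib

open Set MeasureTheory
open scoped ContDiff InnerProductSpace

namespace EvolvingDomain

noncomputable section

/-- `ρ` is a smooth local defining function of `Ω` on the open neighbourhood `U` of `x`:
`Ω ∩ U = {ρ < 0} ∩ U` and `∇ρ(x) ≠ 0`. -/
structure IsLocalDefiningFunction {n : ℕ} (Ω : Set (EuclideanSpace ℝ (Fin (n + 1))))
    (x : EuclideanSpace ℝ (Fin (n + 1))) (U : Set (EuclideanSpace ℝ (Fin (n + 1))))
    (ρ : EuclideanSpace ℝ (Fin (n + 1)) → ℝ) : Prop where
  isOpen : IsOpen U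
  mem : x ∈ U
  contDiffOn : ContDiffOn ℝ ∞ ρ U
  gradient_ne_zero : gradient ρ x ≠ 0
  mem_iff : ∀ y ∈ U, y ∈ Ω ↔ ρ y < 0

/-- A bounded open subset of `ℝⁿ⁺¹` whose boundary is a smooth hypersurface (with the set lying
locally on one side of it). The set need not be connected. -/
structure IsSmoothBoundedDomain {n : ℕ} (Ω : Set (EuclideanSpace ℝ (Fin (n + 1)))) : Prop where
  isOpen : IsOpen Ω
  isBounded : Bornology.IsBounded Ω
  smooth_boundary : ∀ x ∈ frontier Ω, ∃ U ρ, IsLocalDefiningFunction Ω x U ρ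

open Classical in
/-- The outward unit normal of `Ω` at a boundary point `x`: the normalized gradient `∇ρ / |∇ρ|`
at `x` of a local defining function `ρ` of `Ω` (by `outerUnitNormal_eq` below, of any such
function). It is given the value `0` where there is no local defining function. -/
def outerUnitNormal {n : ℕ} (Ω : Set (EuclideanSpace ℝ (Fin (n + 1))))
    (x : EuclideanSpace ℝ (Fin (n + 1))) : EuclideanSpace ℝ (Fin (n + 1)) :=
  if h : ∃ ρ, ∃ U, IsLocalDefiningFunction Ω x U ρ then
    ‖gradient h.choose x‖⁻¹ • gradient h.choose x
  else 0

/-- The outward unit normal does not depend on the choice of the defining function. -/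
theorem outerUnitNormal_eq {n : ℕ} {Ω U : Set (EuclideanSpace ℝ (Fin (n + 1)))}
    {x : EuclideanSpace ℝ (Fin (n + 1))} {ρ : EuclideanSpace ℝ (Fin (n + 1)) → ℝ}
    (hx : x ∈ frontier Ω) (hΩ : IsOpen Ω) (h : IsLocalDefiningFunction Ω x U ρ) :
    outerUnitNormal Ω x = ‖gradient ρ x‖⁻¹ • gradient ρ x := by
  classical
  have key : ∀ {U₁ U₂ : Set (EuclideanSpace ℝ (Fin (n + 1)))}
      {ρ₁ ρ₂ : EuclideanSpace ℝ (Fin (n + 1)) → ℝ}, IsLocalDefiningFunction Ω x U₁ ρ₁ →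
      IsLocalDefiningFunction Ω x U₂ ρ₂ →
      ‖gradient ρ₁ x‖⁻¹ • gradient ρ₁ x = ‖gradient ρ₂ x‖⁻¹ • gradient ρ₂ x := by
    intro U₁ U₂ ρ₁ ρ₂ h₁ h₂
    have hxΩ : x ∉ Ω := by rw [hΩ.frontier_eq] at hx; exact hx.2
    have nonneg : 0 ≤ ρ₂ x := not_lt.1 fun hlt => hxΩ ((h₂.mem_iff x h₂.mem).2 hlt)
    have hc₁ : ContDiffAt ℝ ∞ ρ₁ x := h₁.contDiffOn.contDiffAt (h₁.isOpen.mem_nhds h₁.mem)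
    have hc₂ : ContDiffAt ℝ ∞ ρ₂ x := h₂.contDiffOn.contDiffAt (h₂.isOpen.mem_nhds h₂.mem)
    have nonpos : ρ₁ x ≤ 0 := by
      by_contra! hpos
      obtain ⟨y, ⟨hy1, hy2⟩, hyΩ⟩ := mem_closure_iff_nhds.1 (frontier_subset_closure hx) _
        (Filter.inter_mem (h₁.isOpen.mem_nhds h₁.mem)
          (hc₁.continuousAt.eventually (lt_mem_nhds hpos)))
      have := (h₁.mem_iff y hy1).1 hyΩ
      have hy2 : 0 < ρ₁ y := hy2
      linarith
    have line : ∀ {ρ : EuclideanSpace ℝ (Fin (n + 1)) → ℝ}, ContDiffAt ℝ ∞ ρ x →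
        ∀ v, HasDerivAt (fun s : ℝ => ρ (x + s • v)) ⟪gradient ρ x, v⟫_ℝ 0 := by
      intro ρ hρ v
      have hg := (hρ.differentiableAt (by simp)).hasGradientAt.hasFDerivAt
      have hl : HasDerivAt (fun s : ℝ => x + s • v) v 0 := by
        simpa using ((hasDerivAt_id (0 : ℝ)).smul_const v).const_add x
      have hg' : HasFDerivAt ρ ((InnerProductSpace.toDual ℝ _) (gradient ρ x))
          (x + (0 : ℝ) • v) := by simpa using hg
      have hcomp := hg'.comp_hasDerivAt (0 : ℝ) hl
      rwa [InnerProductSpace.toDual_apply_apply] at hcomp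
    have cone : ∀ v, ⟪gradient ρ₁ x, v⟫_ℝ < 0 → ⟪gradient ρ₂ x, v⟫_ℝ ≤ 0 := by
      intro v hv
      by_contra! hpos
      have hcont : Filter.Tendsto (fun s : ℝ => x + s • v) (nhdsWithin 0 (Ioi 0)) (nhds x) := by
        have : Continuous fun s : ℝ => x + s • v := by fun_prop
        simpa using (this.tendsto 0).mono_left (nhdsWithin_le_nhds (s := Ioi 0))
      have hIoi : Ioi (0 : ℝ) ⊆ {0}ᶜ := fun s hs => (ne_of_gt hs : s ≠ 0)
      have e₁ := ((hasDerivAt_iff_tendsto_slope_zero.1 (line hc₁ v)).mono_left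
        (nhdsWithin_mono 0 hIoi)).eventually (gt_mem_nhds hv)
      have e₂ := ((hasDerivAt_iff_tendsto_slope_zero.1 (line hc₂ v)).mono_left
        (nhdsWithin_mono 0 hIoi)).eventually (lt_mem_nhds hpos)
      obtain ⟨s, h1, h2, h3, h4, h5⟩ := (e₁.and (e₂.and
        ((hcont.eventually (h₁.isOpen.mem_nhds h₁.mem)).and
          ((hcont.eventually (h₂.isOpen.mem_nhds h₂.mem)).and
            (eventually_mem_nhdsWithin (a := (0 : ℝ)) (s := Ioi 0)))))).exists
      have hs : 0 < s := h5
      simp only [zero_add, zero_smul, add_zero, smul_eq_mul] at h1 h2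
      have h1' : ρ₁ (x + s • v) - ρ₁ x < 0 := by
        by_contra! hc; exact absurd h1 (not_lt.2 (mul_nonneg (inv_pos.2 hs).le hc))
      have h2' : 0 < ρ₂ (x + s • v) - ρ₂ x := pos_of_mul_pos_right h2 (inv_pos.2 hs).le
      have := (h₂.mem_iff _ h4).1 ((h₁.mem_iff _ h3).2 (by linarith))
      linarith
    set a := gradient ρ₁ x with ha
    set b := gradient ρ₂ x with hb
    have ha0 : 0 < ‖a‖ := norm_pos_iff.2 h₁.gradient_ne_zero
    have hb0 : 0 < ‖b‖ := norm_pos_iff.2 h₂.gradient_ne_zero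
    by_contra hne
    have hab : ⟪a, b⟫_ℝ < ‖a‖ * ‖b‖ := inner_lt_norm_mul_iff_real.2 fun heq => hne <| by
      have hscale := congrArg (fun w => (‖a‖⁻¹ * ‖b‖⁻¹) • w) heq
      simp only [smul_smul] at hscale
      rwa [mul_assoc, inv_mul_cancel₀ hb0.ne', mul_one, mul_right_comm,
        inv_mul_cancel₀ ha0.ne', one_mul] at hscale
    have hcone := cone (‖a‖ • b - ‖b‖ • a) (by
      rw [inner_sub_right, real_inner_smul_right, real_inner_smul_right,
        real_inner_self_eq_norm_sq]
      nlinarith)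
    rw [inner_sub_right, real_inner_smul_right, real_inner_smul_right,
      real_inner_self_eq_norm_sq, real_inner_comm] at hcone
    nlinarith
  have hex : ∃ ρ, ∃ U, IsLocalDefiningFunction Ω x U ρ := ⟨ρ, U, h⟩
  rw [outerUnitNormal, dif_pos hex]
  obtain ⟨V, hV⟩ := hex.choose_spec
  exact key hV h

/-- `Φ` restricts to a smooth diffeomorphism of `s` onto `t`. -/
def IsDiffeoOn {n : ℕ} (Φ : EuclideanSpace ℝ (Fin (n + 1)) → EuclideanSpace ℝ (Fin (n + 1)))
    (s t : Set (EuclideanSpace ℝ (Fin (n + 1)))) : Prop :=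
  BijOn Φ s t ∧ ContDiffOn ℝ ∞ Φ s ∧
    ∃ Ψ : EuclideanSpace ℝ (Fin (n + 1)) → EuclideanSpace ℝ (Fin (n + 1)),
      LeftInvOn Ψ Φ s ∧ ContDiffOn ℝ ∞ Ψ t

/-- `(Ω t)`, `t ∈ (0, T)`, is a family of bounded open sets with smooth boundary, evolving through
the smooth one-parameter family of diffeomorphisms `φ t : closure Ω₀ → closure (Ω t)`, which carry
`∂Ω₀` onto `∂(Ω t)`. -/
structure IsSmoothEvolution {n : ℕ} (T : ℝ) (Ω₀ : Set (EuclideanSpace ℝ (Fin (n + 1))))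
    (Ω : ℝ → Set (EuclideanSpace ℝ (Fin (n + 1))))
    (φ : ℝ → EuclideanSpace ℝ (Fin (n + 1)) → EuclideanSpace ℝ (Fin (n + 1))) : Prop where
  reference : IsSmoothBoundedDomain Ω₀
  domain : ∀ t ∈ Ioo 0 T, IsSmoothBoundedDomain (Ω t)
  contDiffOn : ContDiffOn ℝ ∞ (fun p : ℝ × EuclideanSpace ℝ (Fin (n + 1)) => φ p.1 p.2)
    (Ioo 0 T ×ˢ closure Ω₀)
  diffeo : ∀ t ∈ Ioo 0 T, IsDiffeoOn (φ t) (closure Ω₀) (closure (Ω t))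
  image_frontier : ∀ t ∈ Ioo 0 T, φ t '' frontier Ω₀ = frontier (Ω t)

/-- The closed space-time region `{(t, x) : 0 < t < T, x ∈ closure (Ω t)}`. -/
def spaceTime {n : ℕ} (T : ℝ) (Ω : ℝ → Set (EuclideanSpace ℝ (Fin (n + 1)))) :
    Set (ℝ × EuclideanSpace ℝ (Fin (n + 1))) :=
  {p | p.1 ∈ Ioo 0 T ∧ p.2 ∈ closure (Ω p.1)}

/-- `u = e^{-f} / (4πτ)^{(n+1)/2}`. -/
def density {n : ℕ} (f : EuclideanSpace ℝ (Fin (n + 1)) → ℝ) (τ : ℝ)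
    (x : EuclideanSpace ℝ (Fin (n + 1))) : ℝ :=
  Real.exp (-f x) / (4 * Real.pi * τ) ^ (((n : ℝ) + 1) / 2)

/-- The functional
`𝒲_β(Ω, f, τ) = ∫_Ω (τ|∇f|² + f - (n+1)) u dx + 2τ ∫_{∂Ω} β u dS`,
where `dS` is the `n`-dimensional Hausdorff measure (normalized to agree with Lebesgue measure in
`ℝⁿ`) on `∂Ω`. -/
def entropyW {n : ℕ} (β : EuclideanSpace ℝ (Fin (n + 1)) → ℝ)
    (Ω : Set (EuclideanSpace ℝ (Fin (n + 1)))) (f : EuclideanSpace ℝ (Fin (n + 1)) → ℝ)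
    (τ : ℝ) : ℝ :=
  (∫ x in Ω, (τ * ‖gradient f x‖ ^ 2 + f x - ((n : ℝ) + 1)) * density f τ x) +
    2 * τ * ∫ x in frontier Ω, β x * density f τ x ∂μHE[n]

/-- `W = τ(2Δf - |∇f|²) + f - (n+1)` on `closure Ω`. Derivatives are taken within `closure Ω`: they
are the usual ones in `Ω`, and the one-sided ones (continuous extensions) on `∂Ω`. -/
def harnackW {n : ℕ} (Ω : Set (EuclideanSpace ℝ (Fin (n + 1))))
    (f : EuclideanSpace ℝ (Fin (n + 1)) → ℝ) (τ : ℝ) (x : EuclideanSpace ℝ (Fin (n + 1))) : ℝ :=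
  τ * (2 * InnerProductSpace.laplacianWithin f (closure Ω) x -
    ‖gradientWithin f (closure Ω) x‖ ^ 2) + f x - ((n : ℝ) + 1)

/-- The entry `∇ᵢ∇ⱼf(x)` of the Hessian. -/
def hessian {n : ℕ} (f : EuclideanSpace ℝ (Fin (n + 1)) → ℝ)
    (x : EuclideanSpace ℝ (Fin (n + 1))) (i j : Fin (n + 1)) : ℝ :=
  fderiv ℝ (fderiv ℝ f) x (EuclideanSpace.single i 1) (EuclideanSpace.single j 1)

/-- `|∇ᵢ∇ⱼf - δᵢⱼ/(2τ)|²`, the squared Euclidean (Hilbert–Schmidt) norm of this 2-tensor. -/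
def solitonDefect {n : ℕ} (f : EuclideanSpace ℝ (Fin (n + 1)) → ℝ) (τ : ℝ)
    (x : EuclideanSpace ℝ (Fin (n + 1))) : ℝ :=
  ∑ i, ∑ j, (hessian f x i j - (if i = j then 1 else 0) / (2 * τ)) ^ 2

/-- The setting: `(Ω t)` evolves along `∂x/∂t = -∇f(x, t)` where `f`, smooth on the closed
space-time region, solves `(∂/∂t + Δ) f = |∇f|² + (n+1)/(2τ)` in `Ω t`, and `τ > 0`,
`∂τ/∂t = -1`, for `t ∈ (0, T)`. -/
structure IsGradientEvolution {n : ℕ} (T : ℝ) (Ω₀ : Set (EuclideanSpace ℝ (Fin (n + 1))))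
    (Ω : ℝ → Set (EuclideanSpace ℝ (Fin (n + 1))))
    (φ : ℝ → EuclideanSpace ℝ (Fin (n + 1)) → EuclideanSpace ℝ (Fin (n + 1)))
    (f : ℝ → EuclideanSpace ℝ (Fin (n + 1)) → ℝ) (τ : ℝ → ℝ) : Prop where
  evolution : IsSmoothEvolution T Ω₀ Ω φ
  contDiffOn : ContDiffOn ℝ ∞ (fun p : ℝ × EuclideanSpace ℝ (Fin (n + 1)) => f p.1 p.2)
    (spaceTime T Ω)
  flow : ∀ t ∈ Ioo 0 T, ∀ q ∈ Ω₀,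
    HasDerivAt (fun s => φ s q) (-gradient (f t) (φ t q)) t
  equation : ∀ t ∈ Ioo 0 T, ∀ x ∈ Ω t,
    deriv (fun s => f s x) t + Laplacian.laplacian (f t) x =
      ‖gradient (f t) x‖ ^ 2 + ((n : ℝ) + 1) / (2 * τ t)
  tau_pos : ∀ t ∈ Ioo 0 T, 0 < τ t
  tau_deriv : ∀ t ∈ Ioo 0 T, HasDerivAt τ (-1) t

end

end EvolvingDomain

open EvolvingDomain

/-!
# Monotonicity of the `𝒲`-functional on evolving domains

Along the flow `∂ₜφ = -∇f(φ)` the spatial differential satisfies `∂ₜDφ = -(∇²f) Dφ`, so by Jacobi's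
formula `∂ₜ|det Dφ| = -Δf |det Dφ|`. The equation for `f` and `∂ₜτ = -1` say exactly that
`u = e^{-f} / (4πτ)^{(n+1)/2}` satisfies `∂ₜ(u ∘ φ) = Δf (u ∘ φ)`. Hence `|det Dφ| (u ∘ φ)` is
constant in time: the flow preserves the measure `u dx`
(`IsGradientEvolution.hasDerivAt_abs_det_mul_density`). Pulling integrals back to the fixed domain
`Ω₀` and differentiating under the integral sign gives the transport theorem
`d/dt ∫ G u = ∫ (∂ₜG - ∇f · ∇G) u` (`IsGradientEvolution.hasDerivAt_integral_mul_density`), whose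
case `G = 1` is the conservation of mass.

For the entropy, integration by parts turns the drift Laplacian `Δ - ∇f · ∇` into a boundary term:
`∫_Ω (ΔG - ∇f · ∇G) u = ∫_∂Ω (∇G · ν) u` (`IsGradientEvolution.integral_driftLaplacian`). With
`G = f` and `∇f · ν = β` this shows `𝒲_β = ∫_Ω W u`. A computation with the derivatives of `f` up
to order four gives the pointwise identity
`(∂ₜ + Δ - 2∇f · ∇) W = 2τ |∇²f - δ/(2τ)|²` (`IsGradientEvolution.evolution_harnack`). So the
transport theorem with `G = W` produces the integrand
`(∂ₜW - ∇f · ∇W) u = 2τ |∇²f - δ/(2τ)|² u - (ΔW - ∇f · ∇W) u`, and the last term is the boundary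
integral of `∇W · ν`.

The analytic ingredient is the divergence theorem on a smooth bounded domain, with the Hausdorff
measure as surface measure (`IsSmoothBoundedDomain.integral_fderiv_eq`). Locally the domain lies
below a graph over a hyperplane (`exists_isLocalGraph`). There Fubini and the fundamental theorem of
calculus apply, and the surface measure is computed by an area formula
(`setIntegral_image_euclideanHausdorffMeasure`), which follows from the differentiation theorem for
measures. A partition of unity globalizes. Smoothness up to the boundary is expressed by derivatives
within the closed space-time region; they are unique because that region is the image of
`(0, T) × closure Ω₀` under a map with surjective differential
(`IsSmoothEvolution.uniqueDiffOn_spaceTime`).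
-/

namespace EvolvingDomain

open Filter Topology Module

/-! ### Smooth bounded domains -/

section Domain

variable {n : ℕ} {Ω U : Set (EuclideanSpace ℝ (Fin (n + 1)))}
  {x : EuclideanSpace ℝ (Fin (n + 1))} {ρ : EuclideanSpace ℝ (Fin (n + 1)) → ℝ}

theorem IsLocalDefiningFunction.contDiffAt (h : IsLocalDefiningFunction Ω x U ρ)
    {y : EuclideanSpace ℝ (Fin (n + 1))} (hy : y ∈ U) : ContDiffAt ℝ ∞ ρ y :=
  h.contDiffOn.contDiffAt (h.isOpen.mem_nhds hy)

theorem IsLocalDefiningFunction.eq_zero_of_mem_frontier (h : IsLocalDefiningFunction Ω x U ρ)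
    (hΩ : IsOpen Ω) {y : EuclideanSpace ℝ (Fin (n + 1))} (hy : y ∈ frontier Ω) (hyU : y ∈ U) :
    ρ y = 0 := by
  apply le_antisymm
  · by_contra! hpos
    obtain ⟨z, ⟨hz1, hz2⟩, hzΩ⟩ := mem_closure_iff_nhds.1 (frontier_subset_closure hy) _
      (Filter.inter_mem (h.isOpen.mem_nhds hyU)
        ((h.contDiffAt hyU).continuousAt.eventually (lt_mem_nhds hpos)))
    have h1 := (h.mem_iff z hz1).1 hzΩ
    have h2 : 0 < ρ z := hz2
    linarith
  · by_contra! hneg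
    rw [hΩ.frontier_eq] at hy
    exact hy.2 ((h.mem_iff y hyU).2 hneg)

theorem IsLocalDefiningFunction.continuousOn_gradient (h : IsLocalDefiningFunction Ω x U ρ) :
    ContinuousOn (gradient ρ) U := by
  have h1 : ContinuousOn (fderiv ℝ ρ) U :=
    h.contDiffOn.continuousOn_fderiv_of_isOpen h.isOpen (by simp)
  exact ((InnerProductSpace.toDual ℝ _).symm.continuous.comp_continuousOn h1)

theorem IsLocalDefiningFunction.hasStrictFDerivAt (h : IsLocalDefiningFunction Ω x U ρ)
    {y : EuclideanSpace ℝ (Fin (n + 1))} (hy : y ∈ U) :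
    HasStrictFDerivAt ρ (innerSL ℝ (gradient ρ y)) y := by
  have h1 := (h.contDiffAt hy).hasStrictFDerivAt (by simp)
  have h2 : innerSL ℝ (gradient ρ y) = fderiv ℝ ρ y := by
    ext v
    simp [gradient]
  rwa [h2]

/-- A local defining function at `x` is one at all nearby boundary points. -/
theorem IsLocalDefiningFunction.recenter (h : IsLocalDefiningFunction Ω x U ρ)
    {y : EuclideanSpace ℝ (Fin (n + 1))} (hy : y ∈ U) (hg : gradient ρ y ≠ 0) :
    IsLocalDefiningFunction Ω y U ρ :=
  ⟨h.isOpen, hy, h.contDiffOn, hg, h.mem_iff⟩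

theorem IsSmoothBoundedDomain.isCompact_closure (h : IsSmoothBoundedDomain Ω) :
    IsCompact (closure Ω) :=
  h.isBounded.isCompact_closure

theorem IsSmoothBoundedDomain.isCompact_frontier (h : IsSmoothBoundedDomain Ω) :
    IsCompact (frontier Ω) :=
  h.isCompact_closure.of_isClosed_subset isClosed_frontier frontier_subset_closure

theorem IsSmoothBoundedDomain.continuousOn_outerUnitNormal (h : IsSmoothBoundedDomain Ω) :
    ContinuousOn (outerUnitNormal Ω) (frontier Ω) := by
  intro x hx
  obtain ⟨U, ρ, hρ⟩ := h.smooth_boundary x hx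
  have hc : ContinuousAt (gradient ρ) x :=
    hρ.continuousOn_gradient.continuousAt (hρ.isOpen.mem_nhds hρ.mem)
  have h1 : ContinuousAt (fun y => ‖gradient ρ y‖⁻¹ • gradient ρ y) x :=
    (hc.norm.inv₀ (norm_ne_zero_iff.2 hρ.gradient_ne_zero)).smul hc
  refine h1.continuousWithinAt.congr_of_eventuallyEq ?_ (outerUnitNormal_eq hx h.isOpen hρ)
  filter_upwards [self_mem_nhdsWithin,
    mem_nhdsWithin_of_mem_nhds (hρ.isOpen.mem_nhds hρ.mem),
    mem_nhdsWithin_of_mem_nhds (hc.eventually_ne hρ.gradient_ne_zero)] with y hy hyU hyg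
  exact outerUnitNormal_eq hy h.isOpen (hρ.recenter hyU hyg)

/-- Near a boundary point the domain contains an open convex cone with that point as its vertex,
so derivatives within the closed domain are unique. -/
theorem IsSmoothBoundedDomain.uniqueDiffOn_closure (h : IsSmoothBoundedDomain Ω) :
    UniqueDiffOn ℝ (closure Ω) := by
  intro x hx
  rw [uniqueDiffWithinAt_closure]
  by_cases hxΩ : x ∈ Ω
  · exact h.isOpen.uniqueDiffWithinAt hxΩ
  have hxf : x ∈ frontier Ω := by rw [h.isOpen.frontier_eq]; exact ⟨hx, hxΩ⟩
  obtain ⟨U, ρ, hρ⟩ := h.smooth_boundary x hxf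
  have hx0 := hρ.eq_zero_of_mem_frontier h.isOpen hxf hρ.mem
  set G := gradient ρ x with hG
  have hGpos : 0 < ‖G‖ := norm_pos_iff.2 hρ.gradient_ne_zero
  have hd := (hρ.hasStrictFDerivAt hρ.mem).hasFDerivAt.isLittleO.def (half_pos hGpos)
  obtain ⟨r, hr, hball⟩ := Metric.eventually_nhds_iff_ball.1
    (hd.and (hρ.isOpen.mem_nhds hρ.mem))
  set C := {y | ⟪G, y - x⟫_ℝ + ‖G‖ / 2 * ‖y - x‖ < 0} with hC
  have hCconv : Convex ℝ C := by
    have hc : ConvexOn ℝ univ (fun w : EuclideanSpace ℝ (Fin (n + 1)) =>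
        ⟪G, w⟫_ℝ + ‖G‖ / 2 * ‖w‖) :=
      ((innerSL ℝ G).toLinearMap.convexOn convex_univ).add
        (convexOn_univ_norm.smul (half_pos hGpos).le)
    have := (hc.translate_right (-x)).convex_lt 0
    have hCeq : C = {y | y ∈ (fun z => -x + z) ⁻¹' univ ∧
        ((fun w : EuclideanSpace ℝ (Fin (n + 1)) => ⟪G, w⟫_ℝ + ‖G‖ / 2 * ‖w‖) ∘
          fun z => -x + z) y < 0} := by
      ext y
      simp [hC, sub_eq_neg_add]
    rwa [hCeq]
  have hCopen : IsOpen C := isOpen_lt (by fun_prop) continuous_const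
  have hsub : C ∩ Metric.ball x r ⊆ Ω := by
    rintro y ⟨hy, hyb⟩
    obtain ⟨h1, h2⟩ := hball y hyb
    refine (hρ.mem_iff y h2).2 ?_
    simp only [hx0, sub_zero, innerSL_apply_apply, Real.norm_eq_abs] at h1
    have hy : ⟪G, y - x⟫_ℝ + ‖G‖ / 2 * ‖y - x‖ < 0 := hy
    linarith [(abs_le.1 h1).2]
  -- the points `x - s G`, for small `s > 0`, lie in the cone
  have hmem : ∀ s : ℝ, 0 < s → x - s • G ∈ C := by
    intro s hs
    simp only [hC, mem_ofPred_eq, sub_sub_cancel_left, inner_neg_right, norm_neg, norm_smul,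
      real_inner_smul_right, real_inner_self_eq_norm_sq, Real.norm_eq_abs, abs_of_pos hs]
    nlinarith [mul_pos hs (mul_pos hGpos hGpos)]
  have htend : Tendsto (fun s : ℝ => x - s • G) (𝓝[>] 0) (𝓝 x) := by
    have : Continuous fun s : ℝ => x - s • G := by fun_prop
    simpa using (this.tendsto 0).mono_left (nhdsWithin_le_nhds (s := Ioi 0))
  have hev : ∀ᶠ s in 𝓝[>] (0 : ℝ), x - s • G ∈ C ∩ Metric.ball x r := by
    filter_upwards [self_mem_nhdsWithin, htend.eventually (Metric.ball_mem_nhds x hr)] with s hs hb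
    exact ⟨hmem s hs, hb⟩
  refine (uniqueDiffWithinAt_convex (hCconv.inter (convex_ball x r)) ?_ ?_).mono hsub
  · rw [(hCopen.inter Metric.isOpen_ball).interior_eq]
    exact hev.exists.elim fun s hs => ⟨_, hs⟩
  · exact mem_closure_of_tendsto htend hev

end Domain

/-! ### The area formula for graphs -/

section Area

open Measure

/-- If `p` expands distances by at most `K` compared with `q`, then the Hausdorff measures of the
images of a set under `p` and `q` compare accordingly. -/
theorem euclideanHausdorffMeasure_image_le_of_edist_le {X Y Z : Type*} [EMetricSpace Y]
    [MeasurableSpace Y] [BorelSpace Y] [EMetricSpace Z] [MeasurableSpace Z] [BorelSpace Z]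
    {p : X → Y} {q : X → Z} {A : Set X} {K : NNReal} (d : ℕ)
    (h : ∀ x ∈ A, ∀ y ∈ A, edist (p x) (p y) ≤ K * edist (q x) (q y)) :
    μHE[d] (p '' A) ≤ (K : ENNReal) ^ d * μHE[d] (q '' A) := by
  rcases A.eq_empty_or_nonempty with rfl | ⟨x0, -⟩
  · simp
  have : Nonempty X := ⟨x0⟩
  -- the map `q x ↦ p x`, which the hypothesis makes well defined and Lipschitz
  set g : Z → Y := fun z => p (Function.invFunOn q A z) with hg
  have hinv : ∀ x ∈ A, Function.invFunOn q A (q x) ∈ A ∧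
      q (Function.invFunOn q A (q x)) = q x := fun x hx =>
    ⟨Function.invFunOn_mem ⟨x, hx, rfl⟩, Function.invFunOn_eq ⟨x, hx, rfl⟩⟩
  have hgq : ∀ x ∈ A, g (q x) = p x := by
    intro x hx
    have h1 := h _ (hinv x hx).1 x hx
    rw [(hinv x hx).2, edist_self, mul_zero] at h1
    exact edist_eq_zero.1 (le_antisymm h1 bot_le)
  have himg : p '' A = g '' (q '' A) := by
    rw [image_image]
    exact image_congr fun x hx => (hgq x hx).symm
  have hlip : LipschitzOnWith K g (q '' A) := by
    rintro _ ⟨x, hx, rfl⟩ _ ⟨y, hy, rfl⟩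
    rw [hgq x hx, hgq y hy]
    exact h x hx y hy
  have hH := hlip.hausdorffMeasure_image_le (d := d) (by simp)
  rw [himg, euclideanHausdorffMeasure_def, euclideanHausdorffMeasure_def, Measure.smul_apply,
    Measure.smul_apply, nnreal_smul_coe_apply, nnreal_smul_coe_apply, mul_left_comm]
  gcongr
  simpa using hH

variable {V F : Type*} [NormedAddCommGroup V] [InnerProductSpace ℝ V] [FiniteDimensional ℝ V]
  [MeasurableSpace V] [BorelSpace V] [NormedAddCommGroup F] [InnerProductSpace ℝ F]
  [MeasurableSpace F] [BorelSpace F]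

/-- Near a point where `ψ` has the injective strict derivative `A`, the maps `ψ` and `A` distort
distances by nearly the same factor. -/
theorem tendsto_euclideanHausdorffMeasure_image_closedBall_div {ψ : V → F} {A : V →L[ℝ] F} {y : V}
    (hψ : HasStrictFDerivAt ψ A y) (hA : Function.Injective A) :
    Tendsto (fun r => μHE[finrank ℝ V] (ψ '' Metric.closedBall y r) /
      volume (Metric.closedBall y r)) (𝓝[>] 0) (𝓝 (ENNReal.ofReal A.toLinearMap.normDet)) := by
  set J := ENNReal.ofReal A.toLinearMap.normDet with hJ
  set d := finrank ℝ V with hd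
  obtain ⟨K, hK0, hK⟩ := A.toLinearMap.exists_antilipschitzWith (LinearMap.ker_eq_bot.2 hA)
  have hKv : ∀ v, ‖v‖ ≤ K * ‖A v‖ := fun v => by
    simpa [dist_eq_norm] using hK.le_mul_dist v 0
  have hK0' : (0 : ℝ) < K := by exact_mod_cast hK0
  have key : ∀ ε : ℝ, 0 < ε → ε < 1 → ∀ᶠ r in 𝓝[>] (0 : ℝ),
      μHE[d] (ψ '' Metric.closedBall y r) / volume (Metric.closedBall y r) ≤
        ENNReal.ofReal ((1 + ε) ^ d) * J ∧
      J ≤ ENNReal.ofReal (((1 - ε)⁻¹) ^ d) *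
        (μHE[d] (ψ '' Metric.closedBall y r) / volume (Metric.closedBall y r)) := by
    intro ε hε hε1
    have hev := hψ.isLittleO.def (div_pos hε hK0')
    rw [nhds_prod_eq] at hev
    obtain ⟨r0, hr0, hball⟩ := (Metric.nhds_basis_ball.prod_self.eventually_iff).1 hev
    filter_upwards [Ioo_mem_nhdsGT hr0] with r hr
    set B := Metric.closedBall y r with hB
    have hvol0 : volume B ≠ 0 := (Metric.measure_closedBall_pos volume y hr.1).ne'
    have hvolt : volume B ≠ ⊤ := measure_closedBall_lt_top.ne
    have hclose : ∀ a ∈ B, ∀ b ∈ B, ‖ψ a - ψ b - (A a - A b)‖ ≤ ε * ‖A a - A b‖ := by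
      intro a ha b hb
      have h1 := @hball (a, b) ⟨Metric.closedBall_subset_ball hr.2 ha,
        Metric.closedBall_subset_ball hr.2 hb⟩
      simp only [map_sub] at h1
      refine h1.trans ?_
      calc ε / K * ‖a - b‖ ≤ ε / K * (K * ‖A (a - b)‖) := by gcongr; exact hKv _
        _ = ε * ‖A a - A b‖ := by rw [map_sub]; field_simp
    have hlin : μHE[d] (A '' B) = J * volume B :=
      A.toLinearMap.euclideanHausdorffMeasure_image_eq_normDet_mul_volume B
    have tonn : ∀ {a b c d' : F} {k : ℝ} (hk : 0 ≤ k), ‖a - b‖ ≤ k * ‖c - d'‖ →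
        edist a b ≤ (k.toNNReal : ENNReal) * edist c d' := by
      intro a b c d' k hk hle
      rw [edist_dist, edist_dist, dist_eq_norm, dist_eq_norm]
      change _ ≤ ENNReal.ofReal k * _
      rw [← ENNReal.ofReal_mul hk]
      exact ENNReal.ofReal_le_ofReal hle
    have h1 : μHE[d] (ψ '' B) ≤ ((1 + ε).toNNReal : ENNReal) ^ d * μHE[d] (A '' B) := by
      refine euclideanHausdorffMeasure_image_le_of_edist_le d fun a ha b hb =>
        tonn (by linarith) ?_
      have := hclose a ha b hb
      have h2 := norm_le_norm_add_norm_sub' (ψ a - ψ b) (A a - A b)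
      linarith
    have h2 : μHE[d] (A '' B) ≤ (((1 - ε)⁻¹).toNNReal : ENNReal) ^ d * μHE[d] (ψ '' B) := by
      refine euclideanHausdorffMeasure_image_le_of_edist_le d fun a ha b hb =>
        tonn (inv_nonneg.2 (by linarith)) ?_
      have := hclose a ha b hb
      have h2 := norm_le_norm_add_norm_sub (ψ a - ψ b) (A a - A b)
      rw [inv_mul_eq_div, le_div_iff₀ (by linarith)]
      linarith
    have e1 : ((1 + ε).toNNReal : ENNReal) ^ d = ENNReal.ofReal ((1 + ε) ^ d) :=
      (ENNReal.ofReal_pow (by linarith) d).symm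
    have e2 : (((1 - ε)⁻¹).toNNReal : ENNReal) ^ d = ENNReal.ofReal (((1 - ε)⁻¹) ^ d) :=
      (ENNReal.ofReal_pow (inv_nonneg.2 (by linarith)) d).symm
    rw [e1, hlin, ← mul_assoc] at h1
    rw [e2, hlin] at h2
    constructor
    · exact (ENNReal.div_le_iff hvol0 hvolt).2 h1
    · rw [← mul_div_assoc]
      exact (ENNReal.le_div_iff_mul_le (Or.inl hvol0) (Or.inl hvolt)).2 h2
  have hJt : J ≠ ⊤ := ENNReal.ofReal_ne_top
  refine tendsto_order.2 ⟨fun c hc => ?_, fun c hc => ?_⟩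
  · have hlim : Tendsto (fun ε : ℝ => ENNReal.ofReal (((1 - ε)⁻¹) ^ d) * c) (𝓝[>] 0) (𝓝 c) := by
      have h1 : Tendsto (fun ε : ℝ => ((1 - ε)⁻¹) ^ d) (𝓝 0) (𝓝 1) := by
        have : ContinuousAt (fun ε : ℝ => ((1 - ε)⁻¹) ^ d) 0 := by
          refine ContinuousAt.pow (ContinuousAt.inv₀ (by fun_prop) (by simp)) d
        simpa using this.tendsto
      have h2 := ENNReal.Tendsto.mul_const (b := c) (ENNReal.tendsto_ofReal h1)
        (Or.inl (by simp))
      simpa using h2.mono_left nhdsWithin_le_nhds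
    obtain ⟨ε, h1, h2⟩ := ((hlim.eventually (gt_mem_nhds hc)).and
      (Ioo_mem_nhdsGT (zero_lt_one' ℝ))).exists
    filter_upwards [key ε h2.1 h2.2] with r hr
    by_contra! hcon
    exact absurd (hr.2.trans (mul_le_mul_right hcon _)) (not_le.2 h1)
  · have hlim : Tendsto (fun ε : ℝ => ENNReal.ofReal ((1 + ε) ^ d) * J) (𝓝[>] 0) (𝓝 J) := by
      have h1 : Tendsto (fun ε : ℝ => (1 + ε) ^ d) (𝓝 0) (𝓝 1) := by
        have : ContinuousAt (fun ε : ℝ => (1 + ε) ^ d) 0 := by fun_prop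
        simpa using this.tendsto
      have h2 := ENNReal.Tendsto.mul_const (b := J) (ENNReal.tendsto_ofReal h1)
        (Or.inl (by simp))
      simpa using h2.mono_left nhdsWithin_le_nhds
    obtain ⟨ε, h1, h2⟩ := ((hlim.eventually (gt_mem_nhds hc)).and
      (Ioo_mem_nhdsGT (zero_lt_one' ℝ))).exists
    filter_upwards [key ε h2.1 h2.2] with r hr
    exact hr.1.trans_lt h1

end Area

section Area

open Measure

variable {V F : Type*} [NormedAddCommGroup V] [InnerProductSpace ℝ V] [FiniteDimensional ℝ V]
  [MeasurableSpace V] [BorelSpace V] [NormedAddCommGroup F] [InnerProductSpace ℝ F]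
  [MeasurableSpace F] [BorelSpace F]

/-- The surface measure of the parametrized piece `ψ '' B`, transported to the parameter domain by
a left inverse `π` of `ψ`, has the norm determinant of `Dψ` as its Lebesgue density: by the
differentiation theorem for measures it is enough to know the ratio of the measures of small
balls. -/
theorem setIntegral_image_euclideanHausdorffMeasure [CompleteSpace F] {ψ : V → F} {π : F → V}
    {A : V → V →L[ℝ] F} {B : Set V} {K : NNReal} (hB : IsOpen B) (hBv : volume B ≠ ⊤)
    (hlip : LipschitzOnWith K ψ B) (hπ : Measurable π) (hπψ : ∀ y ∈ B, π (ψ y) = y)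
    (hψ : ∀ y ∈ B, HasStrictFDerivAt ψ (A y) y) (hA : ∀ y ∈ B, Function.Injective (A y))
    {h : F → ℝ} (hh : ContinuousOn (fun y => h (ψ y)) B) :
    ∫ x in ψ '' B, h x ∂μHE[finrank ℝ V] =
      ∫ y in B, (A y).toLinearMap.normDet * h (ψ y) := by
  set d := finrank ℝ V with hd
  set m : Measure V := (μHE[d].restrict (ψ '' B)).map π with hm
  have himage : ∀ s : Set V, ψ '' B ∩ π ⁻¹' s = ψ '' (B ∩ s) := by
    intro s
    ext x
    constructor
    · rintro ⟨⟨y, hy, rfl⟩, hs⟩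
      exact ⟨y, ⟨hy, by simpa [hπψ y hy] using hs⟩, rfl⟩
    · rintro ⟨y, ⟨hy, hs⟩, rfl⟩
      exact ⟨⟨y, hy, rfl⟩, by simpa [hπψ y hy] using hs⟩
  have hmapply : ∀ s, MeasurableSet s → m s = μHE[d] (ψ '' (B ∩ s)) := by
    intro s hs
    rw [hm, Measure.map_apply hπ hs, Measure.restrict_apply (hπ hs), inter_comm, himage]
  have hlipm : ∀ s ⊆ B, μHE[d] (ψ '' s) ≤ (K : ENNReal) ^ d * volume s := by
    intro s hs
    have h1 := euclideanHausdorffMeasure_image_le_of_edist_le (p := ψ) (q := id) (A := s) (K := K) d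
      (fun x hx y hy => hlip (hs hx) (hs hy))
    rwa [image_id, InnerProductSpace.euclideanHausdorffMeasure_eq_volume] at h1
  have hfin : IsFiniteMeasure m := by
    refine ⟨?_⟩
    rw [hmapply _ MeasurableSet.univ, inter_univ]
    exact (hlipm B subset_rfl).trans_lt
      (ENNReal.mul_lt_top (ENNReal.pow_lt_top ENNReal.coe_lt_top) hBv.lt_top)
  have hac : m ≪ volume := by
    refine AbsolutelyContinuous.mk fun s hs h0 => ?_
    rw [hmapply s hs]
    refine le_antisymm ((hlipm _ inter_subset_left).trans ?_) bot_le
    rw [measure_mono_null inter_subset_right h0, mul_zero]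
  -- the Radon-Nikodym derivative is the limit of the ratios of small balls
  have hrn : ∀ᵐ y ∂(volume : Measure V), y ∈ B →
      m.rnDeriv volume y = ENNReal.ofReal (A y).toLinearMap.normDet := by
    filter_upwards [Besicovitch.ae_tendsto_rnDeriv m volume] with y hy hyB
    refine tendsto_nhds_unique hy
      ((tendsto_euclideanHausdorffMeasure_image_closedBall_div (hψ y hyB) (hA y hyB)).congr' ?_)
    obtain ⟨r0, hr0, hball⟩ := Metric.isOpen_iff.1 hB y hyB
    filter_upwards [Ioo_mem_nhdsGT hr0] with r hr
    rw [hmapply _ measurableSet_closedBall,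
      inter_eq_right.2 ((Metric.closedBall_subset_ball hr.2).trans hball)]
  have hmB : m Bᶜ = 0 := by
    rw [hmapply _ hB.measurableSet.compl, inter_compl_self, image_empty, measure_empty]
  have hmres : m.restrict B = m := restrict_eq_self_of_ae_mem (by
    rw [ae_iff]; exact hmB)
  have hinj : InjOn ψ B := fun a ha b hb hab => by rw [← hπψ a ha, ← hπψ b hb, hab]
  have hSm : MeasurableSet (ψ '' B) := hB.measurableSet.image_of_continuousOn_injOn
    hlip.continuousOn hinj
  have hae : AEStronglyMeasurable (fun y => h (ψ y)) m := by
    rw [← hmres]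
    exact ((hh.aestronglyMeasurable (μ := volume) hB.measurableSet)).mono_ac
      (hac.restrict B)
  calc ∫ x in ψ '' B, h x ∂μHE[d] = ∫ x in ψ '' B, h (ψ (π x)) ∂μHE[d] := by
        refine setIntegral_congr_fun hSm ?_
        rintro _ ⟨y, hy, rfl⟩
        simp only [hπψ y hy]
    _ = ∫ y, h (ψ y) ∂m := by rw [hm, integral_map hπ.aemeasurable hae]
    _ = ∫ y in B, h (ψ y) ∂m := by rw [hmres]
    _ = ∫ y in B, h (ψ y) ∂(volume.withDensity (m.rnDeriv volume)) := by
        rw [Measure.withDensity_rnDeriv_eq _ _ hac]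
    _ = ∫ y in B, (m.rnDeriv volume y).toReal * h (ψ y) := by
        rw [setIntegral_withDensity_eq_setIntegral_toReal_smul (Measure.measurable_rnDeriv _ _) _ _
          hB.measurableSet]
        · rfl
        · exact ae_restrict_of_ae (Measure.rnDeriv_lt_top _ _)
    _ = ∫ y in B, (A y).toLinearMap.normDet * h (ψ y) := by
        refine setIntegral_congr_ae hB.measurableSet ?_
        filter_upwards [hrn] with y hy hyB
        rw [hy hyB, ENNReal.toReal_ofReal (LinearMap.normDet_nonneg _)]

end Area

section Slope

variable {E : Type*} [NormedAddCommGroup E] [InnerProductSpace ℝ E]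

/-- The parametrization `v ↦ v - (⟪G, v⟫ / ⟪G, e⟫) e` of the hyperplane `Gᗮ` over the
hyperplane `eᗮ`. -/
noncomputable def hyperplaneGraph (e G : E) : (ℝ ∙ e)ᗮ →L[ℝ] E :=
  (ℝ ∙ e)ᗮ.subtypeL - (((⟪G, e⟫_ℝ)⁻¹ • innerSL ℝ G).comp (ℝ ∙ e)ᗮ.subtypeL).smulRight e

theorem hyperplaneGraph_apply (e G : E) (v : (ℝ ∙ e)ᗮ) :
    hyperplaneGraph e G v = (v : E) - ((⟪G, e⟫_ℝ)⁻¹ * ⟪G, (v : E)⟫_ℝ) • e := by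
  simp [hyperplaneGraph]

theorem inner_coe_orthogonal_span_singleton (e : E) (v : (ℝ ∙ e)ᗮ) : ⟪e, (v : E)⟫_ℝ = 0 :=
  Submodule.mem_orthogonal_singleton_iff_inner_right.1 v.2

theorem hyperplaneGraph_injective {e : E} (he : ‖e‖ = 1) (G : E) :
    Function.Injective (hyperplaneGraph e G) := by
  refine (injective_iff_map_eq_zero _).2 fun v hv => ?_
  rw [hyperplaneGraph_apply] at hv
  have h1 := congrArg (fun w => ⟪e, w⟫_ℝ) hv
  simp only [inner_sub_right, inner_coe_orthogonal_span_singleton, real_inner_smul_right,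
    real_inner_self_eq_norm_sq, he, inner_zero_right] at h1
  have h2 : (⟪G, e⟫_ℝ)⁻¹ * ⟪G, (v : E)⟫_ℝ = 0 := by linarith
  rw [h2, zero_smul, sub_zero] at hv
  exact_mod_cast hv

/-- The area element of a graph: Gram's formula gives `1 + |a|²` for the square, where `a` is the
slope, and `|a|² = ‖G‖² / ⟪G, e⟫² - 1` by Pythagoras. -/
theorem normDet_hyperplaneGraph [FiniteDimensional ℝ E] {e : E} (he : ‖e‖ = 1) {G : E}
    (hG : 0 < ⟪G, e⟫_ℝ) :
    (hyperplaneGraph e G).toLinearMap.normDet = ‖G‖ / ⟪G, e⟫_ℝ := by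
  have hnn := LinearMap.normDet_nonneg (hyperplaneGraph e G).toLinearMap
  rw [← sq_eq_sq₀ hnn (by positivity)]
  set b := stdOrthonormalBasis ℝ (ℝ ∙ e)ᗮ with hb
  have hgram := (hyperplaneGraph e G).toLinearMap.normDet_sq_eq_det_gram b
  simp only [RCLike.ofReal_real_eq_id, id_eq] at hgram
  rw [hgram]
  set a : Fin (finrank ℝ (ℝ ∙ e)ᗮ) → ℝ := fun i => (⟪G, e⟫_ℝ)⁻¹ * ⟪G, (b i : E)⟫_ℝ with ha
  have hmat : Matrix.gram ℝ (fun i => (hyperplaneGraph e G).toLinearMap (b i)) =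
      1 + Matrix.replicateCol (Fin 1) a * Matrix.replicateRow (Fin 1) a := by
    ext i j
    have hbij : ⟪(b i : E), (b j : E)⟫_ℝ = if i = j then 1 else 0 := by
      have := orthonormal_iff_ite.1 b.orthonormal i j
      exact_mod_cast this
    have hbe : ⟪(b i : E), e⟫_ℝ = 0 := by
      rw [real_inner_comm]; exact inner_coe_orthogonal_span_singleton e (b i)
    simp only [Matrix.gram_apply, ContinuousLinearMap.coe_coe, hyperplaneGraph_apply,
      inner_sub_left, inner_sub_right, real_inner_smul_left, real_inner_smul_right, hbij, hbe,
      inner_coe_orthogonal_span_singleton, real_inner_self_eq_norm_sq, he, Matrix.add_apply,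
      Matrix.one_apply, Matrix.mul_apply, Matrix.replicateCol_apply, Matrix.replicateRow_apply,
      Finset.univ_unique, Finset.sum_const, Finset.card_singleton, ha]
    ring
  have hdet : (1 + Matrix.replicateCol (Fin 1) a * Matrix.replicateRow (Fin 1) a).det =
      1 + a ⬝ᵥ a := by
    rw [Matrix.det_one_add_mul_comm, Matrix.det_unique, Matrix.add_apply, Matrix.one_apply_eq,
      Matrix.replicateRow_mul_replicateCol_apply]
  rw [hmat, hdet]
  -- Pythagoras: `‖G‖² = ⟪G, e⟫² + ∑ ⟪G, bᵢ⟫²`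
  have hsum : ∑ i, ⟪G, (b i : E)⟫_ℝ ^ 2 = ‖G‖ ^ 2 - ⟪G, e⟫_ℝ ^ 2 := by
    have h1 := b.sum_sq_norm_inner_right ((ℝ ∙ e)ᗮ.orthogonalProjectionOnto G)
    have h2 : ∀ i, ⟪b i, (ℝ ∙ e)ᗮ.orthogonalProjectionOnto G⟫_ℝ = ⟪G, (b i : E)⟫_ℝ := by
      intro i
      rw [real_inner_comm]
      simp
    simp only [h2, Real.norm_eq_abs, sq_abs] at h1
    rw [h1]
    have h3 := Submodule.norm_sq_eq_add_norm_sq_projection G (ℝ ∙ e)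
    have h4 : ‖(ℝ ∙ e).orthogonalProjectionOnto G‖ ^ 2 = ⟪G, e⟫_ℝ ^ 2 := by
      have : ‖(ℝ ∙ e).orthogonalProjectionOnto G‖ = ‖(ℝ ∙ e).starProjection G‖ := rfl
      rw [this, Submodule.starProjection_unit_singleton ℝ he, norm_smul, he, mul_one,
        Real.norm_eq_abs, sq_abs, real_inner_comm]
    linarith
  have hdot : a ⬝ᵥ a = (⟪G, e⟫_ℝ)⁻¹ ^ 2 * ∑ i, ⟪G, (b i : E)⟫_ℝ ^ 2 := by
    simp only [dotProduct, ha, Finset.mul_sum]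
    exact Finset.sum_congr rfl fun i _ => by ring
  rw [hdot, hsum]
  field_simp
  ring

end Slope

section Coordinates

variable {E : Type*} [NormedAddCommGroup E] [InnerProductSpace ℝ E] [FiniteDimensional ℝ E]
  [MeasurableSpace E] [BorelSpace E]

/-- Lebesgue measure splits along the direction `e`. -/
theorem measurePreserving_add_smul {e : E} (he : ‖e‖ = 1) :
    MeasurePreserving (fun p : (ℝ ∙ e)ᗮ × ℝ => (p.1 : E) + p.2 • e) := by
  have h1 : MeasurePreserving (LinearIsometryEquiv.toSpanUnitSingleton e he) volume volume :=
    LinearIsometryEquiv.measurePreserving _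
  have h2 := ((ℝ ∙ e).measurePreserving_measurableEquivProd (0 : E)).symm
  rw [InnerProductSpace.euclideanHausdorffMeasure_eq_volume] at h2
  have h3 := (h2.comp (h1.prod (MeasurePreserving.id (volume : Measure (ℝ ∙ e)ᗮ)))).comp
    (Measure.measurePreserving_swap (μ := (volume : Measure (ℝ ∙ e)ᗮ)) (ν := (volume : Measure ℝ)))
  have hf : (fun p : (ℝ ∙ e)ᗮ × ℝ => (p.1 : E) + p.2 • e) = ((ℝ ∙ e).measurableEquivProd 0).symm ∘
      Prod.map (LinearIsometryEquiv.toSpanUnitSingleton e he) id ∘ Prod.swap := by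
    ext p
    simp [add_comm]
  rw [hf]
  exact h3

end Coordinates

/-! ### The boundary as a local graph -/

section LocalGraph

variable {n : ℕ} {Ω U : Set (EuclideanSpace ℝ (Fin (n + 1)))}
  {x₀ e : EuclideanSpace ℝ (Fin (n + 1))} {ρ : EuclideanSpace ℝ (Fin (n + 1)) → ℝ}

/-- In the cylinder over `B ⊆ eᗮ` between the heights `lo` and `hi` (in the direction `e`), the set
`Ω` is the part below the graph of `g`, whose point `ψ v = v + g v • e` has the upward normal
vector `G (ψ v)` (not normalized). -/
structure IsLocalGraph (Ω : Set (EuclideanSpace ℝ (Fin (n + 1))))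
    (e : EuclideanSpace ℝ (Fin (n + 1)))
    (G : EuclideanSpace ℝ (Fin (n + 1)) → EuclideanSpace ℝ (Fin (n + 1)))
    (B : Set (ℝ ∙ e)ᗮ) (g : (ℝ ∙ e)ᗮ → ℝ) (lo hi : ℝ) (K : NNReal) : Prop where
  isOpen : IsOpen B
  volume_ne_top : volume B ≠ ⊤
  mem_Ioo : ∀ v ∈ B, g v ∈ Ioo lo hi
  lipschitz : LipschitzOnWith K (fun v : (ℝ ∙ e)ᗮ => (v : EuclideanSpace ℝ (Fin (n + 1))) + g v • e)
    B
  pos : ∀ v ∈ B, 0 < ⟪G (v + g v • e), e⟫_ℝ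
  hasStrictFDerivAt : ∀ v ∈ B, HasStrictFDerivAt
    (fun v : (ℝ ∙ e)ᗮ => (v : EuclideanSpace ℝ (Fin (n + 1))) + g v • e)
    (hyperplaneGraph e (G (v + g v • e))) v
  mem_iff : ∀ v ∈ B, ∀ s ∈ Icc lo hi,
    (v : EuclideanSpace ℝ (Fin (n + 1))) + s • e ∈ Ω ↔ s < g v
  mem_frontier_iff : ∀ v ∈ B, ∀ s ∈ Icc lo hi,
    (v : EuclideanSpace ℝ (Fin (n + 1))) + s • e ∈ frontier Ω ↔ s = g v
  normal_eq : ∀ v ∈ B, outerUnitNormal Ω (v + g v • e) =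
    ‖G (v + g v • e)‖⁻¹ • G (v + g v • e)

/-- The open cylinder over `B ⊆ eᗮ` between the heights `lo` and `hi`. -/
def cylinder (e : EuclideanSpace ℝ (Fin (n + 1))) (B : Set (ℝ ∙ e)ᗮ) (lo hi : ℝ) :
    Set (EuclideanSpace ℝ (Fin (n + 1))) :=
  {x | (ℝ ∙ e)ᗮ.orthogonalProjectionOnto x ∈ B ∧ ⟪e, x⟫_ℝ ∈ Ioo lo hi}

theorem isOpen_cylinder {B : Set (ℝ ∙ e)ᗮ} (hB : IsOpen B) (lo hi : ℝ) :
    IsOpen (cylinder e B lo hi) :=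
  (hB.preimage (ContinuousLinearMap.continuous _)).inter
    (isOpen_Ioo.preimage (by fun_prop : Continuous fun x => ⟪e, x⟫_ℝ))

theorem orthogonalProjectionOnto_add_inner_smul (he : ‖e‖ = 1)
    (x : EuclideanSpace ℝ (Fin (n + 1))) :
    ((ℝ ∙ e)ᗮ.orthogonalProjectionOnto x : EuclideanSpace ℝ (Fin (n + 1))) + ⟪e, x⟫_ℝ • e = x := by
  exact (add_comm _ _).trans <|
    (congrArg (· + _) (Submodule.starProjection_unit_singleton ℝ he x).symm).trans
    (Submodule.starProjection_add_starProjection_orthogonal (K := ℝ ∙ e) x)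

theorem orthogonalProjectionOnto_add_smul (v : (ℝ ∙ e)ᗮ) (s : ℝ) :
    (ℝ ∙ e)ᗮ.orthogonalProjectionOnto ((v : EuclideanSpace ℝ (Fin (n + 1))) + s • e) = v := by
  rw [map_add, Submodule.orthogonalProjectionOnto_mem_subspace_eq_self, map_smul,
    Submodule.orthogonalProjectionOnto_orthogonal_apply_eq_zero
      (Submodule.mem_span_singleton_self e), smul_zero, add_zero]

theorem inner_add_smul_self (he : ‖e‖ = 1) (v : (ℝ ∙ e)ᗮ) (s : ℝ) :
    ⟪e, (v : EuclideanSpace ℝ (Fin (n + 1))) + s • e⟫_ℝ = s := by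
  rw [inner_add_right, inner_coe_orthogonal_span_singleton, real_inner_smul_right,
    real_inner_self_eq_norm_sq, he]
  ring

theorem add_smul_mem_cylinder_iff (he : ‖e‖ = 1) {B : Set (ℝ ∙ e)ᗮ} {lo hi : ℝ} {v : (ℝ ∙ e)ᗮ}
    {s : ℝ} : (v : EuclideanSpace ℝ (Fin (n + 1))) + s • e ∈ cylinder e B lo hi ↔
      v ∈ B ∧ s ∈ Ioo lo hi := by
  simp only [cylinder, mem_ofPred_eq, orthogonalProjectionOnto_add_smul, inner_add_smul_self he]

/-- Near a boundary point the domain lies below a graph in every direction `e` that crosses the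
boundary outwards there. The defining function is strictly increasing in the direction `e`, so the
height `g` comes from the intermediate value theorem. The strict differentiability of `ρ` makes `g`
Lipschitz and strictly differentiable. -/
theorem exists_isLocalGraph (hΩ : IsOpen Ω) (hx : x₀ ∈ frontier Ω)
    (h : IsLocalDefiningFunction Ω x₀ U ρ) (he : ‖e‖ = 1) (hpos : 0 < ⟪gradient ρ x₀, e⟫_ℝ) :
    ∃ B g lo hi K, IsLocalGraph Ω e (gradient ρ) B g lo hi K ∧ x₀ ∈ cylinder e B lo hi := by
  set a := ⟪gradient ρ x₀, e⟫_ℝ with ha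
  set G₀ := gradient ρ x₀ with hG₀
  have hgc : ContinuousAt (gradient ρ) x₀ :=
    h.continuousOn_gradient.continuousAt (h.isOpen.mem_nhds h.mem)
  have hapos : ∀ᶠ y in 𝓝 x₀, 0 < ⟪gradient ρ y, e⟫_ℝ :=
    (hgc.inner continuousAt_const).eventually (lt_mem_nhds hpos)
  have hstrict := (h.hasStrictFDerivAt h.mem).isLittleO.def (half_pos hpos)
  rw [nhds_prod_eq] at hstrict
  obtain ⟨δ₁, hδ₁, hb₁⟩ := (Metric.nhds_basis_ball.prod_self.eventually_iff).1 hstrict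
  obtain ⟨δ₂, hδ₂, hb₂⟩ := Metric.eventually_nhds_iff_ball.1
    (hapos.and (h.isOpen.mem_nhds h.mem))
  obtain ⟨δ, hδ, hδ1, hδ2⟩ : ∃ δ > 0, δ ≤ δ₁ ∧ δ ≤ δ₂ :=
    ⟨min δ₁ δ₂, lt_min hδ₁ hδ₂, min_le_left _ _, min_le_right _ _⟩
  have hest : ∀ p ∈ Metric.ball x₀ δ, ∀ q ∈ Metric.ball x₀ δ,
      |ρ p - ρ q - ⟪G₀, p - q⟫_ℝ| ≤ a / 2 * ‖p - q‖ := by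
    intro p hp q hq
    have := @hb₁ (p, q) ⟨Metric.ball_subset_ball hδ1 hp, Metric.ball_subset_ball hδ1 hq⟩
    simpa [← hG₀] using this
  have hbpos : ∀ p ∈ Metric.ball x₀ δ, 0 < ⟪gradient ρ p, e⟫_ℝ := fun p hp =>
    (hb₂ p (Metric.ball_subset_ball hδ2 hp)).1
  have hbU : ∀ p ∈ Metric.ball x₀ δ, p ∈ U := fun p hp =>
    (hb₂ p (Metric.ball_subset_ball hδ2 hp)).2
  set v₀ : (ℝ ∙ e)ᗮ := (ℝ ∙ e)ᗮ.orthogonalProjectionOnto x₀ with hv₀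
  set s₀ : ℝ := ⟪e, x₀⟫_ℝ with hs₀
  have hx₀ : (v₀ : EuclideanSpace ℝ (Fin (n + 1))) + s₀ • e = x₀ :=
    orthogonalProjectionOnto_add_inner_smul he x₀
  set lo := s₀ - δ / 2 with hlo
  set hi := s₀ + δ / 2 with hhi
  have hρ0 : ρ x₀ = 0 := h.eq_zero_of_mem_frontier hΩ hx h.mem
  -- all points of the cylinder over the ball of radius `δ / 2` lie in the ball of radius `δ`
  have hball : ∀ v ∈ Metric.ball v₀ (δ / 2), ∀ s ∈ Icc lo hi,
      (v : EuclideanSpace ℝ (Fin (n + 1))) + s • e ∈ Metric.ball x₀ δ := by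
    intro v hv s hs
    rw [Metric.mem_ball, dist_eq_norm] at hv ⊢
    have h1 : (v : EuclideanSpace ℝ (Fin (n + 1))) + s • e - x₀ =
        ((v - v₀ : (ℝ ∙ e)ᗮ) : EuclideanSpace ℝ (Fin (n + 1))) + (s - s₀) • e := by
      rw [← hx₀]; push_cast; module
    have h2 : |s - s₀| ≤ δ / 2 := abs_le.2 ⟨by linarith [hs.1], by linarith [hs.2]⟩
    rw [h1]
    refine (norm_add_le _ _).trans_lt ?_
    rw [norm_smul, he, mul_one, Real.norm_eq_abs]
    have h3 : ‖((v - v₀ : (ℝ ∙ e)ᗮ) : EuclideanSpace ℝ (Fin (n + 1)))‖ = ‖v - v₀‖ := rfl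
    rw [h3]
    linarith
  -- on lines parallel to `e`, `ρ` increases at a rate of at least `a / 2`
  have hmono : ∀ v ∈ Metric.ball v₀ (δ / 2), ∀ s ∈ Icc lo hi, ∀ s' ∈ Icc lo hi, s < s' →
      ρ (v + s • e) < ρ (v + s' • e) := by
    intro v hv s hs s' hs' hlt
    have h1 := hest _ (hball v hv s' hs') _ (hball v hv s hs)
    have h2 : (v : EuclideanSpace ℝ (Fin (n + 1))) + s' • e - (v + s • e) = (s' - s) • e := by
      module
    rw [h2, norm_smul, he, mul_one, real_inner_smul_right, ← ha, Real.norm_eq_abs,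
      abs_of_pos (sub_pos.2 hlt)] at h1
    have h3 := (abs_le.1 h1).1
    have h4 := mul_pos (sub_pos.2 hlt) hpos
    nlinarith
  have hv₀mem : v₀ ∈ Metric.ball v₀ (δ / 2) := Metric.mem_ball_self (half_pos hδ)
  have hlohi : lo < s₀ ∧ s₀ < hi := ⟨by linarith, by linarith⟩
  have hends : ∀ s ∈ Icc lo hi, ContinuousAt
      (fun v : (ℝ ∙ e)ᗮ => ρ ((v : EuclideanSpace ℝ (Fin (n + 1))) + s • e)) v₀ := by
    intro s hs
    refine ContinuousAt.comp (g := ρ) (h.contDiffAt (hbU _ (hball v₀ hv₀mem s hs))).continuousAt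
      (by fun_prop)
  have hloI : lo ∈ Icc lo hi := ⟨le_rfl, by linarith⟩
  have hhiI : hi ∈ Icc lo hi := ⟨by linarith, le_rfl⟩
  have hs₀I : s₀ ∈ Icc lo hi := ⟨hlohi.1.le, hlohi.2.le⟩
  have hneg := hmono v₀ hv₀mem lo hloI s₀ hs₀I hlohi.1
  have hposi := hmono v₀ hv₀mem s₀ hs₀I hi hhiI hlohi.2
  rw [hx₀, hρ0] at hneg hposi
  obtain ⟨r₁, hr₁, hr₁'⟩ := Metric.eventually_nhds_iff_ball.1
    (((hends lo hloI).eventually (gt_mem_nhds hneg)).and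
      ((hends hi hhiI).eventually (lt_mem_nhds hposi)))
  obtain ⟨r, hr, hrδ, hrr₁⟩ : ∃ r > 0, r ≤ δ / 2 ∧ r ≤ r₁ :=
    ⟨min (δ / 2) r₁, lt_min (half_pos hδ) hr₁, min_le_left _ _, min_le_right _ _⟩
  set B := Metric.ball v₀ r with hB
  have hBδ : ∀ v ∈ B, v ∈ Metric.ball v₀ (δ / 2) := fun v hv => Metric.ball_subset_ball hrδ hv
  have hexists : ∀ v ∈ B, ∃ s ∈ Ioo lo hi, ρ (v + s • e) = 0 := by
    intro v hv
    have hc : ContinuousOn (fun s : ℝ => ρ ((v : EuclideanSpace ℝ (Fin (n + 1))) + s • e))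
        (Icc lo hi) := by
      intro s hs
      exact (ContinuousAt.comp (g := ρ)
        (f := fun s : ℝ => (v : EuclideanSpace ℝ (Fin (n + 1))) + s • e)
        (h.contDiffAt (hbU _ (hball v (hBδ v hv) s hs))).continuousAt
        (by fun_prop)).continuousWithinAt
    obtain ⟨h1, h2⟩ := hr₁' v (Metric.ball_subset_ball hrr₁ hv)
    exact intermediate_value_Ioo (hlohi.1.trans hlohi.2).le hc ⟨h1, h2⟩
  choose! g hgI hg0 using hexists
  have hgIcc : ∀ v ∈ B, g v ∈ Icc lo hi := fun v hv => Ioo_subset_Icc_self (hgI v hv)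
  have hψball : ∀ v ∈ B, (v : EuclideanSpace ℝ (Fin (n + 1))) + g v • e ∈ Metric.ball x₀ δ :=
    fun v hv => hball v (hBδ v hv) _ (hgIcc v hv)
  have hiff : ∀ v ∈ B, ∀ s ∈ Icc lo hi,
      (v : EuclideanSpace ℝ (Fin (n + 1))) + s • e ∈ Ω ↔ s < g v := by
    intro v hv s hs
    rw [h.mem_iff _ (hbU _ (hball v (hBδ v hv) s hs))]
    rcases lt_trichotomy s (g v) with hlt | heq | hgt
    · have := hmono v (hBδ v hv) s hs (g v) (hgIcc v hv) hlt
      rw [hg0 v hv] at this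
      exact iff_of_true this hlt
    · exact iff_of_false (by rw [heq, hg0 v hv]; exact lt_irrefl _) (by rw [heq]; exact lt_irrefl _)
    · have := hmono v (hBδ v hv) (g v) (hgIcc v hv) s hs hgt
      rw [hg0 v hv] at this
      exact iff_of_false this.not_gt hgt.not_gt
  have hfr : ∀ v ∈ B, (v : EuclideanSpace ℝ (Fin (n + 1))) + g v • e ∈ frontier Ω := by
    intro v hv
    rw [hΩ.frontier_eq]
    refine ⟨?_, fun hmem => lt_irrefl _ ((hiff v hv _ (hgIcc v hv)).1 hmem)⟩
    have ht : Tendsto (fun s : ℝ => (v : EuclideanSpace ℝ (Fin (n + 1))) + s • e) (𝓝[<] (g v))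
        (𝓝 (v + g v • e)) := by
      have : Continuous fun s : ℝ => (v : EuclideanSpace ℝ (Fin (n + 1))) + s • e := by fun_prop
      exact (this.tendsto _).mono_left nhdsWithin_le_nhds
    refine mem_closure_of_tendsto ht ?_
    filter_upwards [Ioo_mem_nhdsLT (hgI v hv).1] with s hs
    exact (hiff v hv s ⟨hs.1.le, hs.2.le.trans (hgIcc v hv).2⟩).2 hs.2
  have hlipR : ∀ v ∈ B, ∀ v' ∈ B, |g v - g v'| ≤ (‖G₀‖ + a / 2) / (a / 2) * ‖v - v'‖ := by
    intro v hv v' hv'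
    have h1 := hest _ (hψball v hv) _ (hψball v' hv')
    rw [hg0 v hv, hg0 v' hv'] at h1
    have h2 : (v : EuclideanSpace ℝ (Fin (n + 1))) + g v • e - (v' + g v' • e) =
        ((v - v' : (ℝ ∙ e)ᗮ) : EuclideanSpace ℝ (Fin (n + 1))) + (g v - g v') • e := by
      push_cast; module
    rw [h2, inner_add_right, real_inner_smul_right, ← ha] at h1
    have h3 : |⟪G₀, ((v - v' : (ℝ ∙ e)ᗮ) : EuclideanSpace ℝ (Fin (n + 1)))⟫_ℝ| ≤ ‖G₀‖ * ‖v - v'‖ :=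
      abs_real_inner_le_norm _ _
    have h4 : ‖((v - v' : (ℝ ∙ e)ᗮ) : EuclideanSpace ℝ (Fin (n + 1))) + (g v - g v') • e‖ ≤
        ‖v - v'‖ + |g v - g v'| := by
      refine (norm_add_le _ _).trans_eq ?_
      rw [norm_smul, he, mul_one, Real.norm_eq_abs]
      rfl
    have h5 := h1.trans (mul_le_mul_of_nonneg_left h4 (half_pos hpos).le)
    rw [div_mul_eq_mul_div, le_div_iff₀ (half_pos hpos)]
    have h6 : |g v - g v'| * a = |(g v - g v') * a| := by rw [abs_mul, abs_of_pos hpos]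
    have h7 : |(g v - g v') * a| ≤
        |0 - 0 - (⟪G₀, ((v - v' : (ℝ ∙ e)ᗮ) : EuclideanSpace ℝ (Fin (n + 1)))⟫_ℝ +
          (g v - g v') * a)| +
        |⟪G₀, ((v - v' : (ℝ ∙ e)ᗮ) : EuclideanSpace ℝ (Fin (n + 1)))⟫_ℝ| := by
      refine le_trans (le_of_eq ?_) (abs_add_le _ _)
      rw [← abs_neg]
      congr 1
      ring
    have h8 := h7.trans (add_le_add h5 h3)
    rw [← h6] at h8
    linarith
  set C : ℝ := (‖G₀‖ + a / 2) / (a / 2) with hC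
  have hC0 : 0 ≤ C := by positivity
  have hlip : LipschitzOnWith (1 + C).toNNReal
      (fun v : (ℝ ∙ e)ᗮ => (v : EuclideanSpace ℝ (Fin (n + 1))) + g v • e) B := by
    refine LipschitzOnWith.of_dist_le_mul fun v hv v' hv' => ?_
    rw [Real.coe_toNNReal _ (by linarith), dist_eq_norm, dist_eq_norm]
    have h2 : (v : EuclideanSpace ℝ (Fin (n + 1))) + g v • e - (v' + g v' • e) =
        ((v - v' : (ℝ ∙ e)ᗮ) : EuclideanSpace ℝ (Fin (n + 1))) + (g v - g v') • e := by
      push_cast; module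
    rw [h2]
    refine (norm_add_le _ _).trans ?_
    rw [norm_smul, he, mul_one, Real.norm_eq_abs]
    have h3 : ‖((v - v' : (ℝ ∙ e)ᗮ) : EuclideanSpace ℝ (Fin (n + 1)))‖ = ‖v - v'‖ := rfl
    rw [h3]
    linarith [hlipR v hv v' hv']
  refine ⟨B, g, lo, hi, _, ⟨Metric.isOpen_ball, measure_ball_lt_top.ne, hgI, hlip,
    fun v hv => hbpos _ (hψball v hv), ?_, hiff, ?_, ?_⟩, ?_⟩
  · intro v hv
    set p : EuclideanSpace ℝ (Fin (n + 1)) := v + g v • e with hp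
    set b := ⟪gradient ρ p, e⟫_ℝ with hb
    have hb0 : 0 < b := hbpos _ (hψball v hv)
    have hBn : B ∈ 𝓝 v := Metric.isOpen_ball.mem_nhds hv
    have hψc : ContinuousAt (fun v : (ℝ ∙ e)ᗮ =>
        (v : EuclideanSpace ℝ (Fin (n + 1))) + g v • e) v := hlip.continuousOn.continuousAt hBn
    have hψp : Tendsto (fun q : (ℝ ∙ e)ᗮ × (ℝ ∙ e)ᗮ =>
        ((q.1 : EuclideanSpace ℝ (Fin (n + 1))) + g q.1 • e,
          (q.2 : EuclideanSpace ℝ (Fin (n + 1))) + g q.2 • e)) (𝓝 (v, v)) (𝓝 (p, p)) := by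
      rw [nhds_prod_eq, nhds_prod_eq]
      exact hψc.tendsto.prodMap hψc.tendsto
    have hlo := (h.hasStrictFDerivAt (hbU p (hψball v hv))).isLittleO.comp_tendsto hψp
    have hBB : ∀ᶠ q : (ℝ ∙ e)ᗮ × (ℝ ∙ e)ᗮ in 𝓝 (v, v), q.1 ∈ B ∧ q.2 ∈ B := by
      rw [nhds_prod_eq]
      exact prod_mem_prod hBn hBn
    -- differences of `ψ` are, up to `o(‖v - v'‖)`, orthogonal to the gradient
    have hO : (fun q : (ℝ ∙ e)ᗮ × (ℝ ∙ e)ᗮ =>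
        ((q.1 : EuclideanSpace ℝ (Fin (n + 1))) + g q.1 • e) -
          ((q.2 : EuclideanSpace ℝ (Fin (n + 1))) + g q.2 • e)) =O[𝓝 (v, v)]
        fun q => q.1 - q.2 := by
      refine Asymptotics.IsBigO.of_bound (1 + C).toNNReal ?_
      filter_upwards [hBB] with q hq
      simpa [dist_eq_norm] using hlip.dist_le_mul _ hq.1 _ hq.2
    have hlo2 := hlo.trans_isBigO hO
    have hlo3 := ((hlo2.const_smul_left (-b⁻¹)).norm_right.smul_isBigO
      (Asymptotics.isBigO_refl (fun _ => e) _)).trans_isBigO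
      (k := fun q : (ℝ ∙ e)ᗮ × (ℝ ∙ e)ᗮ => q.1 - q.2)
      (Asymptotics.IsBigO.of_bound 1 (Eventually.of_forall fun q => by simp [norm_smul, he]))
    refine HasStrictFDerivAt.of_isLittleO (hlo3.congr' ?_ EventuallyEq.rfl)
    filter_upwards [hBB] with q hq
    have h2 : (q.1 : EuclideanSpace ℝ (Fin (n + 1))) + g q.1 • e - (q.2 + g q.2 • e) =
        ((q.1 - q.2 : (ℝ ∙ e)ᗮ) : EuclideanSpace ℝ (Fin (n + 1))) + (g q.1 - g q.2) • e := by
      push_cast; module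
    simp only [Pi.smul_apply, Function.comp_apply, hg0 _ hq.1, hg0 _ hq.2,
      hyperplaneGraph_apply, innerSL_apply_apply, h2, inner_add_right, real_inner_smul_right, ← hb,
      smul_eq_mul]
    have h3 : -b⁻¹ * (0 - 0 - (⟪gradient ρ p, ((q.1 - q.2 : (ℝ ∙ e)ᗮ) :
        EuclideanSpace ℝ (Fin (n + 1)))⟫_ℝ + (g q.1 - g q.2) * b)) =
        (g q.1 - g q.2) + b⁻¹ * ⟪gradient ρ p, ((q.1 - q.2 : (ℝ ∙ e)ᗮ) :
          EuclideanSpace ℝ (Fin (n + 1)))⟫_ℝ := by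
      field_simp
      ring
    rw [h3]
    module
  · intro v hv s hs
    constructor
    · intro hmem
      have h0 := h.eq_zero_of_mem_frontier hΩ hmem (hbU _ (hball v (hBδ v hv) s hs))
      rcases lt_trichotomy s (g v) with hlt | heq | hgt
      · have := hmono v (hBδ v hv) s hs (g v) (hgIcc v hv) hlt
        rw [h0, hg0 v hv] at this
        exact absurd this (lt_irrefl _)
      · exact heq
      · have := hmono v (hBδ v hv) (g v) (hgIcc v hv) s hs hgt
        rw [h0, hg0 v hv] at this
        exact absurd this (lt_irrefl _)
    · rintro rfl
      exact hfr v hv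
  · intro v hv
    refine outerUnitNormal_eq (hfr v hv) hΩ (h.recenter (hbU _ (hψball v hv)) fun h0 => ?_)
    have := hbpos _ (hψball v hv)
    rw [h0, inner_zero_left] at this
    exact lt_irrefl _ this
  · rw [← hx₀, add_smul_mem_cylinder_iff he]
    exact ⟨Metric.mem_ball_self hr, hlohi⟩

end LocalGraph

section LocalGraph

variable {n : ℕ} {Ω : Set (EuclideanSpace ℝ (Fin (n + 1)))} {e : EuclideanSpace ℝ (Fin (n + 1))}
  {G : EuclideanSpace ℝ (Fin (n + 1)) → EuclideanSpace ℝ (Fin (n + 1))} {B : Set (ℝ ∙ e)ᗮ}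
  {g : (ℝ ∙ e)ᗮ → ℝ} {lo hi : ℝ} {K : NNReal}

theorem IsLocalGraph.frontier_inter_cylinder (hg : IsLocalGraph Ω e G B g lo hi K)
    (he : ‖e‖ = 1) :
    frontier Ω ∩ cylinder e B lo hi =
      (fun v : (ℝ ∙ e)ᗮ => (v : EuclideanSpace ℝ (Fin (n + 1))) + g v • e) '' B := by
  ext x
  constructor
  · rintro ⟨hx, hxB, hxI⟩
    refine ⟨_, hxB, ?_⟩
    have hx' := hx
    rw [← orthogonalProjectionOnto_add_inner_smul he x,
      hg.mem_frontier_iff _ hxB _ (Ioo_subset_Icc_self hxI)] at hx'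
    simp only [← hx']
    exact orthogonalProjectionOnto_add_inner_smul he x
  · rintro ⟨v, hv, rfl⟩
    exact ⟨(hg.mem_frontier_iff v hv _ (Ioo_subset_Icc_self (hg.mem_Ioo v hv))).2 rfl,
      (add_smul_mem_cylinder_iff he).2 ⟨hv, hg.mem_Ioo v hv⟩⟩

theorem finrank_orthogonal_span_unit (he : ‖e‖ = 1) : finrank ℝ (ℝ ∙ e)ᗮ = n := by
  have : Fact (finrank ℝ (EuclideanSpace ℝ (Fin (n + 1))) = n + 1) := ⟨by simp⟩
  exact Submodule.finrank_orthogonal_span_singleton (by rintro rfl; simp at he)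

theorem IsLocalGraph.measure_frontier_inter_lt_top (hg : IsLocalGraph Ω e G B g lo hi K)
    (he : ‖e‖ = 1) : μHE[n] (frontier Ω ∩ cylinder e B lo hi) < ⊤ := by
  rw [hg.frontier_inter_cylinder he]
  have h1 := euclideanHausdorffMeasure_image_le_of_edist_le (q := id) (K := K)
    (finrank ℝ (ℝ ∙ e)ᗮ) (fun x hx y hy => hg.lipschitz hx hy)
  rw [image_id, InnerProductSpace.euclideanHausdorffMeasure_eq_volume,
    finrank_orthogonal_span_unit he] at h1
  exact h1.trans_lt (ENNReal.mul_lt_top (ENNReal.pow_lt_top ENNReal.coe_lt_top)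
    hg.volume_ne_top.lt_top)

/-- The density `⟪e, ν⟫` cancels the area element of the graph: the surface measure weighted with
`⟪e, ν⟫` projects along `e` to Lebesgue measure. -/
theorem IsLocalGraph.setIntegral_frontier (hg : IsLocalGraph Ω e G B g lo hi K)
    (hΩ : IsSmoothBoundedDomain Ω) (he : ‖e‖ = 1) {w : EuclideanSpace ℝ (Fin (n + 1)) → ℝ}
    (hw : ContinuousOn w (frontier Ω)) (hsupp : ∀ x ∉ cylinder e B lo hi, w x = 0) :
    ∫ x in frontier Ω, w x * ⟪e, outerUnitNormal Ω x⟫_ℝ ∂μHE[n] = ∫ v in B, w (v + g v • e) := by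
  have hψfr : ∀ v ∈ B, (v : EuclideanSpace ℝ (Fin (n + 1))) + g v • e ∈ frontier Ω := fun v hv =>
    (hg.mem_frontier_iff v hv _ (Ioo_subset_Icc_self (hg.mem_Ioo v hv))).2 rfl
  have key := setIntegral_image_euclideanHausdorffMeasure
    (π := (ℝ ∙ e)ᗮ.orthogonalProjectionOnto)
    (h := fun x => w x * ⟪e, outerUnitNormal Ω x⟫_ℝ)
    hg.isOpen hg.volume_ne_top hg.lipschitz
    (ContinuousLinearMap.continuous _).measurable
    (fun y _ => orthogonalProjectionOnto_add_smul y _) hg.hasStrictFDerivAt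
    (fun y _ => hyperplaneGraph_injective he _)
    (ContinuousOn.comp (g := fun x => w x * ⟪e, outerUnitNormal Ω x⟫_ℝ)
      (hw.mul (continuousOn_const.inner hΩ.continuousOn_outerUnitNormal))
      hg.lipschitz.continuousOn hψfr)
  rw [finrank_orthogonal_span_unit he, ← hg.frontier_inter_cylinder he] at key
  have hcut : ∫ x in frontier Ω ∩ cylinder e B lo hi, w x * ⟪e, outerUnitNormal Ω x⟫_ℝ ∂μHE[n] =
      ∫ x in frontier Ω, w x * ⟪e, outerUnitNormal Ω x⟫_ℝ ∂μHE[n] := by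
    refine (setIntegral_eq_of_subset_of_forall_sdiff_eq_zero isClosed_frontier.measurableSet
      inter_subset_left fun x hx => ?_).symm
    rw [hsupp x fun hc => hx.2 ⟨hx.1, hc⟩, zero_mul]
  rw [← hcut, key]
  refine setIntegral_congr_fun hg.isOpen.measurableSet fun v hv => ?_
  have hpos := hg.pos v hv
  have hG0 : ‖G (v + g v • e)‖ ≠ 0 := by
    rw [norm_ne_zero_iff]
    intro h0
    rw [h0, inner_zero_left] at hpos
    exact lt_irrefl _ hpos
  simp only [normDet_hyperplaneGraph he hpos, hg.normal_eq v hv, real_inner_smul_right]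
  rw [real_inner_comm] at hpos ⊢
  have := hpos.ne'
  field_simp

/-- The divergence theorem for fields supported in a graph chart, in the direction `e` of the
chart: Fubini and the fundamental theorem of calculus on the lines parallel to `e`. -/
theorem IsLocalGraph.integral_fderiv_eq (hg : IsLocalGraph Ω e G B g lo hi K)
    (hΩ : IsSmoothBoundedDomain Ω) (he : ‖e‖ = 1) {w : EuclideanSpace ℝ (Fin (n + 1)) → ℝ}
    (hw : ContinuousOn w (closure Ω)) (hd : DifferentiableOn ℝ w Ω)
    (hint : IntegrableOn (fun x => fderiv ℝ w x e) Ω)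
    (hsupp : tsupport w ⊆ cylinder e B lo hi) :
    ∫ x in Ω, fderiv ℝ w x e =
      ∫ x in frontier Ω, w x * ⟪e, outerUnitNormal Ω x⟫_ℝ ∂μHE[n] := by
  have hw0 : ∀ x ∉ cylinder e B lo hi, w x = 0 := fun x hx =>
    image_eq_zero_of_notMem_tsupport fun h => hx (hsupp h)
  have hF0 : ∀ x ∉ cylinder e B lo hi, fderiv ℝ w x e = 0 := fun x hx => by
    rw [fderiv_of_notMem_tsupport ℝ (fun h => hx (hsupp h))]
    rfl
  rw [hg.setIntegral_frontier hΩ he (hw.mono frontier_subset_closure) hw0]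
  set c : (ℝ ∙ e)ᗮ × ℝ → EuclideanSpace ℝ (Fin (n + 1)) := fun p => (p.1 : _) + p.2 • e with hc
  have hcm : MeasurePreserving c := measurePreserving_add_smul he
  have hcinj : Function.Injective c := by
    rintro ⟨v, s⟩ ⟨v', s'⟩ h
    have h1 := congrArg (ℝ ∙ e)ᗮ.orthogonalProjectionOnto h
    have h2 := congrArg (fun x => ⟪e, x⟫_ℝ) h
    simp only [hc, orthogonalProjectionOnto_add_smul, inner_add_smul_self he] at h1 h2
    rw [h1, h2]
  have hcemb : MeasurableEmbedding c :=
    Continuous.measurableEmbedding (by fun_prop) hcinj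
  have hCyl : IsOpen (cylinder e B lo hi) := isOpen_cylinder hg.isOpen lo hi
  set R : Set ((ℝ ∙ e)ᗮ × ℝ) := c ⁻¹' (Ω ∩ cylinder e B lo hi) with hR
  have hRm : MeasurableSet R := hcm.measurable (hΩ.isOpen.inter hCyl).measurableSet
  have hRmem : ∀ v s, (v, s) ∈ R ↔ v ∈ B ∧ s ∈ Ioo lo (g v) := by
    intro v s
    simp only [hR, hc, mem_preimage, mem_inter_iff, add_smul_mem_cylinder_iff he]
    constructor
    · rintro ⟨h1, h2, h3⟩
      exact ⟨h2, h3.1, (hg.mem_iff v h2 s (Ioo_subset_Icc_self h3)).1 h1⟩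
    · rintro ⟨h2, h3⟩
      have h4 : s ∈ Ioo lo hi := ⟨h3.1, h3.2.trans (hg.mem_Ioo v h2).2⟩
      exact ⟨(hg.mem_iff v h2 s (Ioo_subset_Icc_self h4)).2 h3.2, h2, h4⟩
  have hRint : IntegrableOn (fun p => fderiv ℝ w (c p) e) R :=
    (hcm.integrableOn_comp_preimage hcemb).2 (hint.mono_set inter_subset_left)
  have hRind := (integrable_indicator_iff hRm).2 hRint
  calc ∫ x in Ω, fderiv ℝ w x e = ∫ x in Ω ∩ cylinder e B lo hi, fderiv ℝ w x e :=
        setIntegral_eq_of_subset_of_forall_sdiff_eq_zero hΩ.isOpen.measurableSet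
          inter_subset_left fun x hx => hF0 x fun hc => hx.2 ⟨hx.1, hc⟩
    _ = ∫ p in R, fderiv ℝ w (c p) e := (hcm.setIntegral_preimage_emb hcemb _ _).symm
    _ = ∫ p, R.indicator (fun p => fderiv ℝ w (c p) e) p := (integral_indicator hRm).symm
    _ = ∫ v, ∫ s, R.indicator (fun p => fderiv ℝ w (c p) e) (v, s) := integral_prod _ hRind
    _ = ∫ v, B.indicator (fun v => w (v + g v • e)) v := ?_
    _ = ∫ v in B, w (v + g v • e) := integral_indicator hg.isOpen.measurableSet
  refine integral_congr_ae ?_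
  filter_upwards [hRind.prod_right_ae] with v hv
  by_cases hvB : v ∈ B
  · have hslice : (fun s => R.indicator (fun p => fderiv ℝ w (c p) e) (v, s)) =
        (Ioo lo (g v)).indicator (fun s => fderiv ℝ w (c (v, s)) e) := by
      ext s
      by_cases hs : s ∈ Ioo lo (g v)
      · rw [indicator_of_mem hs, indicator_of_mem ((hRmem v s).2 ⟨hvB, hs⟩)]
      · rw [indicator_of_notMem hs, indicator_of_notMem fun h => hs ((hRmem v s).1 h).2]
    have hlog : lo < g v := (hg.mem_Ioo v hvB).1
    have hIcc : ∀ s ∈ Icc lo (g v), s ∈ Icc lo hi := fun s hs =>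
      ⟨hs.1, hs.2.trans (hg.mem_Ioo v hvB).2.le⟩
    rw [hslice, integrable_indicator_iff measurableSet_Ioo] at hv
    rw [hslice, integral_indicator measurableSet_Ioo, indicator_of_mem hvB,
      ← integral_Ioc_eq_integral_Ioo, ← intervalIntegral.integral_of_le hlog.le]
    have hmaps : MapsTo (fun s : ℝ => (v : EuclideanSpace ℝ (Fin (n + 1))) + s • e)
        (Icc lo (g v)) (closure Ω) := by
      intro s hs
      rcases hs.2.lt_or_eq with hlt | heq
      · exact subset_closure ((hg.mem_iff v hvB s (hIcc s hs)).2 hlt)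
      · exact frontier_subset_closure ((hg.mem_frontier_iff v hvB s (hIcc s hs)).2 heq)
    rw [intervalIntegral.integral_eq_sub_of_hasDerivAt_of_le (f := fun s => w (v + s • e)) hlog.le
      (hw.comp (by fun_prop) hmaps)]
    · have h0 : w (v + lo • e) = 0 := hw0 _ fun h =>
        lt_irrefl lo ((add_smul_mem_cylinder_iff he).1 h).2.1
      rw [h0, sub_zero]
    · intro s hs
      have hmem : (v : EuclideanSpace ℝ (Fin (n + 1))) + s • e ∈ Ω :=
        (hg.mem_iff v hvB s (hIcc s (Ioo_subset_Icc_self hs))).2 hs.2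
      have h1 := ((hd _ hmem).differentiableAt (hΩ.isOpen.mem_nhds hmem)).hasFDerivAt
      have h2 : HasDerivAt (fun s : ℝ => (v : EuclideanSpace ℝ (Fin (n + 1))) + s • e) e s := by
        simpa using ((hasDerivAt_id s).smul_const e).const_add (v : EuclideanSpace ℝ (Fin (n + 1)))
      exact h1.comp_hasDerivAt s h2
    · rw [intervalIntegrable_iff_integrableOn_Ioo_of_le hlog.le]
      exact hv
  · have hslice : (fun s => R.indicator (fun p => fderiv ℝ w (c p) e) (v, s)) = fun _ => 0 := by
      ext s
      exact indicator_of_notMem (fun h => hvB ((hRmem v s).1 h).1) _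
    rw [hslice, integral_zero, indicator_of_notMem hvB]

end LocalGraph

/-! ### The divergence theorem -/

section Divergence

variable {n : ℕ} {Ω : Set (EuclideanSpace ℝ (Fin (n + 1)))}
  {w : EuclideanSpace ℝ (Fin (n + 1)) → ℝ}

theorem IsSmoothBoundedDomain.measure_frontier_lt_top (hΩ : IsSmoothBoundedDomain Ω) :
    μHE[n] (frontier Ω) < ⊤ := by
  refine hΩ.isCompact_frontier.measure_lt_top_of_nhdsWithin fun x hx => ?_
  obtain ⟨U, ρ, hρ⟩ := hΩ.smooth_boundary x hx
  have hG : 0 < ‖gradient ρ x‖ := norm_pos_iff.2 hρ.gradient_ne_zero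
  have he : ‖‖gradient ρ x‖⁻¹ • gradient ρ x‖ = 1 := by
    rw [norm_smul, norm_inv, norm_norm, inv_mul_cancel₀ hG.ne']
  obtain ⟨B, g, lo, hi, K, hg, hxc⟩ := exists_isLocalGraph hΩ.isOpen hx hρ he (by
    rw [real_inner_smul_right, real_inner_self_eq_norm_sq]
    positivity)
  exact ⟨_, inter_mem_nhdsWithin _ ((isOpen_cylinder hg.isOpen lo hi).mem_nhds hxc),
    hg.measure_frontier_inter_lt_top he⟩

theorem IsSmoothBoundedDomain.integrableOn_frontier (hΩ : IsSmoothBoundedDomain Ω)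
    (hw : ContinuousOn w (frontier Ω)) : IntegrableOn w (frontier Ω) μHE[n] := by
  obtain ⟨M, hM⟩ := hΩ.isCompact_frontier.exists_bound_of_continuousOn hw
  exact IntegrableOn.of_bound hΩ.measure_frontier_lt_top
    (hw.aestronglyMeasurable isClosed_frontier.measurableSet) M
    ((ae_restrict_iff' isClosed_frontier.measurableSet).2 (Eventually.of_forall hM))

theorem IsSmoothBoundedDomain.integrableOn_frontier_mul_inner (hΩ : IsSmoothBoundedDomain Ω)
    (hw : ContinuousOn w (frontier Ω)) (f : EuclideanSpace ℝ (Fin (n + 1))) :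
    IntegrableOn (fun x => w x * ⟪f, outerUnitNormal Ω x⟫_ℝ) (frontier Ω) μHE[n] :=
  hΩ.integrableOn_frontier (hw.mul (continuousOn_const.inner hΩ.continuousOn_outerUnitNormal))

theorem IsSmoothBoundedDomain.integrableOn (hΩ : IsSmoothBoundedDomain Ω)
    (hw : ContinuousOn w (closure Ω)) : IntegrableOn w Ω :=
  (hw.integrableOn_compact hΩ.isCompact_closure).mono_set subset_closure

theorem fderivWithin_closure_eq {E F : Type*} [NormedAddCommGroup E] [NormedSpace ℝ E]
    [NormedAddCommGroup F] [NormedSpace ℝ F] {Ω : Set E} (hΩ : IsOpen Ω) {x : E} (hx : x ∈ Ω)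
    (w : E → F) : fderivWithin ℝ w (closure Ω) x = fderiv ℝ w x :=
  fderivWithin_of_mem_nhds (mem_of_superset (hΩ.mem_nhds hx) subset_closure)

theorem IsSmoothBoundedDomain.integrableOn_fderiv (hΩ : IsSmoothBoundedDomain Ω)
    (hw : ContDiffOn ℝ 1 w (closure Ω)) (f : EuclideanSpace ℝ (Fin (n + 1))) :
    IntegrableOn (fun x => fderiv ℝ w x f) Ω := by
  have h1 : ContinuousOn (fun x => fderivWithin ℝ w (closure Ω) x f) (closure Ω) :=
    (hw.continuousOn_fderivWithin hΩ.uniqueDiffOn_closure le_rfl).clm_apply continuousOn_const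
  refine (hΩ.integrableOn h1).congr_fun (fun x hx => ?_) hΩ.isOpen.measurableSet
  simp only [fderivWithin_closure_eq hΩ.isOpen hx]

theorem differentiableOn_of_contDiffOn_closure {E F : Type*} [NormedAddCommGroup E]
    [NormedSpace ℝ E] [NormedAddCommGroup F] [NormedSpace ℝ F] {Ω : Set E} {w : E → F}
    (hw : ContDiffOn ℝ 1 w (closure Ω)) : DifferentiableOn ℝ w Ω :=
  (hw.differentiableOn one_ne_zero).mono subset_closure

/-- The divergence theorem near a boundary point, in a direction transversal to the boundary. -/
theorem IsLocalDefiningFunction.exists_integral_fderiv_eq {U : Set (EuclideanSpace ℝ (Fin (n + 1)))}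
    {x₀ : EuclideanSpace ℝ (Fin (n + 1))} {ρ : EuclideanSpace ℝ (Fin (n + 1)) → ℝ}
    (h : IsLocalDefiningFunction Ω x₀ U ρ) (hΩ : IsSmoothBoundedDomain Ω) (hx : x₀ ∈ frontier Ω)
    {f : EuclideanSpace ℝ (Fin (n + 1))} (hf : 0 < ⟪gradient ρ x₀, f⟫_ℝ) :
    ∃ N, IsOpen N ∧ x₀ ∈ N ∧ ∀ w : EuclideanSpace ℝ (Fin (n + 1)) → ℝ,
      ContDiffOn ℝ 1 w (closure Ω) → tsupport w ⊆ N →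
        ∫ x in Ω, fderiv ℝ w x f =
          ∫ x in frontier Ω, w x * ⟪f, outerUnitNormal Ω x⟫_ℝ ∂μHE[n] := by
  have hf0 : 0 < ‖f‖ := norm_pos_iff.2 (by rintro rfl; simp at hf)
  set e := ‖f‖⁻¹ • f with he'
  have he : ‖e‖ = 1 := by rw [he', norm_smul, norm_inv, norm_norm, inv_mul_cancel₀ hf0.ne']
  have hfe : f = ‖f‖ • e := by rw [he', smul_smul, mul_inv_cancel₀ hf0.ne', one_smul]
  obtain ⟨B, g, lo, hi, K, hg, hxc⟩ := exists_isLocalGraph hΩ.isOpen hx h he (by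
    rw [he', real_inner_smul_right]
    positivity)
  refine ⟨_, isOpen_cylinder hg.isOpen lo hi, hxc, fun w hw hsupp => ?_⟩
  have key := hg.integral_fderiv_eq hΩ he hw.continuousOn
    (differentiableOn_of_contDiffOn_closure hw) (hΩ.integrableOn_fderiv hw e) hsupp
  rw [hfe]
  simp only [map_smul, smul_eq_mul, real_inner_smul_left]
  rw [integral_const_mul, key, ← integral_const_mul]
  congr 1
  ext x
  ring

/-- The divergence theorem near a boundary point, in an arbitrary direction: every vector is a
linear combination of two vectors that are transversal to the boundary. -/
theorem IsSmoothBoundedDomain.exists_integral_fderiv_eq_of_mem_frontier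
    (hΩ : IsSmoothBoundedDomain Ω) {x₀ : EuclideanSpace ℝ (Fin (n + 1))} (hx : x₀ ∈ frontier Ω)
    (f : EuclideanSpace ℝ (Fin (n + 1))) :
    ∃ N, IsOpen N ∧ x₀ ∈ N ∧ ∀ w : EuclideanSpace ℝ (Fin (n + 1)) → ℝ,
      ContDiffOn ℝ 1 w (closure Ω) → tsupport w ⊆ N →
        ∫ x in Ω, fderiv ℝ w x f =
          ∫ x in frontier Ω, w x * ⟪f, outerUnitNormal Ω x⟫_ℝ ∂μHE[n] := by
  obtain ⟨U, ρ, hρ⟩ := hΩ.smooth_boundary x₀ hx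
  set G := gradient ρ x₀ with hGdef
  have hG : 0 < ‖G‖ := norm_pos_iff.2 hρ.gradient_ne_zero
  obtain ⟨N₁, hN₁, hx₁, h₁⟩ := hρ.exists_integral_fderiv_eq hΩ hx (f := G) (by
    rw [← hGdef, real_inner_self_eq_norm_sq]; positivity)
  -- this multiple of `G` outweighs `f`, so that `f + t • G` points outwards
  set t : ℝ := (‖f‖ + 1) / ‖G‖ with ht
  obtain ⟨N₂, hN₂, hx₂, h₂⟩ := hρ.exists_integral_fderiv_eq hΩ hx (f := f + t • G) (by
    have h3 := (abs_le.1 (abs_real_inner_le_norm G f)).1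
    have h4 : t * ‖G‖ ^ 2 = (‖f‖ + 1) * ‖G‖ := by rw [ht]; field_simp
    rw [← hGdef, inner_add_right, real_inner_smul_right, real_inner_self_eq_norm_sq, h4]
    nlinarith)
  refine ⟨N₁ ∩ N₂, hN₁.inter hN₂, ⟨hx₁, hx₂⟩, fun w hw hsupp => ?_⟩
  have k₁ := h₁ w hw (hsupp.trans inter_subset_left)
  have k₂ := h₂ w hw (hsupp.trans inter_subset_right)
  have hwf := hw.continuousOn.mono (frontier_subset_closure (s := Ω))
  have e₁ : ∫ x in Ω, fderiv ℝ w x f =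
      (∫ x in Ω, fderiv ℝ w x (f + t • G)) - t * ∫ x in Ω, fderiv ℝ w x G := by
    rw [← integral_const_mul, ← integral_sub (hΩ.integrableOn_fderiv hw _)
      ((hΩ.integrableOn_fderiv hw _).const_mul t)]
    congr 1
    ext x
    simp
  have e₂ : ∫ x in frontier Ω, w x * ⟪f, outerUnitNormal Ω x⟫_ℝ ∂μHE[n] =
      (∫ x in frontier Ω, w x * ⟪f + t • G, outerUnitNormal Ω x⟫_ℝ ∂μHE[n]) -
        t * ∫ x in frontier Ω, w x * ⟪G, outerUnitNormal Ω x⟫_ℝ ∂μHE[n] := by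
    rw [← integral_const_mul, ← integral_sub (hΩ.integrableOn_frontier_mul_inner hwf _)
      ((hΩ.integrableOn_frontier_mul_inner hwf _).const_mul t)]
    congr 1
    ext x
    rw [inner_add_left, real_inner_smul_left]
    ring
  rw [e₁, e₂, k₁, k₂]

/-- The divergence theorem for functions supported inside the domain, where both sides vanish. -/
theorem IsSmoothBoundedDomain.integral_fderiv_eq_of_tsupport_subset
    (hΩ : IsSmoothBoundedDomain Ω) (hw : ContDiffOn ℝ 1 w (closure Ω)) (hsupp : tsupport w ⊆ Ω)
    (f : EuclideanSpace ℝ (Fin (n + 1))) :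
    ∫ x in Ω, fderiv ℝ w x f =
      ∫ x in frontier Ω, w x * ⟪f, outerUnitNormal Ω x⟫_ℝ ∂μHE[n] := by
  have hd : Differentiable ℝ w := by
    intro x
    by_cases hx : x ∈ tsupport w
    · exact ((differentiableOn_of_contDiffOn_closure hw) x (hsupp hx)).differentiableAt
        (hΩ.isOpen.mem_nhds (hsupp hx))
    · exact (HasFDerivAt.of_notMem_tsupport ℝ hx).differentiableAt
  have hcomp : HasCompactSupport w :=
    hΩ.isCompact_closure.of_isClosed_subset (isClosed_tsupport w)
      (hsupp.trans subset_closure)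
  have h0 : ∀ x ∈ frontier Ω, w x * ⟪f, outerUnitNormal Ω x⟫_ℝ = 0 := by
    intro x hx
    rw [hΩ.isOpen.frontier_eq] at hx
    rw [image_eq_zero_of_notMem_tsupport fun h => hx.2 (hsupp h), zero_mul]
  rw [setIntegral_congr_fun isClosed_frontier.measurableSet h0, integral_zero]
  have hF0 : ∀ x ∉ Ω, fderiv ℝ w x f = 0 := fun x hx => by
    rw [fderiv_of_notMem_tsupport ℝ (fun h => hx (hsupp h))]
    rfl
  have hint : Integrable (fun x => fderiv ℝ w x f) :=
    (integrableOn_iff_integrable_of_support_subset fun x hx => by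
      by_contra h
      exact hx (hF0 x h)).1 (hΩ.integrableOn_fderiv hw f)
  rw [setIntegral_eq_integral_of_forall_compl_eq_zero hF0]
  have key := integral_mul_fderiv_eq_neg_fderiv_mul_of_integrable (𝕜 := ℝ)
    (μ := (volume : Measure (EuclideanSpace ℝ (Fin (n + 1))))) (f := fun _ => (1 : ℝ)) (g := w)
    (v := f) (by simp) (by simpa using hint)
    (by simpa using hd.continuous.integrable_of_hasCompactSupport hcomp)
    (fun x _ => differentiableAt_const _) (fun x _ => hd x)
  simpa using key

/-- The **divergence theorem** on a smooth bounded domain, for the field `w f` with a constant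
vector `f` and a function `w` that is `C¹` up to the boundary. -/
theorem IsSmoothBoundedDomain.integral_fderiv_eq (hΩ : IsSmoothBoundedDomain Ω)
    (hw : ContDiffOn ℝ 1 w (closure Ω)) (f : EuclideanSpace ℝ (Fin (n + 1))) :
    ∫ x in Ω, fderiv ℝ w x f =
      ∫ x in frontier Ω, w x * ⟪f, outerUnitNormal Ω x⟫_ℝ ∂μHE[n] := by
  have hloc : ∀ x ∈ closure Ω, ∃ N, IsOpen N ∧ x ∈ N ∧
      ∀ w : EuclideanSpace ℝ (Fin (n + 1)) → ℝ, ContDiffOn ℝ 1 w (closure Ω) → tsupport w ⊆ N →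
        ∫ x in Ω, fderiv ℝ w x f =
          ∫ x in frontier Ω, w x * ⟪f, outerUnitNormal Ω x⟫_ℝ ∂μHE[n] := by
    intro x hx
    by_cases hxΩ : x ∈ Ω
    · exact ⟨Ω, hΩ.isOpen, hxΩ, fun w hw hs => hΩ.integral_fderiv_eq_of_tsupport_subset hw hs f⟩
    · exact hΩ.exists_integral_fderiv_eq_of_mem_frontier
        (by rw [hΩ.isOpen.frontier_eq]; exact ⟨hx, hxΩ⟩) f
  choose! N hNo hxN hN using hloc
  obtain ⟨s, hs, hcov⟩ := hΩ.isCompact_closure.elim_nhds_subcover N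
    fun x hx => (hNo x hx).mem_nhds (hxN x hx)
  obtain ⟨χ, hχ⟩ := SmoothPartitionOfUnity.exists_isSubordinate
    (modelWithCornersSelf ℝ (EuclideanSpace ℝ (Fin (n + 1)))) (isClosed_closure (s := Ω))
    (fun i : s => N i) (fun i => hNo i (hs i i.2)) (by
      intro x hx
      obtain ⟨i, hi, hxi⟩ := mem_iUnion₂.1 (hcov hx)
      exact mem_iUnion.2 ⟨⟨i, hi⟩, hxi⟩)
  have hχ1 : ∀ x ∈ closure Ω, ∑ i, χ i x = 1 := fun x hx => by
    rw [← finsum_eq_sum_of_fintype]; exact χ.sum_eq_one hx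
  have hχs : ∀ i, ContDiff ℝ 1 (χ i) := fun i => ((χ i).contMDiff.contDiff).of_le (by simp)
  have hwi : ∀ i, ContDiffOn ℝ 1 (fun x => χ i x * w x) (closure Ω) := fun i =>
    (hχs i).contDiffOn.mul hw
  have hi : ∀ i : s, ∫ x in Ω, fderiv ℝ (fun x => χ i x * w x) x f =
      ∫ x in frontier Ω, (χ i x * w x) * ⟪f, outerUnitNormal Ω x⟫_ℝ ∂μHE[n] := fun i =>
    hN i (hs i i.2) _ (hwi i) ((tsupport_mul_subset_left).trans (hχ i))
  calc ∫ x in Ω, fderiv ℝ w x f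
      = ∫ x in Ω, ∑ i, fderiv ℝ (fun x => χ i x * w x) x f := by
        refine setIntegral_congr_fun hΩ.isOpen.measurableSet fun x hx => ?_
        have hev : w =ᶠ[𝓝 x] fun y => ∑ i, χ i y * w y := by
          filter_upwards [hΩ.isOpen.mem_nhds hx] with y hy
          rw [← Finset.sum_mul, hχ1 y (subset_closure hy), one_mul]
        simp only [hev.fderiv_eq]
        rw [fderiv_fun_sum fun i _ => ((differentiableOn_of_contDiffOn_closure (hwi i)) x
          hx).differentiableAt (hΩ.isOpen.mem_nhds hx)]
        simp
    _ = ∑ i, ∫ x in Ω, fderiv ℝ (fun x => χ i x * w x) x f :=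
        integral_finsetSum _ fun i _ => hΩ.integrableOn_fderiv (hwi i) f
    _ = ∑ i, ∫ x in frontier Ω, (χ i x * w x) * ⟪f, outerUnitNormal Ω x⟫_ℝ ∂μHE[n] :=
        Finset.sum_congr rfl fun i _ => hi i
    _ = ∫ x in frontier Ω, ∑ i, (χ i x * w x) * ⟪f, outerUnitNormal Ω x⟫_ℝ ∂μHE[n] :=
        (integral_finsetSum _ fun i _ => hΩ.integrableOn_frontier_mul_inner
          ((hwi i).continuousOn.mono frontier_subset_closure) f).symm
    _ = ∫ x in frontier Ω, w x * ⟪f, outerUnitNormal Ω x⟫_ℝ ∂μHE[n] := by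
        refine setIntegral_congr_fun isClosed_frontier.measurableSet fun x hx => ?_
        simp only [← Finset.sum_mul, hχ1 x (frontier_subset_closure hx), one_mul]

end Divergence

/-! ### Directional derivatives within a set -/

section DirDeriv

variable {X : Type*} [NormedAddCommGroup X] [NormedSpace ℝ X] {S : Set X} {G H : X → ℝ} {p : X}

/-- The directional derivative of `G` along `v` within `S`. -/
noncomputable def dirDeriv (S : Set X) (v : X) (G : X → ℝ) (p : X) : ℝ :=
  fderivWithin ℝ G S p v

theorem contDiffOn_dirDeriv (hS : UniqueDiffOn ℝ S) (hG : ContDiffOn ℝ ∞ G S) (v : X) :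
    ContDiffOn ℝ ∞ (dirDeriv S v G) S :=
  (hG.fderivWithin hS (by simp)).clm_apply contDiffOn_const

theorem differentiableWithinAt_of_contDiffOn (hG : ContDiffOn ℝ ∞ G S) (hp : p ∈ S) :
    DifferentiableWithinAt ℝ G S p :=
  (hG.differentiableOn (by simp)) p hp

theorem dirDeriv_const (v : X) (c : ℝ) : dirDeriv S v (fun _ => c) p = 0 := by
  simp [dirDeriv]

theorem dirDeriv_eq_fderiv (hp : S ∈ 𝓝 p) (v : X) : dirDeriv S v G p = fderiv ℝ G p v := by
  rw [dirDeriv, fderivWithin_of_mem_nhds hp]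

theorem dirDeriv_congr (hS : S ∈ 𝓝 p) (h : G =ᶠ[𝓝 p] H) (v : X) :
    dirDeriv S v G p = dirDeriv S v H p := by
  rw [dirDeriv_eq_fderiv hS, dirDeriv_eq_fderiv hS, h.fderiv_eq]

theorem dirDeriv_dirDeriv (hS : UniqueDiffOn ℝ S) (hG : ContDiffOn ℝ ∞ G S) (hp : p ∈ S)
    (v w : X) :
    dirDeriv S v (dirDeriv S w G) p = fderivWithin ℝ (fderivWithin ℝ G S) S p v w := by
  have hd : DifferentiableWithinAt ℝ (fderivWithin ℝ G S) S p :=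
    ((hG.fderivWithin hS (m := ∞) (by simp)).differentiableOn (by simp)) p hp
  have h1 := (hd.hasFDerivWithinAt.clm_apply (hasFDerivWithinAt_const w p S)).fderivWithin (hS p hp)
  change fderivWithin ℝ (fun q => fderivWithin ℝ G S q w) S p v = _
  rw [h1]
  simp

theorem dirDeriv_comm (hS : UniqueDiffOn ℝ S) (hG : ContDiffOn ℝ ∞ G S) (hp : S ∈ 𝓝 p) (v w : X) :
    dirDeriv S v (dirDeriv S w G) p = dirDeriv S w (dirDeriv S v G) p := by
  have hpS := mem_of_mem_nhds hp
  rw [dirDeriv_dirDeriv hS hG hpS, dirDeriv_dirDeriv hS hG hpS]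
  exact (hG p hpS).isSymmSndFDerivWithinAt (by
    rw [minSmoothness_of_isRCLikeNormedField]
    exact WithTop.coe_le_coe.2 (le_top (a := (2 : ℕ∞)))) hS
    (subset_closure (mem_interior_iff_mem_nhds.2 hp)) hpS v w

end DirDeriv

/-! ### The space-time region -/

section SpaceTime

variable {n : ℕ} {T : ℝ} {Ω₀ : Set (EuclideanSpace ℝ (Fin (n + 1)))}
  {Ω : ℝ → Set (EuclideanSpace ℝ (Fin (n + 1)))}
  {φ : ℝ → EuclideanSpace ℝ (Fin (n + 1)) → EuclideanSpace ℝ (Fin (n + 1))} {t : ℝ}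

theorem IsSmoothEvolution.image_eq (h : IsSmoothEvolution T Ω₀ Ω φ) (ht : t ∈ Ioo 0 T) :
    φ t '' Ω₀ = Ω t := by
  have hb := (h.diffeo t ht).1
  have e₀ : Ω₀ = closure Ω₀ \ frontier Ω₀ := by
    rw [closure_sdiff_frontier, h.reference.isOpen.interior_eq]
  have e₁ : Ω t = closure (Ω t) \ frontier (Ω t) := by
    rw [closure_sdiff_frontier, (h.domain t ht).isOpen.interior_eq]
  rw [e₁, ← h.image_frontier t ht, ← hb.image_eq,
    ← hb.injOn.image_sdiff_subset frontier_subset_closure, ← e₀]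

theorem IsSmoothEvolution.mapsTo (h : IsSmoothEvolution T Ω₀ Ω φ) (ht : t ∈ Ioo 0 T)
    {q : EuclideanSpace ℝ (Fin (n + 1))} (hq : q ∈ Ω₀) : φ t q ∈ Ω t := by
  rw [← h.image_eq ht]; exact mem_image_of_mem _ hq

theorem IsSmoothEvolution.spaceTime_eq_image (h : IsSmoothEvolution T Ω₀ Ω φ) :
    spaceTime T Ω = (fun p : ℝ × EuclideanSpace ℝ (Fin (n + 1)) => (p.1, φ p.1 p.2)) ''
      (Ioo 0 T ×ˢ closure Ω₀) := by
  ext ⟨t, x⟩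
  constructor
  · rintro ⟨ht, hx⟩
    have ht : t ∈ Ioo 0 T := ht
    have hx : x ∈ closure (Ω t) := hx
    rw [← (h.diffeo t ht).1.image_eq] at hx
    obtain ⟨q, hq, rfl⟩ := hx
    exact ⟨(t, q), ⟨ht, hq⟩, rfl⟩
  · rintro ⟨⟨s, q⟩, ⟨hs, hq⟩, heq⟩
    obtain ⟨rfl, rfl⟩ := Prod.mk.inj heq
    exact ⟨hs, (h.diffeo s hs).1.mapsTo hq⟩

/-- The spatial differential of the diffeomorphism is invertible up to the boundary. -/
theorem IsSmoothEvolution.injective_fderivWithin (h : IsSmoothEvolution T Ω₀ Ω φ)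
    (ht : t ∈ Ioo 0 T) {q : EuclideanSpace ℝ (Fin (n + 1))} (hq : q ∈ closure Ω₀) :
    Function.Injective (fderivWithin ℝ (φ t) (closure Ω₀) q) := by
  obtain ⟨hb, hφ, Ψ, hinv, hΨ⟩ := h.diffeo t ht
  have h1 := ((hφ.differentiableOn (by simp)) q hq).hasFDerivWithinAt
  have h2 := ((hΨ.differentiableOn (by simp)) _ (hb.mapsTo hq)).hasFDerivWithinAt
  have h3 := (h2.comp q h1 hb.mapsTo).congr (f₁ := id) (fun y hy => (hinv hy).symm) (hinv hq).symm
  have h4 := (h.reference.uniqueDiffOn_closure q hq).eq h3 (hasFDerivWithinAt_id q _)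
  intro v w hvw
  have h5 := congrArg (fun A => A v) h4
  have h6 := congrArg (fun A => A w) h4
  simp only [ContinuousLinearMap.comp_apply, ContinuousLinearMap.id_apply] at h5 h6
  rw [← h5, ← h6, hvw]

theorem IsSmoothEvolution.contDiffOn_spaceTimeMap (h : IsSmoothEvolution T Ω₀ Ω φ) :
    ContDiffOn ℝ ∞ (fun p : ℝ × EuclideanSpace ℝ (Fin (n + 1)) => (p.1, φ p.1 p.2))
      (Ioo 0 T ×ˢ closure Ω₀) :=
  contDiffOn_fst.prodMk h.contDiffOn

/-- The differential of `(t, q) ↦ (t, φ t q)` is block triangular, with the identity and the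
invertible spatial differential of `φ t` on the diagonal. -/
theorem IsSmoothEvolution.surjective_of_hasFDerivWithinAt (h : IsSmoothEvolution T Ω₀ Ω φ)
    {p : ℝ × EuclideanSpace ℝ (Fin (n + 1))} (hp : p ∈ Ioo 0 T ×ˢ closure Ω₀)
    {A : ℝ × EuclideanSpace ℝ (Fin (n + 1)) →L[ℝ] ℝ × EuclideanSpace ℝ (Fin (n + 1))}
    (hA : HasFDerivWithinAt (fun p : ℝ × EuclideanSpace ℝ (Fin (n + 1)) => (p.1, φ p.1 p.2)) A
      (Ioo 0 T ×ˢ closure Ω₀) p) : Function.Surjective A := by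
  obtain ⟨t, q⟩ := p
  have ht : t ∈ Ioo 0 T := hp.1
  have hq : q ∈ closure Ω₀ := hp.2
  have hpu : UniqueDiffWithinAt ℝ (Ioo 0 T ×ˢ closure Ω₀) (t, q) :=
    (isOpen_Ioo.uniqueDiffOn.prod h.reference.uniqueDiffOn_closure) _ hp
  have hfst : ∀ v, (A v).1 = v.1 := by
    have h1 := hpu.eq hA.fst hasFDerivWithinAt_fst
    intro v
    exact congrArg (fun L => L v) h1
  have hsnd : ∀ v, (A (0, v)).2 = fderivWithin ℝ (φ t) (closure Ω₀) q v := by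
    have hin : HasFDerivWithinAt (fun y : EuclideanSpace ℝ (Fin (n + 1)) => (t, y))
        (ContinuousLinearMap.inr ℝ ℝ (EuclideanSpace ℝ (Fin (n + 1)))) (closure Ω₀) q :=
      (hasFDerivAt_prodMk_right t q).hasFDerivWithinAt
    have h1 := (hA.snd.comp q hin fun y hy => ⟨ht, hy⟩).fderivWithin
      (h.reference.uniqueDiffOn_closure q hq)
    intro v
    exact (congrArg (fun L => L v) h1).symm
  have hsurj := (LinearMap.injective_iff_surjective
    (f := (fderivWithin ℝ (φ t) (closure Ω₀) q).toLinearMap)).1 (h.injective_fderivWithin ht hq)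
  rintro ⟨a, y⟩
  obtain ⟨v, hv⟩ := hsurj (y - (A (a, 0)).2)
  refine ⟨(a, v), ?_⟩
  have hsplit : ((a, v) : ℝ × EuclideanSpace ℝ (Fin (n + 1))) = (a, 0) + (0, v) := by simp
  have hv' : fderivWithin ℝ (φ t) (closure Ω₀) q v = y - (A (a, 0)).2 := hv
  refine Prod.ext (hfst _) ?_
  rw [hsplit, map_add, Prod.snd_add, hsnd, hv']
  simp

/-- Unique differentiability passes to the space-time region as the image of a product under a map
with surjective differential. -/
theorem IsSmoothEvolution.uniqueDiffOn_spaceTime (h : IsSmoothEvolution T Ω₀ Ω φ) :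
    UniqueDiffOn ℝ (spaceTime T Ω) := by
  rw [h.spaceTime_eq_image]
  have hd : ∀ p ∈ Ioo 0 T ×ˢ closure Ω₀, HasFDerivWithinAt
      (fun p : ℝ × EuclideanSpace ℝ (Fin (n + 1)) => (p.1, φ p.1 p.2))
      (fderivWithin ℝ (fun p : ℝ × EuclideanSpace ℝ (Fin (n + 1)) => (p.1, φ p.1 p.2))
        (Ioo 0 T ×ˢ closure Ω₀) p) (Ioo 0 T ×ˢ closure Ω₀) p := fun p hp =>
    ((h.contDiffOn_spaceTimeMap.differentiableOn (by simp)) p hp).hasFDerivWithinAt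
  exact (isOpen_Ioo.uniqueDiffOn.prod h.reference.uniqueDiffOn_closure).image hd fun p hp =>
    (h.surjective_of_hasFDerivWithinAt hp (hd p hp)).denseRange

/-- The open space-time region is open: the map `(t, q) ↦ (t, φ t q)` is open by the inverse
function theorem. -/
theorem IsSmoothEvolution.eventually_mem (h : IsSmoothEvolution T Ω₀ Ω φ) (ht : t ∈ Ioo 0 T)
    {x : EuclideanSpace ℝ (Fin (n + 1))} (hx : x ∈ Ω t) :
    ∀ᶠ p : ℝ × EuclideanSpace ℝ (Fin (n + 1)) in 𝓝 (t, x), p.1 ∈ Ioo 0 T ∧ p.2 ∈ Ω p.1 := by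
  rw [← h.image_eq ht] at hx
  obtain ⟨q, hq, rfl⟩ := hx
  have hQ : Ioo 0 T ×ˢ Ω₀ ∈ 𝓝 (t, q) :=
    (isOpen_Ioo.prod h.reference.isOpen).mem_nhds ⟨ht, hq⟩
  have hQ' : Ioo 0 T ×ˢ closure Ω₀ ∈ 𝓝 (t, q) :=
    mem_of_superset hQ (prod_mono_right subset_closure)
  have hc : ContDiffAt ℝ ∞ (fun p : ℝ × EuclideanSpace ℝ (Fin (n + 1)) => (p.1, φ p.1 p.2))
      (t, q) := h.contDiffOn_spaceTimeMap.contDiffAt hQ'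
  have hs := hc.hasStrictFDerivAt (by simp)
  have hsurj := h.surjective_of_hasFDerivWithinAt ⟨ht, subset_closure hq⟩
    hs.hasFDerivAt.hasFDerivWithinAt
  have hmap := hs.map_nhds_eq_of_surj (LinearMap.range_eq_top.2 hsurj)
  rw [← hmap]
  rw [eventually_map]
  filter_upwards [hQ] with p hp
  exact ⟨hp.1, h.mapsTo hp.1 hp.2⟩

theorem IsSmoothEvolution.spaceTime_mem_nhds (h : IsSmoothEvolution T Ω₀ Ω φ) (ht : t ∈ Ioo 0 T)
    {x : EuclideanSpace ℝ (Fin (n + 1))} (hx : x ∈ Ω t) : spaceTime T Ω ∈ 𝓝 (t, x) := by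
  filter_upwards [h.eventually_mem ht hx] with p hp
  exact ⟨hp.1, subset_closure hp.2⟩

/-- At boundary points too, derivatives within the time slice `closure (Ω t)` are the derivatives
within the space-time region in the spatial directions. -/
theorem IsSmoothEvolution.fderivWithin_slice (h : IsSmoothEvolution T Ω₀ Ω φ) (ht : t ∈ Ioo 0 T)
    {x : EuclideanSpace ℝ (Fin (n + 1))} (hx : x ∈ closure (Ω t))
    {G : ℝ × EuclideanSpace ℝ (Fin (n + 1)) → ℝ} (hG : ContDiffOn ℝ ∞ G (spaceTime T Ω))
    (v : EuclideanSpace ℝ (Fin (n + 1))) :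
    fderivWithin ℝ (fun y => G (t, y)) (closure (Ω t)) x v =
      dirDeriv (spaceTime T Ω) (0, v) G (t, x) := by
  have hd := (differentiableWithinAt_of_contDiffOn hG (p := (t, x)) ⟨ht, hx⟩).hasFDerivWithinAt
  have h1 := (hd.comp x (hasFDerivAt_prodMk_right t x).hasFDerivWithinAt
    (s := closure (Ω t)) fun y hy => ⟨ht, hy⟩).fderivWithin
    ((h.domain t ht).uniqueDiffOn_closure x hx)
  exact congrArg (fun L => L v) h1

theorem contDiffOn_slice {G : ℝ × EuclideanSpace ℝ (Fin (n + 1)) → ℝ}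
    (hG : ContDiffOn ℝ ∞ G (spaceTime T Ω)) (ht : t ∈ Ioo 0 T) :
    ContDiffOn ℝ ∞ (fun y => G (t, y)) (closure (Ω t)) :=
  hG.comp (contDiffOn_const.prodMk contDiffOn_id) fun _ hy => ⟨ht, hy⟩

end SpaceTime

/-! ### Jacobi's formula -/

section Jacobi

variable {ι : Type*} [Fintype ι] [DecidableEq ι]

theorem differentiable_det :
    Differentiable ℝ (fun m : ι → ι → ℝ => (Matrix.of m).det) := by
  simp only [Matrix.det_apply', Matrix.of_apply]
  fun_prop

/-- The derivative of the determinant at the identity is the trace. -/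
theorem hasDerivAt_det_of_eq_one {m : ℝ → Matrix ι ι ℝ} {m' : Matrix ι ι ℝ} {t : ℝ}
    (hm : ∀ i j, HasDerivAt (fun s => m s i j) (m' i j) t) (h1 : m t = 1) :
    HasDerivAt (fun s => (m s).det) m'.trace t := by
  set D := fun m : ι → ι → ℝ => (Matrix.of m).det with hD
  set I : ι → ι → ℝ := fun i j => (1 : Matrix ι ι ℝ) i j with hI
  have hDd : HasFDerivAt D (fderiv ℝ D I) I := (differentiable_det I).hasFDerivAt
  have hcurve : ∀ {k : ℝ → ι → ι → ℝ} {k' : ι → ι → ℝ} {s : ℝ},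
      (∀ i j, HasDerivAt (fun s => k s i j) (k' i j) s) → k s = I →
      HasDerivAt (fun s => D (k s)) (fderiv ℝ D I k') s := by
    intro k k' s hk hs
    have h2 : HasDerivAt k k' s := hasDerivAt_pi.2 fun i => hasDerivAt_pi.2 fun j => hk i j
    rw [← hs] at hDd ⊢
    exact hDd.comp_hasDerivAt s h2
  have hline : HasDerivAt (fun r : ℝ => D (fun i j => I i j + r * m' i j))
      (fderiv ℝ D I (fun i j => m' i j)) 0 := by
    refine hcurve (fun i j => ?_) (by ext i j; simp)
    simpa using ((hasDerivAt_id (0 : ℝ)).mul_const (m' i j)).const_add (I i j)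
  -- along the line `1 + r m'` the determinant is `1 + r tr m' + O(r²)`, a polynomial in `r`
  have hline' : HasDerivAt (fun r : ℝ => D (fun i j => I i j + r * m' i j)) m'.trace 0 := by
    have h3 : (fun r : ℝ => D (fun i j => I i j + r * m' i j)) = fun r => 1 + m'.trace * r +
        (Matrix.det (1 + (Polynomial.X : Polynomial ℝ) •
          m'.map Polynomial.C)).divX.divX.eval r * r ^ 2 := by
      ext r
      rw [← Matrix.det_one_add_smul]
      rfl
    rw [h3]
    set P := (Matrix.det (1 + (Polynomial.X : Polynomial ℝ) •
          m'.map Polynomial.C)).divX.divX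
    have h4 := (((hasDerivAt_id (0 : ℝ)).const_mul m'.trace).const_add 1).add
      ((P.hasDerivAt 0).mul ((hasDerivAt_id (0 : ℝ)).pow 2))
    exact h4.congr_deriv (by simp)
  have h5 := hcurve (k := fun s i j => m s i j) (k' := fun i j => m' i j) (s := t) hm (by rw [h1])
  rw [hline.unique hline'] at h5
  exact h5

/-- **Jacobi's formula** for a solution of the matrix equation `m' = A m`. -/
theorem hasDerivAt_det {m : ℝ → Matrix ι ι ℝ} {A : Matrix ι ι ℝ} {t : ℝ}
    (hm : ∀ i j, HasDerivAt (fun s => m s i j) ((A * m t) i j) t) (h0 : (m t).det ≠ 0) :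
    HasDerivAt (fun s => (m s).det) (A.trace * (m t).det) t := by
  have hu : IsUnit (m t).det := isUnit_iff_ne_zero.2 h0
  have h1 : HasDerivAt (fun s => (m s * (m t)⁻¹).det) A.trace t := by
    refine hasDerivAt_det_of_eq_one (fun i j => ?_) (Matrix.mul_nonsing_inv _ hu)
    have h2 : HasDerivAt (fun s => ∑ k, m s i k * (m t)⁻¹ k j)
        (∑ k, (A * m t) i k * (m t)⁻¹ k j) t :=
      HasDerivAt.fun_sum fun k _ => (hm i k).mul_const _
    have h3 : ∑ k, (A * m t) i k * (m t)⁻¹ k j = A i j := by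
      rw [← Matrix.mul_apply, Matrix.mul_assoc, Matrix.mul_nonsing_inv _ hu, Matrix.mul_one]
    rw [h3] at h2
    simpa only [Matrix.mul_apply] using h2
  have h4 : (fun s => (m s).det) = fun s => (m s * (m t)⁻¹).det * (m t).det := by
    ext s
    rw [← Matrix.det_mul, Matrix.mul_assoc, Matrix.nonsing_inv_mul _ hu, Matrix.mul_one]
  rw [h4]
  exact h1.mul_const (m t).det

end Jacobi

/-! ### Partial derivatives on space-time -/

section Flow

variable {n : ℕ} {T : ℝ} {Ω₀ : Set (EuclideanSpace ℝ (Fin (n + 1)))}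
  {Ω : ℝ → Set (EuclideanSpace ℝ (Fin (n + 1)))}
  {φ : ℝ → EuclideanSpace ℝ (Fin (n + 1)) → EuclideanSpace ℝ (Fin (n + 1))}
  {f : ℝ → EuclideanSpace ℝ (Fin (n + 1)) → ℝ} {τ : ℝ → ℝ} {t : ℝ}
  {x q : EuclideanSpace ℝ (Fin (n + 1))}

/-- The partial derivative in the `i`-th space direction, taken within the closed space-time
region. -/
noncomputable def spaceDeriv (T : ℝ) (Ω : ℝ → Set (EuclideanSpace ℝ (Fin (n + 1))))
    (i : Fin (n + 1)) :
    (ℝ × EuclideanSpace ℝ (Fin (n + 1)) → ℝ) → ℝ × EuclideanSpace ℝ (Fin (n + 1)) → ℝ :=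
  dirDeriv (spaceTime T Ω) (0, EuclideanSpace.single i 1)

/-- The partial derivative in time, taken within the closed space-time region. -/
noncomputable def timeDeriv (T : ℝ) (Ω : ℝ → Set (EuclideanSpace ℝ (Fin (n + 1)))) :
    (ℝ × EuclideanSpace ℝ (Fin (n + 1)) → ℝ) → ℝ × EuclideanSpace ℝ (Fin (n + 1)) → ℝ :=
  dirDeriv (spaceTime T Ω) (1, 0)

theorem IsSmoothEvolution.contDiffOn_spaceDeriv (h : IsSmoothEvolution T Ω₀ Ω φ)
    {G : ℝ × EuclideanSpace ℝ (Fin (n + 1)) → ℝ} (hG : ContDiffOn ℝ ∞ G (spaceTime T Ω))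
    (i : Fin (n + 1)) : ContDiffOn ℝ ∞ (spaceDeriv T Ω i G) (spaceTime T Ω) :=
  contDiffOn_dirDeriv h.uniqueDiffOn_spaceTime hG _

theorem IsSmoothEvolution.contDiffOn_timeDeriv (h : IsSmoothEvolution T Ω₀ Ω φ)
    {G : ℝ × EuclideanSpace ℝ (Fin (n + 1)) → ℝ} (hG : ContDiffOn ℝ ∞ G (spaceTime T Ω)) :
    ContDiffOn ℝ ∞ (timeDeriv T Ω G) (spaceTime T Ω) :=
  contDiffOn_dirDeriv h.uniqueDiffOn_spaceTime hG _

theorem IsSmoothEvolution.fderivWithin_single (h : IsSmoothEvolution T Ω₀ Ω φ) (ht : t ∈ Ioo 0 T)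
    (hx : x ∈ closure (Ω t)) {G : ℝ × EuclideanSpace ℝ (Fin (n + 1)) → ℝ}
    (hG : ContDiffOn ℝ ∞ G (spaceTime T Ω)) (i : Fin (n + 1)) :
    fderivWithin ℝ (fun y => G (t, y)) (closure (Ω t)) x (EuclideanSpace.single i 1) =
      spaceDeriv T Ω i G (t, x) :=
  h.fderivWithin_slice ht hx hG _

theorem gradientWithin_apply {s : Set (EuclideanSpace ℝ (Fin (n + 1)))}
    (g : EuclideanSpace ℝ (Fin (n + 1)) → ℝ) (x : EuclideanSpace ℝ (Fin (n + 1)))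
    (i : Fin (n + 1)) :
    gradientWithin g s x i = fderivWithin ℝ g s x (EuclideanSpace.single i 1) := by
  rw [← inner_gradientWithin_left, EuclideanSpace.inner_single_right]
  simp

theorem gradientWithin_eq_gradient {s : Set (EuclideanSpace ℝ (Fin (n + 1)))} (hs : s ∈ 𝓝 x)
    (g : EuclideanSpace ℝ (Fin (n + 1)) → ℝ) : gradientWithin g s x = gradient g x := by
  rw [gradientWithin, gradient, fderivWithin_of_mem_nhds hs]

theorem IsSmoothEvolution.gradientWithin_apply (h : IsSmoothEvolution T Ω₀ Ω φ) (ht : t ∈ Ioo 0 T)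
    (hx : x ∈ closure (Ω t)) {G : ℝ × EuclideanSpace ℝ (Fin (n + 1)) → ℝ}
    (hG : ContDiffOn ℝ ∞ G (spaceTime T Ω)) (i : Fin (n + 1)) :
    gradientWithin (fun y => G (t, y)) (closure (Ω t)) x i = spaceDeriv T Ω i G (t, x) := by
  rw [EvolvingDomain.gradientWithin_apply, h.fderivWithin_single ht hx hG]

theorem IsSmoothEvolution.closure_mem_nhds (h : IsSmoothEvolution T Ω₀ Ω φ) (ht : t ∈ Ioo 0 T)
    (hx : x ∈ Ω t) : closure (Ω t) ∈ 𝓝 x :=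
  mem_of_superset ((h.domain t ht).isOpen.mem_nhds hx) subset_closure

/-- `f` as a function on space-time. -/
abbrev potential (f : ℝ → EuclideanSpace ℝ (Fin (n + 1)) → ℝ) :
    ℝ × EuclideanSpace ℝ (Fin (n + 1)) → ℝ := fun p => f p.1 p.2

theorem IsGradientEvolution.gradient_apply (h : IsGradientEvolution T Ω₀ Ω φ f τ)
    (ht : t ∈ Ioo 0 T) (hx : x ∈ Ω t) (i : Fin (n + 1)) :
    gradient (f t) x i = spaceDeriv T Ω i (potential f) (t, x) := by
  rw [← gradientWithin_eq_gradient (h.evolution.closure_mem_nhds ht hx)]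
  exact h.evolution.gradientWithin_apply ht (subset_closure hx) h.contDiffOn i

theorem IsGradientEvolution.norm_gradient_sq (h : IsGradientEvolution T Ω₀ Ω φ f τ)
    (ht : t ∈ Ioo 0 T) (hx : x ∈ Ω t) :
    ‖gradient (f t) x‖ ^ 2 = ∑ i, spaceDeriv T Ω i (potential f) (t, x) ^ 2 := by
  rw [EuclideanSpace.norm_sq_eq]
  simp only [h.gradient_apply ht hx, Real.norm_eq_abs, sq_abs]

/-- The derivative along the flow is `∂/∂t - ∇f · ∇`. -/
theorem IsGradientEvolution.hasDerivAt_comp_flow (h : IsGradientEvolution T Ω₀ Ω φ f τ)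
    (ht : t ∈ Ioo 0 T) (hq : q ∈ Ω₀) {G : ℝ × EuclideanSpace ℝ (Fin (n + 1)) → ℝ}
    (hG : ContDiffOn ℝ ∞ G (spaceTime T Ω)) :
    HasDerivAt (fun s => G (s, φ s q))
      (timeDeriv T Ω G (t, φ t q) - ∑ i, spaceDeriv T Ω i (potential f) (t, φ t q) *
        spaceDeriv T Ω i G (t, φ t q)) t := by
  have hx := h.evolution.mapsTo ht hq
  have hn := h.evolution.spaceTime_mem_nhds ht hx
  have hd : HasFDerivAt G (fderiv ℝ G (t, φ t q)) (t, φ t q) :=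
    ((hG.contDiffAt hn).differentiableAt (by simp)).hasFDerivAt
  have hcurve : HasDerivAt (fun s => (s, φ s q)) (1, -gradient (f t) (φ t q)) t :=
    (hasDerivAt_id t).prodMk (h.flow t ht q hq)
  have h1 := hd.comp_hasDerivAt t hcurve
  have hvec : ((1 : ℝ), -gradient (f t) (φ t q)) = (1, 0) -
      ∑ i, spaceDeriv T Ω i (potential f) (t, φ t q) •
        ((0 : ℝ), EuclideanSpace.single i (1 : ℝ)) := by
    refine Prod.ext ?_ ?_
    · simp [Prod.fst_sum]
    · ext j
      simp [Prod.snd_sum, h.gradient_apply ht hx, Finset.sum_apply, Pi.single_apply]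
  rw [hvec, map_sub, map_sum] at h1
  simp only [map_smul, smul_eq_mul] at h1
  simp only [timeDeriv, spaceDeriv, dirDeriv_eq_fderiv hn] at h1 ⊢
  exact h1

end Flow

/-! ### The Jacobian determinant of the flow -/

section SecondDerivative

variable {X F : Type*} [NormedAddCommGroup X] [NormedSpace ℝ X] [NormedAddCommGroup F]
  [NormedSpace ℝ F] {Φ : X → F} {p : X}

theorem ContDiffAt.hasFDerivAt_fderiv_apply (hΦ : ContDiffAt ℝ ∞ Φ p) (v : X) :
    HasFDerivAt (fun y => fderiv ℝ Φ y v) ((fderiv ℝ (fderiv ℝ Φ) p).flip v) p :=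
  (ContinuousLinearMap.apply ℝ F v).hasFDerivAt.comp p
    ((hΦ.fderiv_right (m := ∞) (by simp)).differentiableAt (by simp)).hasFDerivAt

theorem ContDiffAt.hasDerivAt_fderiv_apply_curve (hΦ : ContDiffAt ℝ ∞ Φ p) (v : X) {c : ℝ → X}
    {c' : X} {r : ℝ} (hc : HasDerivAt c c' r) (hr : c r = p) :
    HasDerivAt (fun s => fderiv ℝ Φ (c s) v) (fderiv ℝ (fderiv ℝ Φ) p c' v) r := by
  subst hr
  exact (ContDiffAt.hasFDerivAt_fderiv_apply hΦ v).comp_hasDerivAt r hc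

theorem ContDiffAt.isSymmSndFDerivAt_of_top (hΦ : ContDiffAt ℝ ∞ Φ p) (v w : X) :
    fderiv ℝ (fderiv ℝ Φ) p v w = fderiv ℝ (fderiv ℝ Φ) p w v :=
  hΦ.isSymmSndFDerivAt (by
    rw [minSmoothness_of_isRCLikeNormedField]
    exact WithTop.coe_le_coe.2 (le_top (a := (2 : ℕ∞)))) v w

end SecondDerivative

section Flow

variable {n : ℕ} {T : ℝ} {Ω₀ : Set (EuclideanSpace ℝ (Fin (n + 1)))}
  {Ω : ℝ → Set (EuclideanSpace ℝ (Fin (n + 1)))}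
  {φ : ℝ → EuclideanSpace ℝ (Fin (n + 1)) → EuclideanSpace ℝ (Fin (n + 1))}
  {f : ℝ → EuclideanSpace ℝ (Fin (n + 1)) → ℝ} {τ : ℝ → ℝ} {t : ℝ}
  {x q : EuclideanSpace ℝ (Fin (n + 1))}

theorem IsSmoothEvolution.contDiffAt (h : IsSmoothEvolution T Ω₀ Ω φ) (ht : t ∈ Ioo 0 T)
    (hq : q ∈ Ω₀) :
    ContDiffAt ℝ ∞ (fun p : ℝ × EuclideanSpace ℝ (Fin (n + 1)) => φ p.1 p.2) (t, q) :=
  h.contDiffOn.contDiffAt (mem_of_superset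
    ((isOpen_Ioo.prod h.reference.isOpen).mem_nhds ⟨ht, hq⟩) (prod_mono_right subset_closure))

theorem IsSmoothEvolution.hasFDerivAt_slice (h : IsSmoothEvolution T Ω₀ Ω φ) (ht : t ∈ Ioo 0 T)
    (hq : q ∈ Ω₀) : HasFDerivAt (φ t)
      ((fderiv ℝ (fun p : ℝ × EuclideanSpace ℝ (Fin (n + 1)) => φ p.1 p.2) (t, q)).comp
        (ContinuousLinearMap.inr ℝ ℝ (EuclideanSpace ℝ (Fin (n + 1))))) q :=
  ((h.contDiffAt ht hq).differentiableAt (by simp)).hasFDerivAt.comp q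
    (hasFDerivAt_prodMk_right t q)

theorem IsSmoothEvolution.det_fderiv_ne_zero (h : IsSmoothEvolution T Ω₀ Ω φ) (ht : t ∈ Ioo 0 T)
    (hq : q ∈ Ω₀) : (fderiv ℝ (φ t) q).det ≠ 0 := by
  have h1 := h.injective_fderivWithin ht (subset_closure hq)
  rw [fderivWithin_closure_eq h.reference.isOpen hq] at h1
  intro h0
  have h2 := LinearMap.bot_lt_ker_of_det_eq_zero h0
  rw [LinearMap.ker_eq_bot.2 h1] at h2
  exact lt_irrefl _ h2

/-- The matrix of the spatial differential of the flow. -/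
noncomputable def flowMatrix
    (φ : ℝ → EuclideanSpace ℝ (Fin (n + 1)) → EuclideanSpace ℝ (Fin (n + 1)))
    (q : EuclideanSpace ℝ (Fin (n + 1))) (s : ℝ) : Matrix (Fin (n + 1)) (Fin (n + 1)) ℝ :=
  Matrix.of fun i j => fderiv ℝ (φ s) q (EuclideanSpace.single j 1) i

theorem det_flowMatrix (φ : ℝ → EuclideanSpace ℝ (Fin (n + 1)) → EuclideanSpace ℝ (Fin (n + 1)))
    (q : EuclideanSpace ℝ (Fin (n + 1))) (s : ℝ) :
    (flowMatrix φ q s).det = (fderiv ℝ (φ s) q).det := by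
  have h1 := LinearMap.det_toMatrix (EuclideanSpace.basisFun (Fin (n + 1)) ℝ).toBasis
    (fderiv ℝ (φ s) q).toLinearMap
  rw [ContinuousLinearMap.det, ← h1]
  congr 1

theorem IsSmoothEvolution.fderiv_apply (h : IsSmoothEvolution T Ω₀ Ω φ) (ht : t ∈ Ioo 0 T)
    (hq : q ∈ Ω₀) (e : EuclideanSpace ℝ (Fin (n + 1))) : fderiv ℝ (φ t) q e =
      fderiv ℝ (fun p : ℝ × EuclideanSpace ℝ (Fin (n + 1)) => φ p.1 p.2) (t, q) (0, e) := by
  rw [(h.hasFDerivAt_slice ht hq).fderiv]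
  rfl

/-- The flow equation `∂ₜφ = -∇f(φ)`, in components. -/
theorem IsGradientEvolution.fderiv_time_apply (h : IsGradientEvolution T Ω₀ Ω φ f τ)
    (ht : t ∈ Ioo 0 T) (hq : q ∈ Ω₀) (i : Fin (n + 1)) :
    fderiv ℝ (fun p : ℝ × EuclideanSpace ℝ (Fin (n + 1)) => φ p.1 p.2) (t, q) (1, 0) i =
      -spaceDeriv T Ω i (potential f) (t, φ t q) := by
  have h3 := ((h.evolution.contDiffAt ht hq).differentiableAt
    (by simp)).hasFDerivAt.comp_hasDerivAt t ((hasDerivAt_id t).prodMk (hasDerivAt_const t q))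
  rw [h3.unique (h.flow t ht q hq), PiLp.neg_apply,
    h.gradient_apply ht (h.evolution.mapsTo ht hq)]

theorem hasDerivAt_coord {A : ℝ → EuclideanSpace ℝ (Fin (n + 1))}
    {A' : EuclideanSpace ℝ (Fin (n + 1))} {s : ℝ} (hA : HasDerivAt A A' s) (i : Fin (n + 1)) :
    HasDerivAt (fun r => A r i) (A' i) s :=
  (EuclideanSpace.proj (𝕜 := ℝ) i).hasFDerivAt.comp_hasDerivAt s hA

theorem IsSmoothEvolution.hasDerivAt_comp_line (h : IsSmoothEvolution T Ω₀ Ω φ) (ht : t ∈ Ioo 0 T)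
    (hq : q ∈ Ω₀) {G : ℝ × EuclideanSpace ℝ (Fin (n + 1)) → ℝ}
    (hG : ContDiffOn ℝ ∞ G (spaceTime T Ω)) (e : EuclideanSpace ℝ (Fin (n + 1))) :
    HasDerivAt (fun r : ℝ => G (t, φ t (q + r • e)))
      (∑ k, spaceDeriv T Ω k G (t, φ t q) * fderiv ℝ (φ t) q e k) 0 := by
  have hn := h.spaceTime_mem_nhds ht (h.mapsTo ht hq)
  have hl : HasDerivAt (fun r : ℝ => q + r • e) e 0 := by
    simpa using ((hasDerivAt_id (0 : ℝ)).smul_const e).const_add q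
  have hq0 : q + (0 : ℝ) • e = q := by simp
  have hφ : HasFDerivAt (φ t) (fderiv ℝ (φ t) q) (q + (0 : ℝ) • e) := by
    rw [hq0]; exact (h.hasFDerivAt_slice ht hq).differentiableAt.hasFDerivAt
  have hgd : HasFDerivAt G (fderiv ℝ G (t, φ t q)) (t, φ t (q + (0 : ℝ) • e)) := by
    rw [hq0]; exact ((hG.contDiffAt hn).differentiableAt (by simp)).hasFDerivAt
  have h1 := hgd.comp_hasDerivAt (0 : ℝ) ((hasDerivAt_const (0 : ℝ) t).prodMk
    (hφ.comp_hasDerivAt (0 : ℝ) hl))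
  refine h1.congr_deriv ?_
  have hsum : ((0 : ℝ), fderiv ℝ (φ t) q e) =
      ∑ k, fderiv ℝ (φ t) q e k • ((0 : ℝ), EuclideanSpace.single k (1 : ℝ)) := by
    refine Prod.ext ?_ ?_
    · simp [Prod.fst_sum]
    · ext l
      simp [Prod.snd_sum, Finset.sum_apply, Pi.single_apply]
  rw [hsum, map_sum]
  refine Finset.sum_congr rfl fun k _ => ?_
  rw [map_smul, smul_eq_mul, mul_comm, spaceDeriv, dirDeriv_eq_fderiv hn]

/-- The linearized flow equation `∂ₜ Dφ = -(∇²f) Dφ`, by the symmetry of second derivatives. -/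
theorem IsGradientEvolution.hasDerivAt_flowMatrix (h : IsGradientEvolution T Ω₀ Ω φ f τ)
    (ht : t ∈ Ioo 0 T) (hq : q ∈ Ω₀) (i j : Fin (n + 1)) :
    HasDerivAt (fun s => flowMatrix φ q s i j)
      (((-Matrix.of fun i k => spaceDeriv T Ω k (spaceDeriv T Ω i (potential f)) (t, φ t q)) *
        flowMatrix φ q t) i j) t := by
  set e : EuclideanSpace ℝ (Fin (n + 1)) := EuclideanSpace.single j 1 with he
  have hc := h.evolution.contDiffAt ht hq
  have hleft := (hasDerivAt_coord (ContDiffAt.hasDerivAt_fderiv_apply_curve hc (0, e)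
    ((hasDerivAt_id t).prodMk (hasDerivAt_const t q)) rfl) i).congr_of_eventuallyEq
    (f₁ := fun s => flowMatrix φ q s i j) (by
      filter_upwards [isOpen_Ioo.mem_nhds ht] with s hs
      rw [flowMatrix, Matrix.of_apply, ← he, h.evolution.fderiv_apply hs hq]
      rfl)
  refine hleft.congr_deriv ?_
  rw [ContDiffAt.isSymmSndFDerivAt_of_top hc]
  have hl : HasDerivAt (fun r : ℝ => (t, q + r • e)) (0, e) 0 := by
    refine (hasDerivAt_const 0 t).prodMk ?_
    simpa using ((hasDerivAt_id (0 : ℝ)).smul_const e).const_add q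
  -- the other order of differentiation: the flow equation is differentiated in the direction `e`
  have hright := hasDerivAt_coord
    (ContDiffAt.hasDerivAt_fderiv_apply_curve hc (1, 0) hl (by simp)) i
  have hev : (fun r : ℝ => fderiv ℝ (fun p : ℝ × EuclideanSpace ℝ (Fin (n + 1)) => φ p.1 p.2)
      (t, q + r • e) (1, 0) i) =ᶠ[𝓝 0]
      fun r => -spaceDeriv T Ω i (potential f) (t, φ t (q + r • e)) := by
    have hcont : Tendsto (fun r : ℝ => q + r • e) (𝓝 0) (𝓝 q) := by
      have : Continuous fun r : ℝ => q + r • e := by fun_prop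
      simpa using this.tendsto 0
    filter_upwards [hcont.eventually (h.evolution.reference.isOpen.mem_nhds hq)] with r hr
    exact h.fderiv_time_apply ht hr i
  rw [hright.unique ((h.evolution.hasDerivAt_comp_line ht hq
    (h.evolution.contDiffOn_spaceDeriv h.contDiffOn i) e).neg.congr_of_eventuallyEq hev)]
  simp only [Matrix.neg_apply, Matrix.mul_apply, Matrix.of_apply, flowMatrix, he, neg_mul,
    Finset.sum_neg_distrib]

/-- Jacobi's formula along the flow: `∂ₜ |det Dφ| = -Δf |det Dφ|`. -/
theorem IsGradientEvolution.hasDerivAt_abs_det (h : IsGradientEvolution T Ω₀ Ω φ f τ)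
    (ht : t ∈ Ioo 0 T) (hq : q ∈ Ω₀) :
    HasDerivAt (fun s => |(fderiv ℝ (φ s) q).det|)
      (-(∑ i, spaceDeriv T Ω i (spaceDeriv T Ω i (potential f)) (t, φ t q)) *
        |(fderiv ℝ (φ t) q).det|) t := by
  have h0 := h.evolution.det_fderiv_ne_zero ht hq
  have h1 := hasDerivAt_det (fun i j => h.hasDerivAt_flowMatrix ht hq i j)
    (by rwa [det_flowMatrix])
  simp only [det_flowMatrix] at h1
  have h2 := (hasDerivAt_abs h0).comp t h1
  refine h2.congr_deriv ?_
  rw [Matrix.trace_neg, ← self_mul_sign (fderiv ℝ (φ t) q).det]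
  simp only [Matrix.trace, Matrix.diag_apply, Matrix.of_apply]
  ring

end Flow

/-! ### The evolution equation and the density -/

section Equation

variable {n : ℕ} {T : ℝ} {Ω₀ : Set (EuclideanSpace ℝ (Fin (n + 1)))}
  {Ω : ℝ → Set (EuclideanSpace ℝ (Fin (n + 1)))}
  {φ : ℝ → EuclideanSpace ℝ (Fin (n + 1)) → EuclideanSpace ℝ (Fin (n + 1))}
  {f : ℝ → EuclideanSpace ℝ (Fin (n + 1)) → ℝ} {τ : ℝ → ℝ} {t : ℝ}
  {x q : EuclideanSpace ℝ (Fin (n + 1))}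
  {G : ℝ × EuclideanSpace ℝ (Fin (n + 1)) → ℝ}

theorem IsSmoothEvolution.fderivWithin_fderivWithin_single (h : IsSmoothEvolution T Ω₀ Ω φ)
    (ht : t ∈ Ioo 0 T) (hx : x ∈ closure (Ω t)) (hG : ContDiffOn ℝ ∞ G (spaceTime T Ω))
    (i j : Fin (n + 1)) :
    fderivWithin ℝ (fderivWithin ℝ (fun y => G (t, y)) (closure (Ω t))) (closure (Ω t)) x
      (EuclideanSpace.single i 1) (EuclideanSpace.single j 1) =
      spaceDeriv T Ω i (spaceDeriv T Ω j G) (t, x) := by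
  have hu := (h.domain t ht).uniqueDiffOn_closure
  have hd : DifferentiableWithinAt ℝ (fderivWithin ℝ (fun y => G (t, y)) (closure (Ω t)))
      (closure (Ω t)) x :=
    ((contDiffOn_slice hG ht).fderivWithin hu (m := 1)
      (by exact WithTop.coe_le_coe.2 le_top)).differentiableOn (by simp) x hx
  rw [← h.fderivWithin_single ht hx (h.contDiffOn_spaceDeriv hG j),
    ← fderivWithin_congr (fun y hy => h.fderivWithin_single ht hy hG j)
      (h.fderivWithin_single ht hx hG j),
    fderivWithin_clm_apply (hu x hx) hd (differentiableWithinAt_const _)]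
  simp

theorem IsSmoothEvolution.laplacianWithin_eq (h : IsSmoothEvolution T Ω₀ Ω φ)
    (ht : t ∈ Ioo 0 T) (hx : x ∈ closure (Ω t)) (hG : ContDiffOn ℝ ∞ G (spaceTime T Ω)) :
    InnerProductSpace.laplacianWithin (fun y => G (t, y)) (closure (Ω t)) x =
      ∑ i, spaceDeriv T Ω i (spaceDeriv T Ω i G) (t, x) := by
  rw [InnerProductSpace.laplacianWithin_eq_iteratedFDerivWithin_orthonormalBasis _
    (h.domain t ht).uniqueDiffOn_closure hx (EuclideanSpace.basisFun (Fin (n + 1)) ℝ)]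
  refine Finset.sum_congr rfl fun i _ => ?_
  rw [iteratedFDerivWithin_two_apply _ (h.domain t ht).uniqueDiffOn_closure hx]
  simpa using h.fderivWithin_fderivWithin_single ht hx hG i i

theorem IsSmoothEvolution.laplacian_eq (h : IsSmoothEvolution T Ω₀ Ω φ)
    (ht : t ∈ Ioo 0 T) (hx : x ∈ Ω t) (hG : ContDiffOn ℝ ∞ G (spaceTime T Ω)) :
    Laplacian.laplacian (fun y => G (t, y)) x =
      ∑ i, spaceDeriv T Ω i (spaceDeriv T Ω i G) (t, x) := by
  rw [← h.laplacianWithin_eq ht (subset_closure hx) hG,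
    InnerProductSpace.laplacianWithin_eq_iteratedFDerivWithin_orthonormalBasis _
    (h.domain t ht).uniqueDiffOn_closure (subset_closure hx)
    (EuclideanSpace.basisFun (Fin (n + 1)) ℝ),
    InnerProductSpace.laplacian_eq_iteratedFDeriv_orthonormalBasis _
    (EuclideanSpace.basisFun (Fin (n + 1)) ℝ)]
  refine Finset.sum_congr rfl fun i _ => ?_
  rw [iteratedFDerivWithin_eq_iteratedFDeriv (h.domain t ht).uniqueDiffOn_closure
    (((contDiffOn_slice hG ht).contDiffAt (h.closure_mem_nhds ht hx)).of_le
      (by exact WithTop.coe_le_coe.2 le_top)) (subset_closure hx)]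

theorem IsGradientEvolution.hessian_eq (h : IsGradientEvolution T Ω₀ Ω φ f τ)
    (ht : t ∈ Ioo 0 T) (hx : x ∈ Ω t) (i j : Fin (n + 1)) :
    hessian (f t) x i j = spaceDeriv T Ω i (spaceDeriv T Ω j (potential f)) (t, x) := by
  rw [hessian, ← h.evolution.fderivWithin_fderivWithin_single ht (subset_closure hx)
    h.contDiffOn i j, fderivWithin_of_mem_nhds (h.evolution.closure_mem_nhds ht hx)]
  congr 2
  refine Filter.EventuallyEq.fderiv_eq ?_
  filter_upwards [(h.evolution.domain t ht).isOpen.mem_nhds hx] with y hy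
  exact (fderivWithin_closure_eq (h.evolution.domain t ht).isOpen hy _).symm

theorem IsSmoothEvolution.timeDeriv_eq (h : IsSmoothEvolution T Ω₀ Ω φ)
    (ht : t ∈ Ioo 0 T) (hx : x ∈ Ω t) (hG : ContDiffOn ℝ ∞ G (spaceTime T Ω)) :
    timeDeriv T Ω G (t, x) = deriv (fun s => G (s, x)) t := by
  have hn := h.spaceTime_mem_nhds ht hx
  have h1 := ((hG.contDiffAt hn).differentiableAt (by simp)).hasFDerivAt.comp_hasDerivAt t
    ((hasDerivAt_id t).prodMk (hasDerivAt_const t x))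
  rw [timeDeriv, dirDeriv_eq_fderiv hn]
  exact h1.deriv.symm

/-- The evolution equation, in terms of the partial derivatives on space-time. -/
theorem IsGradientEvolution.timeDeriv_potential (h : IsGradientEvolution T Ω₀ Ω φ f τ)
    (ht : t ∈ Ioo 0 T) (hx : x ∈ Ω t) :
    timeDeriv T Ω (potential f) (t, x) =
      ∑ i, spaceDeriv T Ω i (potential f) (t, x) ^ 2 + ((n : ℝ) + 1) / (2 * τ t) -
        ∑ i, spaceDeriv T Ω i (spaceDeriv T Ω i (potential f)) (t, x) := by
  rw [h.evolution.timeDeriv_eq ht hx h.contDiffOn, ← h.norm_gradient_sq ht hx,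
    ← h.evolution.laplacian_eq ht hx h.contDiffOn, ← h.equation t ht x hx]
  ring

theorem IsGradientEvolution.contDiffOn_tau (h : IsGradientEvolution T Ω₀ Ω φ f τ) :
    ContDiffOn ℝ ∞ τ (Ioo 0 T) :=
  (contDiffOn_infty_iff_deriv_of_isOpen isOpen_Ioo).2
    ⟨fun s hs => (h.tau_deriv s hs).differentiableAt.differentiableWithinAt,
      contDiffOn_const.congr fun s hs => (h.tau_deriv s hs).deriv⟩

theorem IsGradientEvolution.contDiffOn_tau_fst (h : IsGradientEvolution T Ω₀ Ω φ f τ) :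
    ContDiffOn ℝ ∞ (fun p : ℝ × EuclideanSpace ℝ (Fin (n + 1)) => τ p.1) (spaceTime T Ω) :=
  h.contDiffOn_tau.comp contDiffOn_fst fun _ hp => hp.1

theorem IsGradientEvolution.contDiffOn_density (h : IsGradientEvolution T Ω₀ Ω φ f τ) :
    ContDiffOn ℝ ∞ (fun p : ℝ × EuclideanSpace ℝ (Fin (n + 1)) => density (f p.1) (τ p.1) p.2)
      (spaceTime T Ω) := by
  have hpos : ∀ p ∈ spaceTime T Ω, 0 < 4 * Real.pi * τ p.1 := fun p hp =>
    mul_pos (by positivity) (h.tau_pos p.1 hp.1)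
  exact h.contDiffOn.neg.exp.div
    ((contDiffOn_const.mul h.contDiffOn_tau_fst).rpow_const_of_ne fun p hp => (hpos p hp).ne')
    fun p hp => (Real.rpow_pos_of_pos (hpos p hp) _).ne'

/-- The derivative of `u` along the flow is `u Δf`. -/
theorem IsGradientEvolution.hasDerivAt_density_comp_flow (h : IsGradientEvolution T Ω₀ Ω φ f τ)
    (ht : t ∈ Ioo 0 T) (hq : q ∈ Ω₀) :
    HasDerivAt (fun s => density (f s) (τ s) (φ s q))
      ((∑ i, spaceDeriv T Ω i (spaceDeriv T Ω i (potential f)) (t, φ t q)) *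
        density (f t) (τ t) (φ t q)) t := by
  have hτ := h.tau_pos t ht
  have hpos : 0 < 4 * Real.pi * τ t := mul_pos (by positivity) hτ
  have h1 := (h.hasDerivAt_comp_flow ht hq h.contDiffOn).neg.exp
  have h2 := ((h.tau_deriv t ht).const_mul (4 * Real.pi)).rpow_const
    (p := ((n : ℝ) + 1) / 2) (Or.inl hpos.ne')
  have hne := (Real.rpow_pos_of_pos hpos (((n : ℝ) + 1) / 2)).ne'
  refine (h1.div h2 hne).congr_deriv ?_
  have hsq : ∑ i, spaceDeriv T Ω i (potential f) (t, φ t q) *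
      spaceDeriv T Ω i (potential f) (t, φ t q) =
      ∑ i, spaceDeriv T Ω i (potential f) (t, φ t q) ^ 2 :=
    Finset.sum_congr rfl fun i _ => (sq _).symm
  rw [Real.rpow_sub_one hpos.ne', h.timeDeriv_potential ht (h.evolution.mapsTo ht hq), hsq, density]
  have hpi := Real.pi_pos
  simp only [Pi.neg_apply]
  field_simp
  ring

/-- The measure `u dx` is carried along by the flow. -/
theorem IsGradientEvolution.hasDerivAt_abs_det_mul_density
    (h : IsGradientEvolution T Ω₀ Ω φ f τ) (ht : t ∈ Ioo 0 T) (hq : q ∈ Ω₀) :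
    HasDerivAt (fun s => |(fderiv ℝ (φ s) q).det| * density (f s) (τ s) (φ s q)) 0 t := by
  refine ((h.hasDerivAt_abs_det ht hq).mul
    (h.hasDerivAt_density_comp_flow ht hq)).congr_deriv ?_
  ring

theorem IsGradientEvolution.abs_det_mul_density_eq {s : ℝ}
    (h : IsGradientEvolution T Ω₀ Ω φ f τ) (hs : s ∈ Ioo 0 T) (ht : t ∈ Ioo 0 T) (hq : q ∈ Ω₀) :
    |(fderiv ℝ (φ s) q).det| * density (f s) (τ s) (φ s q) =
      |(fderiv ℝ (φ t) q).det| * density (f t) (τ t) (φ t q) :=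
  isOpen_Ioo.is_const_of_deriv_eq_zero isPreconnected_Ioo
    (fun _ hr => (h.hasDerivAt_abs_det_mul_density hr hq).differentiableAt.differentiableWithinAt)
    (fun _ hr => (h.hasDerivAt_abs_det_mul_density hr hq).deriv) hs ht

end Equation

/-! ### Transport of integrals -/

section Transport

variable {n : ℕ} {T : ℝ} {Ω₀ : Set (EuclideanSpace ℝ (Fin (n + 1)))}
  {Ω : ℝ → Set (EuclideanSpace ℝ (Fin (n + 1)))}
  {φ : ℝ → EuclideanSpace ℝ (Fin (n + 1)) → EuclideanSpace ℝ (Fin (n + 1))}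
  {f : ℝ → EuclideanSpace ℝ (Fin (n + 1)) → ℝ} {τ : ℝ → ℝ} {s t : ℝ}
  {x q : EuclideanSpace ℝ (Fin (n + 1))}
  {G : ℝ × EuclideanSpace ℝ (Fin (n + 1)) → ℝ}

theorem IsSmoothEvolution.integral_eq (h : IsSmoothEvolution T Ω₀ Ω φ) (ht : t ∈ Ioo 0 T)
    (g : EuclideanSpace ℝ (Fin (n + 1)) → ℝ) :
    ∫ x in Ω t, g x = ∫ q in Ω₀, |(fderiv ℝ (φ t) q).det| * g (φ t q) := by
  rw [← h.image_eq ht]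
  exact integral_image_eq_integral_abs_det_fderiv_smul volume h.reference.isOpen.measurableSet
    (fun q hq => (h.hasFDerivAt_slice ht hq).differentiableAt.hasFDerivAt.hasFDerivWithinAt)
    ((h.diffeo t ht).1.injOn.mono subset_closure) g

theorem IsSmoothEvolution.integrableOn_comp (h : IsSmoothEvolution T Ω₀ Ω φ) (ht : t ∈ Ioo 0 T)
    {g : EuclideanSpace ℝ (Fin (n + 1)) → ℝ} (hg : IntegrableOn g (Ω t)) :
    IntegrableOn (fun q => |(fderiv ℝ (φ t) q).det| * g (φ t q)) Ω₀ := by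
  rw [← h.image_eq ht] at hg
  exact (integrableOn_image_iff_integrableOn_abs_det_fderiv_smul volume
    h.reference.isOpen.measurableSet
    (fun q hq => (h.hasFDerivAt_slice ht hq).differentiableAt.hasFDerivAt.hasFDerivWithinAt)
    ((h.diffeo t ht).1.injOn.mono subset_closure) g).1 hg

theorem IsSmoothEvolution.continuousOn_comp (h : IsSmoothEvolution T Ω₀ Ω φ)
    (hG : ContinuousOn G (spaceTime T Ω)) :
    ContinuousOn (fun p : ℝ × EuclideanSpace ℝ (Fin (n + 1)) => G (p.1, φ p.1 p.2))
      (Ioo 0 T ×ˢ closure Ω₀) :=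
  hG.comp h.contDiffOn_spaceTimeMap.continuousOn fun p hp => by
    rw [h.spaceTime_eq_image]; exact mem_image_of_mem _ hp

/-- The material derivative `∂G/∂t - ∇f · ∇G`. -/
noncomputable def materialDeriv (T : ℝ) (Ω : ℝ → Set (EuclideanSpace ℝ (Fin (n + 1))))
    (f : ℝ → EuclideanSpace ℝ (Fin (n + 1)) → ℝ) (G : ℝ × EuclideanSpace ℝ (Fin (n + 1)) → ℝ)
    (p : ℝ × EuclideanSpace ℝ (Fin (n + 1))) : ℝ :=
  timeDeriv T Ω G p - ∑ i, spaceDeriv T Ω i (potential f) p * spaceDeriv T Ω i G p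

theorem IsGradientEvolution.continuousOn_materialDeriv (h : IsGradientEvolution T Ω₀ Ω φ f τ)
    (hG : ContDiffOn ℝ ∞ G (spaceTime T Ω)) :
    ContinuousOn (materialDeriv T Ω f G) (spaceTime T Ω) :=
  (h.evolution.contDiffOn_timeDeriv hG).continuousOn.sub
    (continuousOn_finsetSum _ fun i _ =>
      (h.evolution.contDiffOn_spaceDeriv h.contDiffOn i).continuousOn.mul
        (h.evolution.contDiffOn_spaceDeriv hG i).continuousOn)

theorem IsGradientEvolution.integrableOn_mul_density (h : IsGradientEvolution T Ω₀ Ω φ f τ)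
    (ht : t ∈ Ioo 0 T) (hG : ContinuousOn G (spaceTime T Ω)) :
    IntegrableOn (fun x => G (t, x) * density (f t) (τ t) x) (Ω t) :=
  (h.evolution.domain t ht).integrableOn
    ((hG.mul h.contDiffOn_density.continuousOn).comp (by fun_prop) fun x hx => ⟨ht, hx⟩)

/-- **Transport theorem**: as the flow preserves `u dx`, the integral of `G u` changes at the rate
of the material derivative of `G`. -/
theorem IsGradientEvolution.hasDerivAt_integral_mul_density
    (h : IsGradientEvolution T Ω₀ Ω φ f τ) (ht : t ∈ Ioo 0 T)
    (hG : ContDiffOn ℝ ∞ G (spaceTime T Ω)) :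
    HasDerivAt (fun s => ∫ x in Ω s, G (s, x) * density (f s) (τ s) x)
      (∫ x in Ω t, materialDeriv T Ω f G (t, x) * density (f t) (τ t) x) t := by
  have hΩ₀ := h.evolution.reference
  set c : EuclideanSpace ℝ (Fin (n + 1)) → ℝ := fun q =>
    |(fderiv ℝ (φ t) q).det| * density (f t) (τ t) (φ t q) with hc
  -- the change of variables `φ s` moves all integrals to the fixed domain `Ω₀`, with weight `c`.
  have hpull : ∀ (H : ℝ × EuclideanSpace ℝ (Fin (n + 1)) → ℝ), ∀ s ∈ Ioo 0 T,
      ∫ x in Ω s, H (s, x) * density (f s) (τ s) x = ∫ q in Ω₀, H (s, φ s q) * c q := by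
    intro H s hs
    rw [h.evolution.integral_eq hs]
    refine setIntegral_congr_fun hΩ₀.isOpen.measurableSet fun q hq => ?_
    simp only [hc, ← h.abs_det_mul_density_eq hs ht hq]
    ring
  have hci : IntegrableOn c Ω₀ := h.evolution.integrableOn_comp ht
    (by simpa using h.integrableOn_mul_density ht (G := fun _ => 1) continuousOn_const)
  have hmeas : ∀ (H : ℝ × EuclideanSpace ℝ (Fin (n + 1)) → ℝ), ContinuousOn H (spaceTime T Ω) →
      ∀ s ∈ Ioo 0 T, AEStronglyMeasurable (fun q => H (s, φ s q) * c q)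
        (volume.restrict Ω₀) := by
    intro H hH s hs
    refine AEStronglyMeasurable.mul ?_ hci.aestronglyMeasurable
    exact ((h.evolution.continuousOn_comp hH).comp (f := fun q => (s, q)) (by fun_prop)
      fun q hq => ⟨hs, subset_closure hq⟩).aestronglyMeasurable hΩ₀.isOpen.measurableSet
  have hsub : Icc (t / 2) ((t + T) / 2) ⊆ Ioo 0 T := fun s hs =>
    ⟨by linarith [ht.1, hs.1], by linarith [ht.2, hs.2]⟩
  have hbd : ∀ (H : ℝ × EuclideanSpace ℝ (Fin (n + 1)) → ℝ), ContinuousOn H (spaceTime T Ω) →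
      ∃ C, ∀ s ∈ Icc (t / 2) ((t + T) / 2), ∀ q ∈ Ω₀, ‖H (s, φ s q)‖ ≤ C := by
    intro H hH
    obtain ⟨C, hC⟩ := (isCompact_Icc.prod hΩ₀.isCompact_closure).exists_bound_of_continuousOn
      ((h.evolution.continuousOn_comp hH).mono (prod_mono_left hsub))
    exact ⟨C, fun s hs q hq => hC (s, q) ⟨hs, subset_closure hq⟩⟩
  obtain ⟨C, hC⟩ := hbd _ (h.continuousOn_materialDeriv hG)
  have htI : t ∈ Ioo (t / 2) ((t + T) / 2) := ⟨by linarith [ht.1], by linarith [ht.2]⟩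
  have hmain := hasDerivAt_integral_of_dominated_loc_of_deriv_le (μ := volume.restrict Ω₀)
    (F := fun s q => G (s, φ s q) * c q) (x₀ := t) (s := Ioo (t / 2) ((t + T) / 2))
    (bound := fun q => C * ‖c q‖)
    (F' := fun s q => materialDeriv T Ω f G (s, φ s q) * c q)
    (isOpen_Ioo.mem_nhds htI)
    (by
      filter_upwards [isOpen_Ioo.mem_nhds ht] with s hs
      exact hmeas G hG.continuousOn s hs)
    (by
      obtain ⟨C', hC'⟩ := hbd _ hG.continuousOn
      refine (hci.norm.const_mul C').mono' (hmeas G hG.continuousOn t ht) ?_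
      filter_upwards [ae_restrict_mem hΩ₀.isOpen.measurableSet] with q hq
      rw [norm_mul]
      exact mul_le_mul_of_nonneg_right (hC' t (Ioo_subset_Icc_self htI) q hq) (norm_nonneg _))
    (hmeas _ (h.continuousOn_materialDeriv hG) t ht)
    (by
      filter_upwards [ae_restrict_mem hΩ₀.isOpen.measurableSet] with q hq s hs
      rw [norm_mul]
      exact mul_le_mul_of_nonneg_right (hC s (Ioo_subset_Icc_self hs) q hq) (norm_nonneg _))
    (hci.norm.const_mul C)
    (by
      filter_upwards [ae_restrict_mem hΩ₀.isOpen.measurableSet] with q hq s hs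
      exact (h.hasDerivAt_comp_flow (hsub (Ioo_subset_Icc_self hs)) hq hG).mul_const (c q))
  rw [hpull _ t ht]
  refine hmain.2.congr_of_eventuallyEq ?_
  filter_upwards [isOpen_Ioo.mem_nhds ht] with s hs
  exact hpull G s hs

/-- The mass `∫ u dx` is constant in time. -/
theorem IsGradientEvolution.hasDerivAt_integral_density
    (h : IsGradientEvolution T Ω₀ Ω φ f τ) (ht : t ∈ Ioo 0 T) :
    HasDerivAt (fun s => ∫ x in Ω s, density (f s) (τ s) x) 0 t := by
  have h1 := h.hasDerivAt_integral_mul_density ht (G := fun _ => 1) contDiffOn_const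
  simp only [one_mul] at h1
  refine h1.congr_deriv ?_
  simp [materialDeriv, timeDeriv, spaceDeriv, dirDeriv_const]

end Transport

/-! ### The evolution of `W` -/

section LineDeriv

variable {X : Type*} [NormedAddCommGroup X] [NormedSpace ℝ X] {S : Set X} {G : X → ℝ} {p : X}

theorem hasDerivAt_comp_add_smul (hG : ContDiffOn ℝ ∞ G S) (hp : S ∈ 𝓝 p) (v : X) :
    HasDerivAt (fun r : ℝ => G (p + r • v)) (dirDeriv S v G p) 0 := by
  have hl : HasDerivAt (fun r : ℝ => p + r • v) v 0 := by
    simpa using ((hasDerivAt_id (0 : ℝ)).smul_const v).const_add p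
  have hd : HasFDerivAt G (fderiv ℝ G p) (p + (0 : ℝ) • v) := by
    rw [zero_smul, add_zero]
    exact ((hG.contDiffAt hp).differentiableAt (by simp)).hasFDerivAt
  rw [dirDeriv_eq_fderiv hp]
  exact hd.comp_hasDerivAt (0 : ℝ) hl

/-- In the interior, a directional derivative can be read off on the line through the point. -/
theorem dirDeriv_eq_of_hasDerivAt (hG : ContDiffOn ℝ ∞ G S) (hp : S ∈ 𝓝 p) {v : X} {d : ℝ}
    (hd : HasDerivAt (fun r : ℝ => G (p + r • v)) d 0) : dirDeriv S v G p = d :=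
  (hasDerivAt_comp_add_smul hG hp v).unique hd

end LineDeriv

section Harnack

variable {n : ℕ} {T : ℝ} {Ω₀ : Set (EuclideanSpace ℝ (Fin (n + 1)))}
  {Ω : ℝ → Set (EuclideanSpace ℝ (Fin (n + 1)))}
  {φ : ℝ → EuclideanSpace ℝ (Fin (n + 1)) → EuclideanSpace ℝ (Fin (n + 1))}
  {f : ℝ → EuclideanSpace ℝ (Fin (n + 1)) → ℝ} {τ : ℝ → ℝ} {s t : ℝ}
  {x : EuclideanSpace ℝ (Fin (n + 1))}
  {G : ℝ × EuclideanSpace ℝ (Fin (n + 1)) → ℝ} {p : ℝ × EuclideanSpace ℝ (Fin (n + 1))}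

/-- `W = τ(2Δf - |∇f|²) + f - (n+1)` as a function on space-time. -/
noncomputable def harnack (T : ℝ) (Ω : ℝ → Set (EuclideanSpace ℝ (Fin (n + 1))))
    (f : ℝ → EuclideanSpace ℝ (Fin (n + 1)) → ℝ) (τ : ℝ → ℝ)
    (p : ℝ × EuclideanSpace ℝ (Fin (n + 1))) : ℝ :=
  τ p.1 * (2 * ∑ i, spaceDeriv T Ω i (spaceDeriv T Ω i (potential f)) p -
    ∑ i, spaceDeriv T Ω i (potential f) p ^ 2) + potential f p - ((n : ℝ) + 1)

theorem IsGradientEvolution.contDiffOn_potential (h : IsGradientEvolution T Ω₀ Ω φ f τ) :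
    ContDiffOn ℝ ∞ (potential f) (spaceTime T Ω) :=
  h.contDiffOn

theorem IsGradientEvolution.contDiffOn_harnack (h : IsGradientEvolution T Ω₀ Ω φ f τ) :
    ContDiffOn ℝ ∞ (harnack T Ω f τ) (spaceTime T Ω) := by
  have h1 := fun i => h.evolution.contDiffOn_spaceDeriv h.contDiffOn_potential i
  have h2 := fun i => h.evolution.contDiffOn_spaceDeriv (h1 i) i
  have h3 : ContDiffOn ℝ ∞ (fun p => ∑ i, spaceDeriv T Ω i (spaceDeriv T Ω i (potential f)) p)
      (spaceTime T Ω) := ContDiffOn.sum fun i _ => h2 i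
  have h4 : ContDiffOn ℝ ∞ (fun p => ∑ i, spaceDeriv T Ω i (potential f) p ^ 2)
      (spaceTime T Ω) := ContDiffOn.sum fun i _ => (h1 i).pow 2
  have h5 := h.contDiffOn_tau_fst.mul (((contDiffOn_const (c := (2 : ℝ))).mul h3).sub h4)
  exact (h5.add h.contDiffOn_potential).sub (contDiffOn_const (c := (n : ℝ) + 1))

theorem IsGradientEvolution.harnackW_eq (h : IsGradientEvolution T Ω₀ Ω φ f τ) (ht : t ∈ Ioo 0 T)
    (hx : x ∈ closure (Ω t)) : harnackW (Ω t) (f t) (τ t) x = harnack T Ω f τ (t, x) := by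
  have h1 : InnerProductSpace.laplacianWithin (f t) (closure (Ω t)) x =
      ∑ i, spaceDeriv T Ω i (spaceDeriv T Ω i (potential f)) (t, x) :=
    h.evolution.laplacianWithin_eq (G := potential f) ht hx h.contDiffOn_potential
  have h2 : ∀ i, gradientWithin (f t) (closure (Ω t)) x i =
      spaceDeriv T Ω i (potential f) (t, x) := fun i =>
    h.evolution.gradientWithin_apply (G := potential f) ht hx h.contDiffOn_potential i
  simp only [harnackW, harnack, h1, EuclideanSpace.norm_sq_eq, h2, Real.norm_eq_abs, sq_abs]

theorem IsGradientEvolution.hasDerivAt_tau_line (h : IsGradientEvolution T Ω₀ Ω φ f τ)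
    (hp : p.1 ∈ Ioo 0 T) (v : ℝ × EuclideanSpace ℝ (Fin (n + 1))) :
    HasDerivAt (fun r : ℝ => τ (p + r • v).1) (-v.1) 0 := by
  have hl : HasDerivAt (fun r : ℝ => p.1 + r * v.1) v.1 0 := by
    simpa using ((hasDerivAt_id (0 : ℝ)).mul_const v.1).const_add p.1
  have hτ : HasDerivAt τ (-1) (p.1 + 0 * v.1) := by simpa using h.tau_deriv p.1 hp
  have := hτ.comp (0 : ℝ) hl
  rw [neg_one_mul] at this
  exact this

/-- A directional derivative of `W`, in terms of the derivatives of `f`. -/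
theorem IsGradientEvolution.dirDeriv_harnack (h : IsGradientEvolution T Ω₀ Ω φ f τ)
    (hp : spaceTime T Ω ∈ 𝓝 p) (v : ℝ × EuclideanSpace ℝ (Fin (n + 1))) :
    dirDeriv (spaceTime T Ω) v (harnack T Ω f τ) p =
      -v.1 * (2 * ∑ i, spaceDeriv T Ω i (spaceDeriv T Ω i (potential f)) p -
        ∑ i, spaceDeriv T Ω i (potential f) p ^ 2) +
      τ p.1 * (2 * ∑ i, dirDeriv (spaceTime T Ω) v
          (spaceDeriv T Ω i (spaceDeriv T Ω i (potential f))) p -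
        2 * ∑ i, spaceDeriv T Ω i (potential f) p *
          dirDeriv (spaceTime T Ω) v (spaceDeriv T Ω i (potential f)) p) +
      dirDeriv (spaceTime T Ω) v (potential f) p := by
  have h1 := fun i => h.evolution.contDiffOn_spaceDeriv h.contDiffOn_potential i
  have h2 := fun i => h.evolution.contDiffOn_spaceDeriv (h1 i) i
  have hd := (((h.hasDerivAt_tau_line (mem_of_mem_nhds hp).1 v).fun_mul
    (((HasDerivAt.fun_sum fun i (_ : i ∈ Finset.univ) =>
      hasDerivAt_comp_add_smul (h2 i) hp v).const_mul 2).fun_sub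
    (HasDerivAt.fun_sum fun i (_ : i ∈ Finset.univ) =>
      (hasDerivAt_comp_add_smul (h1 i) hp v).fun_pow 2))).fun_add
    (hasDerivAt_comp_add_smul h.contDiffOn_potential hp v)).sub_const ((n : ℝ) + 1)
  refine (dirDeriv_eq_of_hasDerivAt h.contDiffOn_harnack hp hd).trans ?_
  simp only [zero_smul, add_zero, Finset.mul_sum, Nat.cast_ofNat, Nat.add_one_sub_one, pow_one,
    mul_assoc]

theorem IsGradientEvolution.spaceDeriv_harnack (h : IsGradientEvolution T Ω₀ Ω φ f τ)
    (hp : spaceTime T Ω ∈ 𝓝 p) (j : Fin (n + 1)) :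
    spaceDeriv T Ω j (harnack T Ω f τ) p =
      τ p.1 * (2 * ∑ i, spaceDeriv T Ω j (spaceDeriv T Ω i (spaceDeriv T Ω i (potential f))) p -
        2 * ∑ i, spaceDeriv T Ω i (potential f) p *
          spaceDeriv T Ω j (spaceDeriv T Ω i (potential f)) p) +
      spaceDeriv T Ω j (potential f) p := by
  refine (h.dirDeriv_harnack hp _).trans ?_
  simp only [neg_zero, zero_mul, zero_add]
  rfl

theorem IsGradientEvolution.spaceDeriv_spaceDeriv_harnack (h : IsGradientEvolution T Ω₀ Ω φ f τ)
    (hp : spaceTime T Ω ∈ 𝓝 p) (j : Fin (n + 1)) :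
    spaceDeriv T Ω j (spaceDeriv T Ω j (harnack T Ω f τ)) p =
      τ p.1 * (2 * ∑ i, spaceDeriv T Ω j (spaceDeriv T Ω j
          (spaceDeriv T Ω i (spaceDeriv T Ω i (potential f)))) p -
        2 * ∑ i, (spaceDeriv T Ω j (spaceDeriv T Ω i (potential f)) p ^ 2 +
          spaceDeriv T Ω i (potential f) p *
          spaceDeriv T Ω j (spaceDeriv T Ω j (spaceDeriv T Ω i (potential f))) p)) +
      spaceDeriv T Ω j (spaceDeriv T Ω j (potential f)) p := by
  have h1 := fun i => h.evolution.contDiffOn_spaceDeriv h.contDiffOn_potential i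
  have h2 := fun j i => h.evolution.contDiffOn_spaceDeriv (h1 i) j
  have h3 := fun i => h.evolution.contDiffOn_spaceDeriv (h2 i i) j
  set v : ℝ × EuclideanSpace ℝ (Fin (n + 1)) := (0, EuclideanSpace.single j 1) with hv
  have hd := ((h.hasDerivAt_tau_line (mem_of_mem_nhds hp).1 v).fun_mul
    (((HasDerivAt.fun_sum fun i (_ : i ∈ Finset.univ) =>
      hasDerivAt_comp_add_smul (h3 i) hp v).const_mul 2).fun_sub
    ((HasDerivAt.fun_sum fun i (_ : i ∈ Finset.univ) =>
      (hasDerivAt_comp_add_smul (h1 i) hp v).fun_mul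
        (hasDerivAt_comp_add_smul (h2 j i) hp v)).const_mul 2))).fun_add
    (hasDerivAt_comp_add_smul (h1 j) hp v)
  have hcont : Tendsto (fun r : ℝ => p + r • v) (𝓝 0) (𝓝 p) := by
    have : Continuous fun r : ℝ => p + r • v := by fun_prop
    simpa using this.tendsto 0
  have hd' := hd.congr_of_eventuallyEq (f₁ := fun r =>
    spaceDeriv T Ω j (harnack T Ω f τ) (p + r • v)) (by
      filter_upwards [hcont.eventually (eventually_mem_nhds_iff.2 hp)] with r hr
      exact h.spaceDeriv_harnack hr j)
  refine (dirDeriv_eq_of_hasDerivAt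
    (h.evolution.contDiffOn_spaceDeriv h.contDiffOn_harnack j) hp hd').trans ?_
  simp only [zero_smul, add_zero, hv, neg_zero, zero_mul, zero_add, sq]
  rfl

/-- The gradient of the evolution equation. -/
theorem IsGradientEvolution.timeDeriv_spaceDeriv (h : IsGradientEvolution T Ω₀ Ω φ f τ)
    (ht : t ∈ Ioo 0 T) (hx : x ∈ Ω t) (i : Fin (n + 1)) :
    timeDeriv T Ω (spaceDeriv T Ω i (potential f)) (t, x) =
      2 * ∑ j, spaceDeriv T Ω j (potential f) (t, x) *
        spaceDeriv T Ω i (spaceDeriv T Ω j (potential f)) (t, x) -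
      ∑ j, spaceDeriv T Ω i (spaceDeriv T Ω j (spaceDeriv T Ω j (potential f))) (t, x) := by
  have hp := h.evolution.spaceTime_mem_nhds ht hx
  have h1 := fun i => h.evolution.contDiffOn_spaceDeriv h.contDiffOn_potential i
  have h2 := fun i => h.evolution.contDiffOn_spaceDeriv (h1 i) i
  set v : ℝ × EuclideanSpace ℝ (Fin (n + 1)) := (0, EuclideanSpace.single i 1) with hv
  have hcont : Tendsto (fun r : ℝ => (t, x) + r • v) (𝓝 0) (𝓝 (t, x)) := by
    have : Continuous fun r : ℝ => (t, x) + r • v := by fun_prop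
    simpa using this.tendsto 0
  have hd := ((HasDerivAt.fun_sum fun j (_ : j ∈ Finset.univ) =>
      (hasDerivAt_comp_add_smul (h1 j) hp v).fun_pow 2).add_const
        (((n : ℝ) + 1) / (2 * τ t))).fun_sub
    (HasDerivAt.fun_sum fun j (_ : j ∈ Finset.univ) => hasDerivAt_comp_add_smul (h2 j) hp v)
  have hd' := hd.congr_of_eventuallyEq (f₁ := fun r =>
    timeDeriv T Ω (potential f) ((t, x) + r • v)) (by
      filter_upwards [hcont.eventually (h.evolution.eventually_mem ht hx)] with r hr
      refine (h.timeDeriv_potential hr.1 hr.2).trans ?_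
      simp [hv])
  refine (dirDeriv_comm h.evolution.uniqueDiffOn_spaceTime h.contDiffOn_potential hp _ _).trans ?_
  refine (dirDeriv_eq_of_hasDerivAt
    (h.evolution.contDiffOn_timeDeriv h.contDiffOn_potential) hp hd').trans ?_
  simp only [zero_smul, add_zero, Nat.cast_ofNat, Nat.add_one_sub_one, pow_one, Finset.mul_sum,
    mul_assoc]
  rfl

/-- The equation for `∂ᵢ∂ᵢf`, from a second differentiation of the evolution equation. -/
theorem IsGradientEvolution.timeDeriv_spaceDeriv_spaceDeriv
    (h : IsGradientEvolution T Ω₀ Ω φ f τ)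
    (ht : t ∈ Ioo 0 T) (hx : x ∈ Ω t) (i : Fin (n + 1)) :
    timeDeriv T Ω (spaceDeriv T Ω i (spaceDeriv T Ω i (potential f))) (t, x) =
      2 * ∑ j, (spaceDeriv T Ω i (spaceDeriv T Ω j (potential f)) (t, x) ^ 2 +
        spaceDeriv T Ω j (potential f) (t, x) *
        spaceDeriv T Ω i (spaceDeriv T Ω i (spaceDeriv T Ω j (potential f))) (t, x)) -
      ∑ j, spaceDeriv T Ω i (spaceDeriv T Ω i
        (spaceDeriv T Ω j (spaceDeriv T Ω j (potential f)))) (t, x) := by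
  have hp := h.evolution.spaceTime_mem_nhds ht hx
  have h1 := fun i => h.evolution.contDiffOn_spaceDeriv h.contDiffOn_potential i
  have h2 := fun j i => h.evolution.contDiffOn_spaceDeriv (h1 i) j
  have h3 := fun j => h.evolution.contDiffOn_spaceDeriv (h2 j j) i
  set v : ℝ × EuclideanSpace ℝ (Fin (n + 1)) := (0, EuclideanSpace.single i 1) with hv
  have hcont : Tendsto (fun r : ℝ => (t, x) + r • v) (𝓝 0) (𝓝 (t, x)) := by
    have : Continuous fun r : ℝ => (t, x) + r • v := by fun_prop
    simpa using this.tendsto 0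
  have hd := ((HasDerivAt.fun_sum fun j (_ : j ∈ Finset.univ) =>
      (hasDerivAt_comp_add_smul (h1 j) hp v).fun_mul
        (hasDerivAt_comp_add_smul (h2 i j) hp v)).const_mul 2).fun_sub
    (HasDerivAt.fun_sum fun j (_ : j ∈ Finset.univ) => hasDerivAt_comp_add_smul (h3 j) hp v)
  have hd' := hd.congr_of_eventuallyEq (f₁ := fun r =>
    timeDeriv T Ω (spaceDeriv T Ω i (potential f)) ((t, x) + r • v)) (by
      filter_upwards [hcont.eventually (h.evolution.eventually_mem ht hx)] with r hr
      exact h.timeDeriv_spaceDeriv hr.1 hr.2 i)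
  refine (dirDeriv_comm h.evolution.uniqueDiffOn_spaceTime (h1 i) hp _ _).trans ?_
  refine (dirDeriv_eq_of_hasDerivAt (h.evolution.contDiffOn_timeDeriv (h1 i)) hp hd').trans ?_
  simp only [zero_smul, add_zero, sq]
  rfl

end Harnack

section Monotonicity

variable {n : ℕ} {T : ℝ} {Ω₀ : Set (EuclideanSpace ℝ (Fin (n + 1)))}
  {Ω : ℝ → Set (EuclideanSpace ℝ (Fin (n + 1)))}
  {φ : ℝ → EuclideanSpace ℝ (Fin (n + 1)) → EuclideanSpace ℝ (Fin (n + 1))}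
  {f : ℝ → EuclideanSpace ℝ (Fin (n + 1)) → ℝ} {τ : ℝ → ℝ} {s t : ℝ}
  {x : EuclideanSpace ℝ (Fin (n + 1))}
  {G : ℝ × EuclideanSpace ℝ (Fin (n + 1)) → ℝ} {p : ℝ × EuclideanSpace ℝ (Fin (n + 1))}

/-- The square of `∇²f - δ/(2τ)` expanded, with `B` for `∇²f` and `c` for `τ`. -/
theorem sum_sq_sub_delta {m : ℕ} (B : Fin m → Fin m → ℝ) {c : ℝ} (hc : c ≠ 0) :
    2 * c * ∑ i, ∑ j, (B i j - (if i = j then 1 else 0) / (2 * c)) ^ 2 =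
      2 * c * ∑ i, ∑ j, B i j ^ 2 - 2 * ∑ i, B i i + m / (2 * c) := by
  have h1 : ∀ i j, (B i j - (if i = j then 1 else 0) / (2 * c)) ^ 2 =
      B i j ^ 2 + if i = j then (-B i j / c + 1 / (2 * c) ^ 2) else 0 := by
    intro i j
    split_ifs <;> field_simp <;> ring
  simp only [h1, Finset.sum_add_distrib, Finset.sum_ite_eq, Finset.mem_univ, if_true,
    Finset.sum_const, Finset.card_univ, Fintype.card_fin, nsmul_eq_mul, ← Finset.sum_div,
    Finset.sum_neg_distrib]
  field_simp
  ring

/-- The cancellations in the evolution of `W`. Here `a`, `b`, `c`, `e`, `d` stand for `∂ᵢf`,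
`∂ᵢ∂ⱼf`, `∂ᵢ∂ⱼ∂ⱼf`, `∂ᵢ∂ᵢ∂ⱼf` and `∂ᵢ∂ᵢ∂ⱼ∂ⱼf`. -/
theorem sum_harnack_identity {m : ℕ} (a : Fin m → ℝ) (b c e d : Fin m → Fin m → ℝ)
    (hec : ∀ i j, e i j = c j i) (r k : ℝ) :
    -1 * (2 * ∑ i, b i i - ∑ i, a i ^ 2) +
      r * (2 * ∑ i, (2 * ∑ j, (b i j ^ 2 + a j * e i j) - ∑ j, d i j) -
        2 * ∑ i, a i * (2 * ∑ j, a j * b i j - ∑ j, c i j)) +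
      (∑ i, a i ^ 2 + k - ∑ i, b i i) +
      ∑ j, (r * (2 * ∑ i, d j i - 2 * ∑ i, (b j i ^ 2 + a i * e j i)) + b j j) -
      2 * ∑ j, a j * (r * (2 * ∑ i, c j i - 2 * ∑ i, a i * b j i) + a j) =
    2 * r * ∑ i, ∑ j, b i j ^ 2 - 2 * ∑ i, b i i + k := by
  have hcomm : ∑ i, ∑ j, a j * e i j = ∑ i, a i * ∑ j, c i j := by
    simp only [hec, Finset.mul_sum]
    exact Finset.sum_comm
  simp only [Finset.sum_add_distrib]
  set P := fun i => ∑ j, a j * b i j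
  set C := fun i => ∑ j, c i j
  set D := fun i => ∑ j, d i j
  set B := fun i => ∑ j, b i j ^ 2
  set E := fun i => ∑ j, a j * e i j
  change ∑ i, E i = ∑ i, a i * C i at hcomm
  have h1 : ∑ i, (2 * (B i + E i) - D i) = 2 * ∑ i, B i + 2 * ∑ i, E i - ∑ i, D i := by
    simp only [Finset.mul_sum, ← Finset.sum_add_distrib, ← Finset.sum_sub_distrib, mul_add]
  have h2 : ∑ i, a i * (2 * P i - C i) = 2 * ∑ i, a i * P i - ∑ i, a i * C i := by
    simp only [Finset.mul_sum, ← Finset.sum_sub_distrib]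
    exact Finset.sum_congr rfl fun i _ => by ring
  have h3 : ∑ j, r * (2 * D j - 2 * (B j + E j)) =
      r * (2 * ∑ i, D i - 2 * ∑ i, B i - 2 * ∑ i, E i) := by
    simp only [Finset.mul_sum, ← Finset.sum_sub_distrib]
    exact Finset.sum_congr rfl fun i _ => by ring
  have h4 : ∑ j, a j * (r * (2 * C j - 2 * P j) + a j) =
      r * (2 * ∑ i, a i * C i - 2 * ∑ i, a i * P i) + ∑ i, a i ^ 2 := by
    simp only [Finset.mul_sum, ← Finset.sum_sub_distrib, ← Finset.sum_add_distrib]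
    exact Finset.sum_congr rfl fun i _ => by ring
  change -1 * (2 * ∑ i, b i i - ∑ i, a i ^ 2) +
      r * (2 * ∑ i, (2 * (B i + E i) - D i) - 2 * ∑ i, a i * (2 * P i - C i)) +
      (∑ i, a i ^ 2 + k - ∑ i, b i i) + (∑ j, r * (2 * D j - 2 * (B j + E j)) + ∑ j, b j j) -
      2 * ∑ j, a j * (r * (2 * C j - 2 * P j) + a j) = 2 * r * ∑ i, B i - 2 * ∑ i, b i i + k
  rw [h1, h2, h3, h4]
  linear_combination 2 * r * hcomm

/-- Pointwise evolution of `W`: `(∂ₜ + Δ - 2∇f · ∇) W = 2τ |∇²f - δ/(2τ)|²`. -/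
theorem IsGradientEvolution.evolution_harnack (h : IsGradientEvolution T Ω₀ Ω φ f τ)
    (ht : t ∈ Ioo 0 T) (hx : x ∈ Ω t) :
    timeDeriv T Ω (harnack T Ω f τ) (t, x) +
        ∑ j, spaceDeriv T Ω j (spaceDeriv T Ω j (harnack T Ω f τ)) (t, x) -
        2 * ∑ j, spaceDeriv T Ω j (potential f) (t, x) *
          spaceDeriv T Ω j (harnack T Ω f τ) (t, x) =
      2 * τ t * solitonDefect (f t) (τ t) x := by
  have hp := h.evolution.spaceTime_mem_nhds ht hx
  have h1 := fun i => h.evolution.contDiffOn_spaceDeriv h.contDiffOn_potential i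
  have hthird : ∀ i j, spaceDeriv T Ω i (spaceDeriv T Ω i (spaceDeriv T Ω j (potential f))) (t, x) =
      spaceDeriv T Ω j (spaceDeriv T Ω i (spaceDeriv T Ω i (potential f))) (t, x) := by
    -- the inner commutation has to hold on a neighbourhood, as it is differentiated once more
    intro i j
    have hev : spaceDeriv T Ω i (spaceDeriv T Ω j (potential f)) =ᶠ[𝓝 (t, x)]
        spaceDeriv T Ω j (spaceDeriv T Ω i (potential f)) := by
      filter_upwards [eventually_mem_nhds_iff.2 hp] with q hq
      exact dirDeriv_comm h.evolution.uniqueDiffOn_spaceTime h.contDiffOn_potential hq _ _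
    exact (dirDeriv_congr hp hev _).trans
      (dirDeriv_comm h.evolution.uniqueDiffOn_spaceTime (h1 i) hp _ _)
  have htime : timeDeriv T Ω (harnack T Ω f τ) (t, x) = _ := h.dirDeriv_harnack hp (1, 0)
  change _ = -1 * (2 * ∑ i, spaceDeriv T Ω i (spaceDeriv T Ω i (potential f)) (t, x) -
      ∑ i, spaceDeriv T Ω i (potential f) (t, x) ^ 2) +
    τ t * (2 * ∑ i, timeDeriv T Ω (spaceDeriv T Ω i (spaceDeriv T Ω i (potential f))) (t, x) -
      2 * ∑ i, spaceDeriv T Ω i (potential f) (t, x) *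
        timeDeriv T Ω (spaceDeriv T Ω i (potential f)) (t, x)) +
    timeDeriv T Ω (potential f) (t, x) at htime
  rw [htime, h.timeDeriv_potential ht hx]
  simp only [h.timeDeriv_spaceDeriv_spaceDeriv ht hx, h.timeDeriv_spaceDeriv ht hx,
    h.spaceDeriv_spaceDeriv_harnack hp, h.spaceDeriv_harnack hp, solitonDefect,
    h.hessian_eq ht hx]
  rw [sum_sq_sub_delta _ (h.tau_pos t ht).ne', Nat.cast_add, Nat.cast_one]
  exact sum_harnack_identity (fun i => spaceDeriv T Ω i (potential f) (t, x))
    (fun i j => spaceDeriv T Ω i (spaceDeriv T Ω j (potential f)) (t, x))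
    (fun i j => spaceDeriv T Ω i (spaceDeriv T Ω j (spaceDeriv T Ω j (potential f))) (t, x)) _
    (fun i j => spaceDeriv T Ω i (spaceDeriv T Ω i
      (spaceDeriv T Ω j (spaceDeriv T Ω j (potential f)))) (t, x)) hthird _ _

/-! ### Integration by parts and the derivative of the entropy -/

/-- Integration by parts against the weight `u`: the drift Laplacian `Δ - ∇f · ∇` is a divergence
with respect to `u dx`. -/
theorem IsGradientEvolution.integral_driftLaplacian (h : IsGradientEvolution T Ω₀ Ω φ f τ)
    (ht : t ∈ Ioo 0 T) (hG : ContDiffOn ℝ ∞ G (spaceTime T Ω)) :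
    ∫ x in Ω t, (∑ i, spaceDeriv T Ω i (spaceDeriv T Ω i G) (t, x) -
        ∑ i, spaceDeriv T Ω i (potential f) (t, x) * spaceDeriv T Ω i G (t, x)) *
          density (f t) (τ t) x =
      ∫ x in frontier (Ω t), ⟪gradientWithin (fun y => G (t, y)) (closure (Ω t)) x,
        outerUnitNormal (Ω t) x⟫_ℝ * density (f t) (τ t) x ∂μHE[n] := by
  have hΩ := h.evolution.domain t ht
  set w : Fin (n + 1) → ℝ × EuclideanSpace ℝ (Fin (n + 1)) → ℝ := fun i p =>
    spaceDeriv T Ω i G p * density (f p.1) (τ p.1) p.2 with hw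
  have hwc : ∀ i, ContDiffOn ℝ ∞ (w i) (spaceTime T Ω) := fun i =>
    (h.evolution.contDiffOn_spaceDeriv hG i).mul h.contDiffOn_density
  have hws : ∀ i, ContDiffOn ℝ 1 (fun y => w i (t, y)) (closure (Ω t)) := fun i =>
    (contDiffOn_slice (hwc i) ht).of_le (by simp)
  have hdiv : ∀ i, ∀ x ∈ Ω t, fderiv ℝ (fun y => w i (t, y)) x (EuclideanSpace.single i 1) =
      (spaceDeriv T Ω i (spaceDeriv T Ω i G) (t, x) -
        spaceDeriv T Ω i (potential f) (t, x) * spaceDeriv T Ω i G (t, x)) *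
          density (f t) (τ t) x := by
    intro i x hx
    have hp := h.evolution.spaceTime_mem_nhds ht hx
    rw [← fderivWithin_closure_eq hΩ.isOpen hx,
      h.evolution.fderivWithin_single ht (subset_closure hx) (hwc i)]
    set v : ℝ × EuclideanSpace ℝ (Fin (n + 1)) := (0, EuclideanSpace.single i 1) with hv
    -- in spatial directions the normalization `(4πτ)^{(n+1)/2}` of `u` is constant
    have hd := (hasDerivAt_comp_add_smul (h.evolution.contDiffOn_spaceDeriv hG i) hp v).fun_mul
      (((hasDerivAt_comp_add_smul h.contDiffOn_potential hp v).fun_neg.exp).div_const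
        ((4 * Real.pi * τ t) ^ (((n : ℝ) + 1) / 2)))
    refine (dirDeriv_eq_of_hasDerivAt (hwc i) hp (hd.congr_of_eventuallyEq
      (Eventually.of_forall fun r => ?_))).trans ?_
    · simp [hw, hv, density]
    · simp only [zero_smul, add_zero, density, hv, spaceDeriv]
      ring
  have hsum := Finset.sum_congr (rfl : Finset.univ = Finset.univ) fun i _ =>
    hΩ.integral_fderiv_eq (hws i) (EuclideanSpace.single i 1)
  rw [← integral_finsetSum _ fun i _ => hΩ.integrableOn_fderiv (hws i) _,
    ← integral_finsetSum _ fun i _ => hΩ.integrableOn_frontier_mul_inner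
      ((hws i).continuousOn.mono frontier_subset_closure) _] at hsum
  refine (setIntegral_congr_fun hΩ.isOpen.measurableSet fun x hx => ?_).trans (hsum.trans
    (setIntegral_congr_fun isClosed_frontier.measurableSet fun x hx => ?_))
  · simp only [hdiv _ x hx, ← Finset.sum_mul, Finset.sum_sub_distrib]
  · simp only [PiLp.inner_apply, hw, Finset.sum_mul,
      h.evolution.gradientWithin_apply ht (frontier_subset_closure hx) hG]
    refine Finset.sum_congr rfl fun i _ => ?_
    simp
    ring

theorem IsGradientEvolution.integrableOn_driftLaplacian (h : IsGradientEvolution T Ω₀ Ω φ f τ)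
    (ht : t ∈ Ioo 0 T) (hG : ContDiffOn ℝ ∞ G (spaceTime T Ω)) :
    IntegrableOn (fun x => (∑ i, spaceDeriv T Ω i (spaceDeriv T Ω i G) (t, x) -
        ∑ i, spaceDeriv T Ω i (potential f) (t, x) * spaceDeriv T Ω i G (t, x)) *
          density (f t) (τ t) x) (Ω t) := by
  have h1 := fun i => h.evolution.contDiffOn_spaceDeriv hG i
  have h2 := fun i => h.evolution.contDiffOn_spaceDeriv (h1 i) i
  have h3 := fun i => h.evolution.contDiffOn_spaceDeriv h.contDiffOn_potential i
  exact h.integrableOn_mul_density ht (G := fun p =>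
    ∑ i, spaceDeriv T Ω i (spaceDeriv T Ω i G) p -
      ∑ i, spaceDeriv T Ω i (potential f) p * spaceDeriv T Ω i G p)
    ((continuousOn_finsetSum _ fun i _ => (h2 i).continuousOn).sub
      (continuousOn_finsetSum _ fun i _ => (h3 i).continuousOn.mul (h1 i).continuousOn))

/-- Under the boundary condition `∇f · ν = β`, the functional `𝒲_β` is the integral of `W u`. -/
theorem IsGradientEvolution.entropyW_eq (h : IsGradientEvolution T Ω₀ Ω φ f τ) (ht : t ∈ Ioo 0 T)
    {β : EuclideanSpace ℝ (Fin (n + 1)) → ℝ}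
    (hβ : ∀ x ∈ frontier (Ω t),
      ⟪gradientWithin (f t) (closure (Ω t)) x, outerUnitNormal (Ω t) x⟫_ℝ = β x) :
    entropyW β (Ω t) (f t) (τ t) =
      ∫ x in Ω t, harnack T Ω f τ (t, x) * density (f t) (τ t) x := by
  have hΩ := h.evolution.domain t ht
  have h1 := fun i => h.evolution.contDiffOn_spaceDeriv h.contDiffOn_potential i
  have hbdry : ∫ x in frontier (Ω t), β x * density (f t) (τ t) x ∂μHE[n] =
      ∫ x in frontier (Ω t), ⟪gradientWithin (fun y => potential f (t, y)) (closure (Ω t)) x,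
        outerUnitNormal (Ω t) x⟫_ℝ * density (f t) (τ t) x ∂μHE[n] :=
    setIntegral_congr_fun isClosed_frontier.measurableSet fun x hx => by
      simp only [← hβ x hx]
  have hcont : ContinuousOn (fun p => τ p.1 * ∑ i, spaceDeriv T Ω i (potential f) p ^ 2 +
      potential f p - ((n : ℝ) + 1)) (spaceTime T Ω) := by
    have h2 : ContinuousOn (fun p => ∑ i, spaceDeriv T Ω i (potential f) p ^ 2)
        (spaceTime T Ω) := continuousOn_finsetSum _ fun i _ => (h1 i).continuousOn.pow 2
    have h3 := h.contDiffOn_tau_fst.continuousOn.mul h2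
    exact (h3.add h.contDiffOn_potential.continuousOn).sub
      (continuousOn_const (c := (n : ℝ) + 1))
  have hint : IntegrableOn (fun x => (τ t * ‖gradient (f t) x‖ ^ 2 + f t x - ((n : ℝ) + 1)) *
      density (f t) (τ t) x) (Ω t) := by
    refine (h.integrableOn_mul_density ht hcont).congr_fun (fun x hx => ?_)
      hΩ.isOpen.measurableSet
    simp only [h.norm_gradient_sq ht hx]
  rw [entropyW, hbdry, ← h.integral_driftLaplacian ht h.contDiffOn_potential,
    ← integral_const_mul, ← integral_add hint
      ((h.integrableOn_driftLaplacian ht h.contDiffOn_potential).const_mul _)]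
  refine setIntegral_congr_fun hΩ.isOpen.measurableSet fun x hx => ?_
  simp only [h.norm_gradient_sq ht hx, harnack, ← sq]
  ring

/-- The monotonicity formula for `𝒲_β`. -/
theorem IsGradientEvolution.hasDerivAt_entropyW (h : IsGradientEvolution T Ω₀ Ω φ f τ)
    {β : ℝ → EuclideanSpace ℝ (Fin (n + 1)) → ℝ}
    (hβ : ∀ t ∈ Ioo 0 T, ∀ x ∈ frontier (Ω t),
      ⟪gradientWithin (f t) (closure (Ω t)) x, outerUnitNormal (Ω t) x⟫_ℝ = β t x)
    (ht : t ∈ Ioo 0 T) :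
    HasDerivAt (fun s => entropyW (β s) (Ω s) (f s) (τ s))
      (2 * τ t * (∫ x in Ω t, solitonDefect (f t) (τ t) x * density (f t) (τ t) x) -
        ∫ x in frontier (Ω t),
          ⟪gradientWithin (harnackW (Ω t) (f t) (τ t)) (closure (Ω t)) x,
            outerUnitNormal (Ω t) x⟫_ℝ * density (f t) (τ t) x ∂μHE[n]) t := by
  have hΩ := h.evolution.domain t ht
  have hW := h.contDiffOn_harnack
  have hd := (h.hasDerivAt_integral_mul_density ht hW).congr_of_eventuallyEq
    (f₁ := fun s => entropyW (β s) (Ω s) (f s) (τ s)) (by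
      filter_upwards [isOpen_Ioo.mem_nhds ht] with s hs
      exact h.entropyW_eq hs (hβ s hs))
  refine hd.congr_deriv ?_
  have hbdry : ∫ x in frontier (Ω t),
      ⟪gradientWithin (harnackW (Ω t) (f t) (τ t)) (closure (Ω t)) x,
        outerUnitNormal (Ω t) x⟫_ℝ * density (f t) (τ t) x ∂μHE[n] =
      ∫ x in frontier (Ω t),
        ⟪gradientWithin (fun y => harnack T Ω f τ (t, y)) (closure (Ω t)) x,
          outerUnitNormal (Ω t) x⟫_ℝ * density (f t) (τ t) x ∂μHE[n] := by
    refine setIntegral_congr_fun isClosed_frontier.measurableSet fun x hx => ?_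
    have hx' := frontier_subset_closure hx
    simp only [gradientWithin,
      fderivWithin_congr (fun y hy => h.harnackW_eq ht hy) (h.harnackW_eq ht hx')]
  rw [hbdry, ← h.integral_driftLaplacian ht hW, ← integral_const_mul, eq_sub_iff_add_eq,
    ← integral_add (h.integrableOn_mul_density ht (h.continuousOn_materialDeriv hW))
      (h.integrableOn_driftLaplacian ht hW)]
  refine setIntegral_congr_fun hΩ.isOpen.measurableSet fun x hx => ?_
  simp only [← mul_assoc, ← h.evolution_harnack ht hx, materialDeriv]
  ring

end Monotonicity

end EvolvingDomain

theorem mainTheorem2 (n : ℕ) (T : ℝ) (Ω₀ : Set (EuclideanSpace ℝ (Fin (n + 1))))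
    (Ω : ℝ → Set (EuclideanSpace ℝ (Fin (n + 1))))
    (φ : ℝ → EuclideanSpace ℝ (Fin (n + 1)) → EuclideanSpace ℝ (Fin (n + 1)))
    (f : ℝ → EuclideanSpace ℝ (Fin (n + 1)) → ℝ) (τ : ℝ → ℝ)
    (h : IsGradientEvolution T Ω₀ Ω φ f τ) :
    (∀ t ∈ Ioo 0 T, HasDerivAt (fun s => ∫ x in Ω s, density (f s) (τ s) x) 0 t) ∧
    ∀ β : ℝ → EuclideanSpace ℝ (Fin (n + 1)) → ℝ,
      (∀ t ∈ Ioo 0 T, ∀ x ∈ frontier (Ω t),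
        ⟪gradientWithin (f t) (closure (Ω t)) x, outerUnitNormal (Ω t) x⟫_ℝ = β t x) →
      ∀ t ∈ Ioo 0 T,
        HasDerivAt (fun s => entropyW (β s) (Ω s) (f s) (τ s))
          (2 * τ t * (∫ x in Ω t, solitonDefect (f t) (τ t) x * density (f t) (τ t) x) -
            ∫ x in frontier (Ω t),
              ⟪gradientWithin (harnackW (Ω t) (f t) (τ t)) (closure (Ω t)) x,
                outerUnitNormal (Ω t) x⟫_ℝ * density (f t) (τ t) x ∂μHE[n]) t :=
  ⟨fun _ ht => h.hasDerivAt_integral_density ht, fun _ hβ _ ht => h.hasDerivAt_entropyW hβ ht⟩
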